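/- Let $K$ be an algebraically closed field and let $A$ be a basic, indecomposable, finite-dimensional associative unital $K$-algebra with $\dim_K A\ge 2$. Then the following are equivalent: (i) $A$ is isomorphic to a Brauer graph algebra; (ii) $A\cong eBe$ for some biserial weighted surface algebra $B$ over $K$ and some idempotent $e$ of $B$. Here the notions are as follows. A *Brauer graph* $\Gamma$ is a finite connected graph with at least one edge (loops and multiple edges are allowed), together with a cyclic ordering of the half-edges around each vertex $v$ and a multiplicity $e(v)\in\{1,2,\dots\}$ for each vertex $v$. Its quiver $Q_\Gamma$ has the edges of $\Gamma$ as vertices; each half-edge $h$ at a vertex $v$, belonging to an edge $i$, gives one arrow $i\to j$ attached to $v$, where $j$ is the edge of the half-edge that follows $h$ in the cyclic ordering around $v$. The arrows attached to $v$ are cyclically permuted; let $g(\alpha)$ be the successor of $\alpha$, let $v(\alpha)$ be the vertex to which $\alpha$ is attached, let $C_\alpha$ be the product of all arrows attached to $v(\alpha)$ in their cyclic order, starting with $\alpha$, and let $\bar\alpha$ be the other arrow with the same source as $\alpha$. The *Brauer graph algebra* of $\Gamma$ is the quotient of the path algebra $KQ_\Gamma$ by the ideal generated by all paths $\alpha\beta$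 of length $2$ with $\beta\ne g(\alpha)$ and all elements $C_\alpha^{e(v(\alpha))}-C_{\bar\alpha}^{e(v(\bar\alpha))}$. A *directed triangulated surface* $(S,\vec T)$ is a connected compact two-dimensional real manifold $S$, orientable or not, with or without boundary, with a finite triangular cell complex structure $T$ that has at least two edges, and an arbitrary choice of an orientation of each triangle. A triangle has either three different sides, or is self-folded (two of its sides are the same edge, the triangle being folded at their common corner); an edge lying on the boundary of $S$ is exactly once a side of a triangle, and any other edge exactly twice. The quiver $Q=Q(S,\vec T)$ has the edges of $T$ as vertices; each triangle with sides $a,b,c$, in the cyclic order given by its orientation, contributes three arrows $a\to b\to c\to a$, which are permuted cyclically by a permutation $f$ of the arrows, and each boundary edge contributes a loop fixed by $f$. Every vertex of $Q$ is the source of exactly two arrows; let $\bar\alpha$ be the other arrow with the same source as $\alpha$, let $g(\alpha)=\overline{f(\alpha)}$, and let $n_\alpha$ be the size of the $g$-orbit of $\alpha$. Let $m_\bullet$ assign a positive integer $m_\alpha$ to each arrow $\alpha$, constant on $g$-orbits, and put $B_\alpha=\big(\alpha\, g(\alpha)\cdots g^{n_\alpha-1}(\alpha)\big)^{m_\alpha}$.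 The *biserial weighted surface algebra* $B(S,\vec T,m_\bullet)$ is the quotient of the path algebra $KQ$ by the ideal generated by all $\alpha f(\alpha)$ and all $B_\alpha-B_{\bar\alpha}$, where $\alpha$ runs through the arrows of $Q$. -/

import Mathlib

open scoped Manifold

universe u v

/-! ### Quivers and path algebras -/

/-- A finite quiver: finite sets of vertices and of arrows, with source and target maps. -/
structure FinQuiver where
  Vert : Type
  Arr : Type
  [fintypeVert : Fintype Vert]
  [fintypeArr : Fintype Arr]
  src : Arr → Vert
  tgt : Arr → Vert

namespace FinQuiver

attribute [instance] FinQuiver.fintypeVert FinQuiver.fintypeArr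

/-- The arrows from `i` to `j`, making Mathlib's `Quiver.Path` available. -/
instance instQuiverVert (Q : FinQuiver) : Quiver Q.Vert where
  Hom i j := {α : Q.Arr // Q.src α = i ∧ Q.tgt α = j}

/-- The paths of length `≥ 0` in a quiver: source, target, and path between them. -/
structure AllPaths (Q : FinQuiver) where
  start : Q.Vert
  finish : Q.Vert
  path : Quiver.Path start finish

/-- The path algebra `KQ`: the vector space with basis all paths of length `≥ 0`. -/
def PathAlgebra (Q : FinQuiver) (K : Type u) [Field K] : Type u := Q.AllPaths →₀ K

section PathAlgebra

variable (Q : FinQuiver) (K : Type u) [Field K]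

noncomputable instance : AddCommGroup (Q.PathAlgebra K) :=
  inferInstanceAs (AddCommGroup (Q.AllPaths →₀ K))

noncomputable instance : Module K (Q.PathAlgebra K) :=
  inferInstanceAs (Module K (Q.AllPaths →₀ K))

variable {Q}

/-- The basis element of `KQ` given by a path. -/
noncomputable def ofPath (p : Q.AllPaths) : Q.PathAlgebra K := Finsupp.single p 1

open Classical in
/-- The product of two paths: their concatenation (first `p`, then `q`) if `p` ends where `q`
starts, and zero otherwise. -/
noncomputable def pathMul (p q : Q.AllPaths) : Q.PathAlgebra K :=
  if h : q.start = p.finish then ofPath K ⟨p.start, q.finish, p.path.comp (q.path.cast h rfl)⟩ else 0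

/-- The bilinear extension of the product of paths. -/
noncomputable def mulHom : Q.PathAlgebra K →ₗ[K] Q.PathAlgebra K →ₗ[K] Q.PathAlgebra K :=
  Finsupp.linearCombination K (M := Q.PathAlgebra K →ₗ[K] Q.PathAlgebra K)
    fun p => Finsupp.linearCombination K (M := Q.PathAlgebra K) fun q => pathMul K p q

noncomputable instance : Mul (Q.PathAlgebra K) := ⟨fun x y => mulHom K x y⟩

noncomputable instance : One (Q.PathAlgebra K) := ⟨∑ i, ofPath K ⟨i, i, Quiver.Path.nil⟩⟩

variable {K}

theorem PathAlgebra.mul_def (x y : Q.PathAlgebra K) : x * y = mulHom K x y := rfl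

theorem PathAlgebra.one_def :
    (1 : Q.PathAlgebra K) = ∑ i, ofPath K ⟨i, i, Quiver.Path.nil⟩ := rfl

theorem ofPath_mul_ofPath (p q : Q.AllPaths) : ofPath K p * ofPath K q = pathMul K p q := by
  rw [PathAlgebra.mul_def, mulHom, ofPath, ofPath]
  erw [Finsupp.linearCombination_single, one_smul, Finsupp.linearCombination_single, one_smul]

theorem ofPath_mul_comp {i j k : Q.Vert} (p : Quiver.Path i j) (q : Quiver.Path j k) :
    ofPath K ⟨i, j, p⟩ * ofPath K ⟨j, k, q⟩ = ofPath K ⟨i, k, p.comp q⟩ := by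
  rw [ofPath_mul_ofPath, pathMul, dif_pos rfl, Quiver.Path.cast_rfl_rfl]

theorem ofPath_mul_of_ne {p q : Q.AllPaths} (h : p.finish ≠ q.start) :
    ofPath K p * ofPath K q = 0 := by
  rw [ofPath_mul_ofPath, pathMul, dif_neg (Ne.symm h)]

theorem PathAlgebra.induction {P : Q.PathAlgebra K → Prop} (x : Q.PathAlgebra K)
    (zero : P 0) (add : ∀ x y, P x → P y → P (x + y))
    (smul : ∀ (a : K) (p : Q.AllPaths), P (a • ofPath K p)) : P x := by
  refine Finsupp.induction_linear x zero add fun p a => ?_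
  have h := smul a p
  rw [ofPath] at h
  erw [Finsupp.smul_single, smul_eq_mul, mul_one] at h
  exact h

theorem PathAlgebra.mul_add' (x y z : Q.PathAlgebra K) : x * (y + z) = x * y + x * z :=
  (mulHom K x).map_add y z

theorem PathAlgebra.add_mul' (x y z : Q.PathAlgebra K) : (x + y) * z = x * z + y * z := by
  simp only [PathAlgebra.mul_def, map_add, LinearMap.add_apply]

theorem PathAlgebra.smul_mul' (a : K) (x y : Q.PathAlgebra K) : (a • x) * y = a • (x * y) := by
  simp only [PathAlgebra.mul_def, map_smul, LinearMap.smul_apply]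

theorem PathAlgebra.mul_smul' (a : K) (x y : Q.PathAlgebra K) : x * (a • y) = a • (x * y) :=
  (mulHom K x).map_smul a y

theorem PathAlgebra.zero_mul' (x : Q.PathAlgebra K) : 0 * x = 0 := by
  simp only [PathAlgebra.mul_def, map_zero, LinearMap.zero_apply]

theorem PathAlgebra.mul_zero' (x : Q.PathAlgebra K) : x * 0 = 0 :=
  (mulHom K x).map_zero

theorem PathAlgebra.mul_assoc' (x y z : Q.PathAlgebra K) : x * y * z = x * (y * z) := by
  induction x using PathAlgebra.induction with
  | zero => simp only [zero_mul']
  | add x x' hx hx' => simp only [add_mul', hx, hx']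
  | smul a p =>
    simp only [smul_mul']
    congr 1
    induction y using PathAlgebra.induction with
    | zero => simp only [zero_mul', mul_zero']
    | add x x' hx hx' => simp only [mul_add', add_mul', hx, hx']
    | smul b q =>
      simp only [smul_mul', mul_smul']
      congr 1
      induction z using PathAlgebra.induction with
      | zero => simp only [mul_zero']
      | add x x' hx hx' => simp only [mul_add', hx, hx']
      | smul c r =>
        simp only [mul_smul']
        congr 1
        obtain ⟨i, j, p⟩ := p
        obtain ⟨j', k, q⟩ := q
        obtain ⟨k', l, r⟩ := r
        by_cases h : j = j'
        · subst h
          by_cases h' : k = k'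
          · subst h'
            simp only [ofPath_mul_comp, Quiver.Path.comp_assoc]
          · rw [ofPath_mul_comp, ofPath_mul_of_ne h', ofPath_mul_of_ne h', mul_zero']
        · rw [ofPath_mul_of_ne h, zero_mul']
          by_cases h' : k = k'
          · subst h'
            rw [ofPath_mul_comp, ofPath_mul_of_ne (q := ⟨j', l, q.comp r⟩) h]
          · rw [ofPath_mul_of_ne (p := ⟨j', k, q⟩) h', mul_zero']

theorem PathAlgebra.one_mul' (x : Q.PathAlgebra K) : 1 * x = x := by
  induction x using PathAlgebra.induction with
  | zero => simp only [mul_zero']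
  | add x x' hx hx' => simp only [mul_add', hx, hx']
  | smul a p =>
    rw [mul_smul']
    congr 1
    obtain ⟨i, j, p⟩ := p
    rw [one_def, mul_def, map_sum, LinearMap.sum_apply]
    rw [Finset.sum_eq_single i]
    · rw [← mul_def, ofPath_mul_comp, Quiver.Path.nil_comp]
    · intro k _ hk
      rw [← mul_def, ofPath_mul_of_ne hk]
    · exact fun h => absurd (Finset.mem_univ i) h

theorem PathAlgebra.mul_one' (x : Q.PathAlgebra K) : x * 1 = x := by
  induction x using PathAlgebra.induction with
  | zero => simp only [zero_mul']
  | add x x' hx hx' => simp only [add_mul', hx, hx']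
  | smul a p =>
    rw [smul_mul']
    congr 1
    obtain ⟨i, j, p⟩ := p
    rw [one_def, mul_def, map_sum]
    rw [Finset.sum_eq_single j]
    · rw [← mul_def, ofPath_mul_comp, Quiver.Path.comp_nil]
    · intro k _ hk
      rw [← mul_def, ofPath_mul_of_ne (Ne.symm hk)]
    · exact fun h => absurd (Finset.mem_univ j) h

noncomputable instance : Ring (Q.PathAlgebra K) where
  mul_assoc := PathAlgebra.mul_assoc'
  one_mul := PathAlgebra.one_mul'
  mul_one := PathAlgebra.mul_one'
  left_distrib := PathAlgebra.mul_add'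
  right_distrib := PathAlgebra.add_mul'
  zero_mul := PathAlgebra.zero_mul'
  mul_zero := PathAlgebra.mul_zero'
  neg_add_cancel := neg_add_cancel
  sub_eq_add_neg := sub_eq_add_neg
  zsmul := fun n x => n • x
  zsmul_zero' := zero_zsmul
  zsmul_succ' := SubNegMonoid.zsmul_succ'
  zsmul_neg' := SubNegMonoid.zsmul_neg'
  nsmul := fun n x => n • x
  nsmul_zero := zero_nsmul
  nsmul_succ := AddMonoid.nsmul_succ

noncomputable instance : Algebra K (Q.PathAlgebra K) :=
  Algebra.ofModule PathAlgebra.smul_mul' PathAlgebra.mul_smul'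

variable (K)

/-- An arrow, as a path of length one, in the path algebra. -/
noncomputable def arrow (α : Q.Arr) : Q.PathAlgebra K :=
  ofPath K ⟨Q.src α, Q.tgt α, Quiver.Hom.toPath ⟨α, rfl, rfl⟩⟩

/-- The product `α g(α) ⋯ g^{n-1}(α)` in the path algebra. -/
noncomputable def cycleProd (g : Q.Arr → Q.Arr) (n : ℕ) (α : Q.Arr) : Q.PathAlgebra K :=
  ((List.range n).map fun k => arrow K (g^[k] α)).prod

end PathAlgebra

end FinQuiver

/-! ### Brauer graph algebras -/

/-- A Brauer graph: a finite connected graph (loops and multiple edges allowed) with at least one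
edge, a cyclic ordering of the edges around each vertex and a positive multiplicity at each vertex.
The two ends (half-edges) of an edge `i` are `(i, false)` and `(i, true)`, and an edge which is a
loop occurs twice in the cyclic ordering around its vertex. -/
structure BrauerGraph where
  Vertex : Type
  Edge : Type
  [fintypeVertex : Fintype Vertex]
  [fintypeEdge : Fintype Edge]
  /-- the vertex at which a half-edge is attached -/
  vert : Edge × Bool → Vertex
  nonempty_edge : Nonempty Edge
  connected : ∀ v w : Vertex,
    Relation.ReflTransGen (fun a b => ∃ i : Edge, ∃ ε : Bool, vert (i, ε) = a ∧ vert (i, !ε) = b) v w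
  /-- the successor in the cyclic ordering around a vertex -/
  next : Equiv.Perm (Edge × Bool)
  /-- the cycles of `next` are exactly the sets of half-edges around the vertices -/
  sameCycle_next : ∀ h h' : Edge × Bool, next.SameCycle h h' ↔ vert h = vert h'
  mult : Vertex → ℕ
  mult_pos : ∀ v, 0 < mult v

namespace BrauerGraph

attribute [instance] BrauerGraph.fintypeVertex BrauerGraph.fintypeEdge

/-- The Brauer quiver: its vertices are the edges of the Brauer graph, and every half-edge `h` of
an edge `i` gives an arrow, attached to `vert h`, from `i` to the edge following `h` in the cyclic
ordering around `vert h`. -/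
def quiver (Γ : BrauerGraph) : FinQuiver where
  Vert := Γ.Edge
  Arr := Γ.Edge × Bool
  src h := h.1
  tgt h := (Γ.next h).1

/-- The arrow following the given arrow in its cycle of arrows attached to a vertex. -/
def nextArrow (Γ : BrauerGraph) (α : Γ.quiver.Arr) : Γ.quiver.Arr := Γ.next α

/-- The other arrow with the same source. -/
def otherArrow (Γ : BrauerGraph) (α : Γ.quiver.Arr) : Γ.quiver.Arr := (α.1, !α.2)

/-- The vertex to which an arrow is attached. -/
def attachedTo (Γ : BrauerGraph) (α : Γ.quiver.Arr) : Γ.Vertex := Γ.vert α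

/-- The cycle `C_α` of all arrows attached to the vertex `v(α)`, in the given order, starting
with `α`. -/
noncomputable def cyc (Γ : BrauerGraph) (K : Type u) [Field K] (α : Γ.quiver.Arr) :
    Γ.quiver.PathAlgebra K :=
  FinQuiver.cycleProd K Γ.nextArrow
    (Nat.card {β : Γ.quiver.Arr // Γ.attachedTo β = Γ.attachedTo α}) α

/-- The relations of the Brauer graph algebra. -/
inductive Rel (Γ : BrauerGraph) (K : Type u) [Field K] :
    Γ.quiver.PathAlgebra K → Γ.quiver.PathAlgebra K → Prop
  | zero (α β : Γ.quiver.Arr) (hpath : Γ.quiver.tgt α = Γ.quiver.src β)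
      (hne : β ≠ Γ.nextArrow α) :
      Rel Γ K (FinQuiver.arrow K α * FinQuiver.arrow K β) 0
  | cycle (α : Γ.quiver.Arr) :
      Rel Γ K (Γ.cyc K α ^ Γ.mult (Γ.attachedTo α))
        (Γ.cyc K (Γ.otherArrow α) ^ Γ.mult (Γ.attachedTo (Γ.otherArrow α)))

/-- The Brauer graph algebra `B_Γ`: the quotient of the path algebra of the Brauer quiver by the
two-sided ideal generated by the relations. -/
abbrev BrauerAlgebra (Γ : BrauerGraph) (K : Type u) [Field K] : Type u := RingQuot (Γ.Rel K)

end BrauerGraph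

/-- `A` is (isomorphic to) a Brauer graph algebra. -/
def IsBrauerGraphAlgebra (K : Type u) [Field K] (A : Type v) [Ring A] [Algebra K A] : Prop :=
  ∃ Γ : BrauerGraph, Nonempty (A ≃ₐ[K] Γ.BrauerAlgebra K)

/-! ### Weighted biserial quiver algebras -/

/-- A finite `2`-regular quiver with a permutation `f` of its arrows such that `f(α)` starts where
`α` ends. Connectedness is not part of this structure: it is automatic for connected surfaces. -/
structure BiserialQuiver extends FinQuiver where
  f : Equiv.Perm Arr
  src_f : ∀ α, src (f α) = tgt α
  card_src : ∀ i : Vert, Nat.card {α // src α = i} = 2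
  card_tgt : ∀ i : Vert, Nat.card {α // tgt α = i} = 2

namespace BiserialQuiver

theorem exists_bar (Q : BiserialQuiver) (α : Q.Arr) : ∃ β, β ≠ α ∧ Q.src β = Q.src α := by
  classical
  have h := Q.card_src (Q.src α)
  have : Nontrivial {β // Q.src β = Q.src α} := by
    rw [← Finite.one_lt_card_iff_nontrivial, h]
    norm_num
  obtain ⟨⟨β, hβ⟩, hne⟩ := exists_ne (⟨α, rfl⟩ : {β // Q.src β = Q.src α})
  exact ⟨β, fun h => hne (Subtype.ext h), hβ⟩

/-- `ᾱ`: the other arrow starting at the source of `α`. -/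
noncomputable def bar (Q : BiserialQuiver) (α : Q.Arr) : Q.Arr := (Q.exists_bar α).choose

/-- The permutation `g(α) = \overline{f(α)}`. -/
noncomputable def g (Q : BiserialQuiver) (α : Q.Arr) : Q.Arr := Q.bar (Q.f α)

/-- A weight function: a positive integer for every `g`-orbit of arrows. -/
structure Weight (Q : BiserialQuiver) where
  m : Q.Arr → ℕ
  pos : ∀ α, 0 < m α
  orbit : ∀ α, m (Q.g α) = m α

/-- The cycle `B_α = (α g(α) ⋯ g^{n_α - 1}(α))^{m_α}`, with `n_α` the size of the `g`-orbit
of `α`. -/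
noncomputable def cyc (Q : BiserialQuiver) (w : Q.Weight) (K : Type u) [Field K] (α : Q.Arr) :
    Q.toFinQuiver.PathAlgebra K :=
  FinQuiver.cycleProd K Q.g (Function.minimalPeriod Q.g α) α ^ w.m α

/-- The relations of the algebra `B(Q, f, m)`. -/
inductive Rel (Q : BiserialQuiver) (w : Q.Weight) (K : Type u) [Field K] :
    Q.toFinQuiver.PathAlgebra K → Q.toFinQuiver.PathAlgebra K → Prop
  | zero (α : Q.Arr) : Rel Q w K (FinQuiver.arrow K α * FinQuiver.arrow K (Q.f α)) 0
  | cycle (α : Q.Arr) : Rel Q w K (Q.cyc w K α) (Q.cyc w K (Q.bar α))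

/-- The algebra `B(Q, f, m)`: the quotient of the path algebra by the two-sided ideal generated by
the relations. -/
abbrev BiserialAlgebra (Q : BiserialQuiver) (w : Q.Weight) (K : Type u) [Field K] : Type u :=
  RingQuot (Q.Rel w K)

end BiserialQuiver

/-! ### Directed triangulated surfaces -/

/-- The interior of the closed `n`-dimensional simplex (which is homeomorphic to the closed
disk `D^n`). -/
def openSimplex (n : ℕ) : Set (stdSimplex ℝ (Fin (n + 1))) := {x | ∀ i, 0 < x i}

/-- The `i`-th open side of the closed triangle, opposite to the `i`-th corner. -/
def openSide (i : Fin 3) : Set (stdSimplex ℝ (Fin (2 + 1))) := {x | x i = 0 ∧ ∀ j, j ≠ i → 0 < x j}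

/-- The boundary of a two-dimensional topological manifold. -/
abbrev surfaceBoundary (S : Type u) [TopologicalSpace S] [ChartedSpace (EuclideanHalfSpace 2) S] :
    Set S :=
  (𝓡∂ 2).boundary S

/-- A triangulation of a surface by a finite two-dimensional triangular cell complex, with an
arbitrary orientation of each triangle. Different corners of a triangle may be the same `0`-cell. -/
structure DirectedTriangulation (S : Type u) [TopologicalSpace S]
    [ChartedSpace (EuclideanHalfSpace 2) S] where
  /-- the index set of the `n`-dimensional cells -/
  Cell : ℕ → Type
  finite_cell : ∀ n, Finite (Cell n)
  isEmpty_cell : ∀ n, 2 < n → IsEmpty (Cell n)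
  /-- the characteristic maps of the cells -/
  φ : ∀ n, Cell n → stdSimplex ℝ (Fin (n + 1)) → S
  continuous_φ : ∀ n c, Continuous (φ n c)
  /-- `φ` is a homeomorphism from the interior of the simplex onto the open cell -/
  isEmbedding_φ : ∀ n c, Topology.IsEmbedding ((openSimplex n).domRestrict (φ n c))
  /-- the open cells are disjoint -/
  disjoint_cell : Pairwise fun c d : Σ n, Cell n =>
    Disjoint (φ c.1 c.2 '' openSimplex c.1) (φ d.1 d.2 '' openSimplex d.1)
  /-- the union of the open cells is the whole surface -/
  cover : ⋃ c : Σ n, Cell n, φ c.1 c.2 '' openSimplex c.1 = Set.univ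
  /-- the end points of edges are `0`-cells -/
  edge_vertex : ∀ (a : Cell 1) (i : Fin 2), ∃ p : Cell 0,
    φ 1 a (stdSimplex.vertex i) ∈ Set.range (φ 0 p)
  /-- the corners of triangles are `0`-cells -/
  triangle_vertex : ∀ (t : Cell 2) (i : Fin 3), ∃ p : Cell 0,
    φ 2 t (stdSimplex.vertex i) ∈ Set.range (φ 0 p)
  /-- the edge which is the `i`-th side of the triangle `t` -/
  side : Cell 2 → Fin 3 → Cell 1
  /-- each open side of a triangle is mapped bijectively onto an open edge -/
  bijOn_side : ∀ t i, Set.BijOn (φ 2 t) (openSide i) (φ 1 (side t i) '' openSimplex 1)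
  /-- a triangle with two equal sides is self-folded: the two sides are glued by folding the
  triangle at their common corner, which becomes an inner point of the resulting disk -/
  self_folded : ∀ (t : Cell 2) (i j k : Fin 3), i ≠ j → k ≠ i → k ≠ j → side t i = side t j →
    φ 2 t (stdSimplex.vertex k) ≠ φ 2 t (stdSimplex.vertex i) ∧
      φ 2 t (stdSimplex.vertex k) ≠ φ 2 t (stdSimplex.vertex j)
  /-- an edge not on the boundary is exactly twice a side of a triangle (of two different
  triangles, or of one self-folded triangle), and an edge on the boundary exactly once -/
  edge_cases : ∀ a : Cell 1,
    (Nat.card {p : Cell 2 × Fin 3 // side p.1 p.2 = a} = 2 ∧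
        ¬ Set.range (φ 1 a) ⊆ surfaceBoundary S) ∨
      (Nat.card {p : Cell 2 × Fin 3 // side p.1 p.2 = a} = 1 ∧
        Set.range (φ 1 a) ⊆ surfaceBoundary S)
  /-- there are at least two edges -/
  two_le_card_edge : 2 ≤ Nat.card (Cell 1)
  /-- the chosen orientation of each triangle, i.e. one of the two cyclic orderings
  `(0 1 2)`, `(2 1 0)` of its sides -/
  orient : Cell 2 → Bool

namespace DirectedTriangulation

variable {S : Type u} [TopologicalSpace S] [ChartedSpace (EuclideanHalfSpace 2) S]

/-- The triangles. -/
abbrev Triangle (T : DirectedTriangulation S) : Type := T.Cell 2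

/-- The edges. -/
abbrev Edge (T : DirectedTriangulation S) : Type := T.Cell 1

/-- The boundary edges: those lying on the boundary of the surface. -/
abbrev BoundaryEdge (T : DirectedTriangulation S) : Type :=
  {a : T.Edge // Set.range (T.φ 1 a) ⊆ surfaceBoundary S}

/-- The arrows of the quiver: one for each side of each triangle and one for each boundary edge. -/
abbrev Arrow (T : DirectedTriangulation S) : Type := (T.Triangle × Fin 3) ⊕ T.BoundaryEdge

instance (T : DirectedTriangulation S) (n : ℕ) : Finite (T.Cell n) := T.finite_cell n

/-- The rotation of the sides of the triangle `t` in the direction of the orientation of `t`. -/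
def rotate (T : DirectedTriangulation S) (t : T.Triangle) : Equiv.Perm (Fin 3) :=
  if T.orient t then finRotate 3 else (finRotate 3)⁻¹

/-- The source of an arrow: the arrow of the side `i` of `t` starts at this side; the arrow of a
boundary edge is a loop at this edge. -/
def arrowSrc (T : DirectedTriangulation S) : T.Arrow → T.Edge
  | Sum.inl p => T.side p.1 p.2
  | Sum.inr a => a.1

/-- The permutation `f` of the arrows: it rotates the three arrows of each triangle and fixes the
loops at boundary edges. -/
def arrowPerm (T : DirectedTriangulation S) : Equiv.Perm T.Arrow :=
  Equiv.sumCongr (Equiv.prodShear (Equiv.refl _) T.rotate) (Equiv.refl _)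

theorem card_arrowSrc (T : DirectedTriangulation S) (a : T.Edge) :
    Nat.card {α : T.Arrow // T.arrowSrc α = a} = 2 := by
  have e : {α : T.Arrow // T.arrowSrc α = a} ≃
      {p : T.Triangle × Fin 3 // T.side p.1 p.2 = a} ⊕ {b : T.BoundaryEdge // b.1 = a} :=
    Equiv.subtypeSum
  rw [Nat.card_congr e, Nat.card_sum]
  rcases T.edge_cases a with ⟨h, hb⟩ | ⟨h, hb⟩
  · have : IsEmpty {b : T.BoundaryEdge // b.1 = a} := ⟨fun b => hb (b.2 ▸ b.1.2)⟩
    rw [h, Nat.card_of_isEmpty]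
  · have : Unique {b : T.BoundaryEdge // b.1 = a} :=
      { default := ⟨⟨a, hb⟩, rfl⟩
        uniq := fun b => Subtype.ext (Subtype.ext b.2) }
    rw [h, Nat.card_unique]

/-- The quiver `Q(S, T)` with its permutation `f`: the vertices are the edges of the triangulation;
each triangle with sides `a, b, c`, in the order given by its orientation, gives arrows
`a → b → c → a` permuted cyclically by `f`, and each boundary edge gives a loop fixed by `f`. -/
noncomputable def quiver (T : DirectedTriangulation S) : BiserialQuiver where
  Vert := T.Edge
  Arr := T.Arrow
  fintypeVert := Fintype.ofFinite _
  fintypeArr := Fintype.ofFinite _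
  src := T.arrowSrc
  tgt α := T.arrowSrc (T.arrowPerm α)
  f := T.arrowPerm
  src_f _ := rfl
  card_src := T.card_arrowSrc
  card_tgt a := by
    rw [← T.card_arrowSrc a]
    exact Nat.card_congr (T.arrowPerm.subtypeEquiv fun _ => Iff.rfl)

end DirectedTriangulation

/-! ### Idempotent algebras, basic and indecomposable algebras -/

/-- The `K`-algebra structure of the idempotent algebra `eBe`, whose ring structure is Mathlib's
`IsIdempotentElem.Corner`. -/
instance cornerAlgebra {K : Type u} [Field K] {B : Type v} [Ring B] [Algebra K B] {e : B}
    (he : IsIdempotentElem e) : Algebra K he.Corner where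
  smul k x := ⟨k • x.1, by
    obtain ⟨b, hb⟩ := x.2
    exact ⟨k • b, by simp only [mul_smul_comm, smul_mul_assoc]; exact congrArg (k • ·) hb⟩⟩
  algebraMap :=
    { toFun := fun k => ⟨k • e, ⟨k • e, by
        simp only [mul_smul_comm, smul_mul_assoc, he.eq]⟩⟩
      map_one' := Subtype.ext (one_smul K e)
      map_mul' := fun k l => Subtype.ext <| by
        change (k * l) • e = (k • e) * (l • e)
        rw [smul_mul_smul_comm, he.eq]
      map_zero' := Subtype.ext (zero_smul K e)
      map_add' := fun k l => Subtype.ext (add_smul k l e) }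
  commutes' := fun k x => Subtype.ext <| by
    have hx := (Subsemigroup.mem_corner_iff he).1 x.2
    change (k • e) * x.1 = x.1 * (k • e)
    rw [smul_mul_assoc, mul_smul_comm, hx.1, hx.2]
  smul_def' := fun k x => Subtype.ext <| by
    have hx := (Subsemigroup.mem_corner_iff he).1 x.2
    change k • x.1 = (k • e) * x.1
    rw [smul_mul_assoc, hx.1]

/-- A finite-dimensional algebra over an algebraically closed field `K` is basic if its quotient
by the radical is a direct product of copies of `K`. -/
def IsBasicAlgebra (K : Type u) [Field K] (A : Type v) [Ring A] [Algebra K A] : Prop :=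
  ∃ n : ℕ, Nonempty ((A ⧸ Ring.jacobson A) ≃ₐ[K] (Fin n → K))

/-- An algebra is indecomposable if it is nonzero and is not a direct product of two nonzero
algebras, i.e. if `0` and `1` are its only central idempotents. -/
def IsIndecomposableAlgebra (A : Type v) [Ring A] : Prop :=
  Nontrivial A ∧ ∀ e : A, IsIdempotentElem e → (∀ a : A, e * a = a * e) → e = 0 ∨ e = 1

/-! Both kinds of algebras have the form `B(Q, f, m)` for a 2-regular quiver `Q` with a permutation
`f` of its arrows, and both implications rest on one comparison of such algebras. A Brauer graph is
such a quiver: the half-edges are the arrows, `next` is `g`, and `f` is `next` followed by the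
exchange of the two halves of an edge (`BrauerGraph.nonempty_algEquiv`).

A nonzero product of arrows in `B(Q, f, m)` runs along a `g`-orbit. The vertex idempotents, one
socle element `B_α` per vertex and the proper nontrivial initial subpaths of the cycles `B_α` form a
basis (`span_basisVec`, `linearIndependent_basisVec`). If `e` is the sum of the idempotents of a set
`I` of vertices, then `eBe` is spanned by the walks along `g` that start and end in `I`. So `eBe` is
the algebra of the quiver whose arrows are those starting in `I`, with `g` replaced by its first
return map (`FirstReturn.algEquiv`).

From (ii) to (i): the augmentation onto a product of copies of `K` has a kernel of nilpotent
elements. Every idempotent is therefore conjugate to a sum of vertex idempotents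
(`exists_unit_conj`), and `eBe` is again some `B(Q', f', m')` (`exists_restrict`). Indecomposability
makes `Q'` connected, and `Q'` is then read as a Brauer graph (`isBrauerGraphAlgebra`).

From (i) to (ii): the Brauer quiver must be a first return of the quiver of a surface. Take two
triangles `(h, true)`, `(h, false)` for every half-edge `h`, number their sides by 0, 1, 2, and glue
sides of equal number in pairs by fixed-point-free involutions `s 0`, `s 1`, `s 2`, keeping
barycentric coordinates. If `f` sends side `i` to side `i + 1` in each triangle, then `g` leads from
side `i` of `φ` to side `i + 1` of `s (i + 1) φ`. Three steps from side 0 of `φ` reach side 0 of `s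
0 (s 2 (s 1 φ))`. Here `s 0` exchanges the halves of an edge, `s 1` exchanges the two triangles of
`h`, and `s 2` is chosen so that the return from `(h, true)` is `(next h, true)`
(`involution_next`).

The glued space is a closed surface because the triangles around a corner form an orbit of two
fixed-point-free involutions: an even number of sectors, cyclically arranged, which fill a disk
(`nonempty_star_homeomorph`). It is connected because the Brauer graph is. -/

namespace FinQuiver

/-! ### Maps out of a path algebra -/

section System

variable {Q : FinQuiver} {C : Type v} [Ring C]

/-- The idempotents of the vertices and the elements of the arrows in an algebra over a path
algebra. -/
structure IsPathSystem (Q : FinQuiver) (E : Q.Vert → C) (X : Q.Arr → C) : Prop where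
  mul_self : ∀ i, E i * E i = E i
  mul_ne : ∀ i j, i ≠ j → E i * E j = 0
  sum_eq : ∑ i, E i = 1
  src_mul : ∀ α, E (Q.src α) * X α = X α
  mul_tgt : ∀ α, X α * E (Q.tgt α) = X α

/-- The list of the arrows of a path. -/
def arrowList {i : Q.Vert} : ∀ {j : Q.Vert}, Quiver.Path i j → List Q.Arr
  | _, .nil => []
  | _, .cons p α => arrowList p ++ [α.1]

@[simp] theorem arrowList_nil (i : Q.Vert) : arrowList (Quiver.Path.nil : Quiver.Path i i) = [] :=
  rfl

@[simp] theorem arrowList_cons {i j k : Q.Vert} (p : Quiver.Path i j) (α : j ⟶ k) :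
    arrowList (p.cons α) = arrowList p ++ [α.1] := rfl

theorem arrowList_comp {i j : Q.Vert} (p : Quiver.Path i j) {k : Q.Vert} (q : Quiver.Path j k) :
    arrowList (p.comp q) = arrowList p ++ arrowList q := by
  induction q with
  | nil => simp
  | cons q α ih => simp [ih]

theorem AllPaths.eq_nil {p : Q.AllPaths} (h : arrowList p.path = []) :
    p = ⟨p.start, p.start, Quiver.Path.nil⟩ := by
  obtain ⟨i, j, p⟩ := p
  cases p with
  | nil => rfl
  | cons p α => simp at h

/-- The value of a path in a system. -/
def pathVal (E : Q.Vert → C) (X : Q.Arr → C) (p : Q.AllPaths) : C :=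
  E p.start * ((arrowList p.path).map X).prod

theorem IsPathSystem.start_mul_pathVal {E : Q.Vert → C} {X : Q.Arr → C} (h : Q.IsPathSystem E X)
    (p : Q.AllPaths) : E p.start * pathVal E X p = pathVal E X p := by
  rw [pathVal, ← mul_assoc, h.mul_self]

theorem IsPathSystem.pathVal_mul_finish {E : Q.Vert → C} {X : Q.Arr → C}
    (h : Q.IsPathSystem E X) (p : Q.AllPaths) : pathVal E X p * E p.finish = pathVal E X p := by
  obtain ⟨i, j, p⟩ := p
  cases p with
  | nil => simp [pathVal, h.mul_self]
  | cons p α =>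
    obtain ⟨α, rfl, rfl⟩ := α
    simp [pathVal, mul_assoc, h.mul_tgt]

theorem IsPathSystem.pathVal_mul_comp {E : Q.Vert → C} {X : Q.Arr → C}
    (h : Q.IsPathSystem E X) {i j k : Q.Vert} (p : Quiver.Path i j) (q : Quiver.Path j k) :
    pathVal E X ⟨i, j, p⟩ * pathVal E X ⟨j, k, q⟩ = pathVal E X ⟨i, k, p.comp q⟩ := by
  conv_lhs => rw [pathVal.eq_def E X ⟨j, k, q⟩, ← mul_assoc, h.pathVal_mul_finish ⟨i, j, p⟩]
  simp [pathVal, arrowList_comp, mul_assoc]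

theorem IsPathSystem.pathVal_mul_of_ne {E : Q.Vert → C} {X : Q.Arr → C}
    (h : Q.IsPathSystem E X) {p q : Q.AllPaths} (hpq : p.finish ≠ q.start) :
    pathVal E X p * pathVal E X q = 0 := by
  rw [← h.pathVal_mul_finish, ← h.start_mul_pathVal q, mul_assoc, ← mul_assoc (E p.finish),
    h.mul_ne _ _ hpq, zero_mul, mul_zero]

end System

section Lift

variable {Q : FinQuiver} {K : Type u} [Field K] {C : Type v} [Ring C] [Algebra K C]

/-- The linear map on the path algebra with given values on paths. -/
noncomputable def linearLift {M : Type v} [AddCommGroup M] [Module K M] (φ : Q.AllPaths → M) :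
    Q.PathAlgebra K →ₗ[K] M :=
  Finsupp.linearCombination K φ

@[simp] theorem linearLift_ofPath {M : Type v} [AddCommGroup M] [Module K M] (φ : Q.AllPaths → M)
    (p : Q.AllPaths) : linearLift φ (ofPath K p) = φ p := by
  rw [linearLift, ofPath]
  erw [Finsupp.linearCombination_single, one_smul]

/-- The algebra homomorphism from the path algebra given by a system. -/
noncomputable def IsPathSystem.lift {E : Q.Vert → C} {X : Q.Arr → C} (h : Q.IsPathSystem E X) :
    Q.PathAlgebra K →ₐ[K] C :=
  AlgHom.ofLinearMap (linearLift (pathVal E X))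
    (by simp [PathAlgebra.one_def, pathVal, h.sum_eq])
    (by
      intro x y
      induction x using PathAlgebra.induction with
      | zero => simp
      | add x x' hx hx' => simp [add_mul, hx, hx']
      | smul a p =>
        rw [smul_mul_assoc, map_smul, map_smul, smul_mul_assoc]
        congr 1
        induction y using PathAlgebra.induction with
        | zero => simp
        | add x x' hx hx' => simp [mul_add, hx, hx']
        | smul b q =>
          rw [mul_smul_comm, map_smul, map_smul, mul_smul_comm]
          congr 1
          by_cases hpq : p.finish = q.start
          · obtain ⟨i, j, p⟩ := p
            obtain ⟨j', k, q⟩ := q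
            obtain rfl : j = j' := hpq
            rw [ofPath_mul_comp, linearLift_ofPath, linearLift_ofPath, linearLift_ofPath,
              h.pathVal_mul_comp]
          · rw [ofPath_mul_of_ne hpq, map_zero, linearLift_ofPath, linearLift_ofPath,
              h.pathVal_mul_of_ne hpq])

theorem IsPathSystem.lift_ofPath {E : Q.Vert → C} {X : Q.Arr → C} (h : Q.IsPathSystem E X)
    (p : Q.AllPaths) : h.lift (ofPath K p) = pathVal E X p :=
  linearLift_ofPath _ _

variable (K) in
/-- The idempotent of a vertex in the path algebra. -/
noncomputable def vertex (i : Q.Vert) : Q.PathAlgebra K := ofPath K ⟨i, i, Quiver.Path.nil⟩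

@[simp] theorem IsPathSystem.lift_vertex {E : Q.Vert → C} {X : Q.Arr → C}
    (h : Q.IsPathSystem E X) (i : Q.Vert) : h.lift (vertex K i) = E i := by
  simp [vertex, h.lift_ofPath, pathVal]

@[simp] theorem IsPathSystem.lift_arrow {E : Q.Vert → C} {X : Q.Arr → C}
    (h : Q.IsPathSystem E X) (α : Q.Arr) : h.lift (arrow K α) = X α := by
  simp [arrow, h.lift_ofPath, pathVal, Quiver.Hom.toPath, h.src_mul]

variable (Q K) in
theorem isPathSystem : Q.IsPathSystem (vertex K) (arrow K) where
  mul_self i := by rw [vertex, ofPath_mul_comp, Quiver.Path.nil_comp]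
  mul_ne i j h := by rw [vertex, vertex, ofPath_mul_of_ne h]
  sum_eq := PathAlgebra.one_def.symm
  src_mul α := by rw [vertex, arrow, ofPath_mul_comp, Quiver.Path.nil_comp]
  mul_tgt α := by rw [vertex, arrow, ofPath_mul_comp, Quiver.Path.comp_nil]

theorem IsPathSystem.map {E : Q.Vert → C} {X : Q.Arr → C} (h : Q.IsPathSystem E X)
    {D : Type*} [Ring D] (F : C →+* D) : Q.IsPathSystem (F ∘ E) (F ∘ X) where
  mul_self i := by simp [← map_mul, h.mul_self]
  mul_ne i j hij := by simp [← map_mul, h.mul_ne i j hij]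
  sum_eq := by simp [← map_sum, h.sum_eq]
  src_mul α := by simp [← map_mul, h.src_mul]
  mul_tgt α := by simp [← map_mul, h.mul_tgt]

theorem pathVal_vertex_arrow (p : Q.AllPaths) : pathVal (vertex K) (arrow K) p = ofPath K p := by
  obtain ⟨i, j, p⟩ := p
  induction p with
  | nil => simp [pathVal, vertex]
  | cons p α ih =>
    obtain ⟨α, rfl, rfl⟩ := α
    have := ofPath_mul_comp (K := K) p (Quiver.Hom.toPath ⟨α, rfl, rfl⟩)
    rw [Quiver.Path.comp_toPath_eq_cons] at this
    rw [← this, ← ih]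
    simp [pathVal, mul_assoc, arrow]

/-- Products of basis elements of `KQ` are basis elements or zero, never proper sums. Recording the
arrow list of the result allows later arguments to work with lists instead of paths. -/
theorem ofPath_mul_arrow_prod (p : Q.AllPaths) (l : List Q.Arr) :
    ofPath K p * (l.map (arrow K)).prod = 0 ∨
      ∃ q : Q.AllPaths, q.start = p.start ∧ arrowList q.path = arrowList p.path ++ l ∧
        ofPath K p * (l.map (arrow K)).prod = ofPath K q := by
  induction l using List.reverseRecOn with
  | nil => exact Or.inr ⟨p, rfl, by simp, by simp⟩
  | append_singleton l α ih =>
    rw [List.map_append, List.prod_append, ← mul_assoc]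
    rcases ih with h | ⟨⟨i, j, q⟩, h1, h2, h3⟩
    · left; rw [h, zero_mul]
    · rw [h3, List.map_singleton, List.prod_singleton]
      by_cases h : j = Q.src α
      · subst h
        refine Or.inr ⟨⟨i, _, q.comp (Quiver.Hom.toPath ⟨α, rfl, rfl⟩)⟩, h1, ?_,
          ofPath_mul_comp _ _⟩
        have h2' : arrowList q = _ := h2
        rw [arrowList_comp, h2', List.append_assoc]
        rfl
      · left
        rw [arrow, ofPath_mul_of_ne h]

theorem ofPath_mul_arrow_prod_mul (p q : Q.AllPaths) (l : List Q.Arr) :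
    ofPath K p * (l.map (arrow K)).prod * ofPath K q = 0 ∨
      ∃ r : Q.AllPaths, r.start = p.start ∧
        arrowList r.path = arrowList p.path ++ l ++ arrowList q.path ∧
        ofPath K p * (l.map (arrow K)).prod * ofPath K q = ofPath K r := by
  rcases ofPath_mul_arrow_prod (K := K) p l with h | ⟨⟨i, j, r⟩, h1, h2, h3⟩
  · left; rw [h, zero_mul]
  · rw [h3]
    obtain ⟨j', k, q⟩ := q
    by_cases h : j = j'
    · subst h
      refine Or.inr ⟨⟨i, k, r.comp q⟩, h1, ?_, ofPath_mul_comp _ _⟩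
      have h2' : arrowList r = _ := h2
      simp only [arrowList_comp, h2']
    · left
      exact ofPath_mul_of_ne h

end Lift

end FinQuiver

/-- A linear functional which is compatible with the relations descends to the quotient. -/
theorem RingQuot.functional_eq {K : Type u} [Field K] {R : Type v} [Ring R] [Algebra K R]
    (r : R → R → Prop) (L : R →ₗ[K] K)
    (h : ∀ x y, r x y → ∀ a b, L (a * x * b) = L (a * y * b)) {x y : R}
    (hxy : RingQuot.mkAlgHom K r x = RingQuot.mkAlgHom K r y) : L x = L y := by
  -- The congruence of all pairs that `L` cannot distinguish inside any two-sided product. It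
  -- contains the relations, so the quotient map by `c` factors through `RingQuot`; `a = b = 1` then
  -- gives the claim.
  let c : RingCon R :=
    { r := fun x y => ∀ a b, L (a * x * b) = L (a * y * b)
      iseqv := ⟨fun _ _ _ => rfl, fun h a b => (h a b).symm, fun h h' a b => (h a b).trans (h' a b)⟩
      mul' := fun {w x y z} h h' a b => by
        have h1 := h a (y * b)
        have h2 := h' (a * x) b
        simp only [mul_assoc] at h1 h2 ⊢
        rw [h1, h2]
      add' := fun h h' a b => by simp only [mul_add, add_mul, map_add, h a b, h' a b] }
  have hr : ∀ ⦃x y⦄, r x y → c.mk' x = c.mk' y := fun x y hxy => (RingCon.eq c).2 (h x y hxy)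
  have h1 : RingQuot.mkRingHom r x = RingQuot.mkRingHom r y := by
    rw [← RingQuot.mkAlgHom_coe K]
    exact hxy
  have h2 := congrArg (RingQuot.lift ⟨c.mk', hr⟩) h1
  rw [RingQuot.lift_mkRingHom_apply, RingQuot.lift_mkRingHom_apply] at h2
  have h3 := (RingCon.eq c).1 h2 1 1
  simpa using h3

/-! ### Arrows, `g`-orbits and walks in a biserial quiver -/

namespace BiserialQuiver

section Arrows

variable (Q : BiserialQuiver)

theorem bar_ne (α : Q.Arr) : Q.bar α ≠ α := (Q.exists_bar α).choose_spec.1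

@[simp] theorem src_bar (α : Q.Arr) : Q.src (Q.bar α) = Q.src α :=
  (Q.exists_bar α).choose_spec.2

variable {Q}

theorem eq_bar_of_ne {α β : Q.Arr} (hs : Q.src β = Q.src α) (hne : β ≠ α) : β = Q.bar α := by
  obtain ⟨y, -, hy⟩ := (Nat.card_eq_two_iff' (⟨α, rfl⟩ : {β // Q.src β = Q.src α})).1
    (Q.card_src (Q.src α))
  have h1 := hy ⟨β, hs⟩ fun h => hne (congrArg Subtype.val h)
  have h2 := hy ⟨Q.bar α, Q.src_bar α⟩ fun h => Q.bar_ne α (congrArg Subtype.val h)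
  exact congrArg Subtype.val (h1.trans h2.symm)

theorem eq_or_eq_bar {α β : Q.Arr} (hs : Q.src β = Q.src α) : β = α ∨ β = Q.bar α := by
  by_cases h : β = α
  · exact Or.inl h
  · exact Or.inr (eq_bar_of_ne hs h)

variable (Q)

@[simp] theorem bar_bar (α : Q.Arr) : Q.bar (Q.bar α) = α :=
  (eq_bar_of_ne (Q.src_bar α).symm (Q.bar_ne α).symm).symm

@[simp] theorem src_g (α : Q.Arr) : Q.src (Q.g α) = Q.tgt α := by
  rw [g, src_bar, Q.src_f]

@[simp] theorem bar_g (α : Q.Arr) : Q.bar (Q.g α) = Q.f α := by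
  rw [g, bar_bar]

theorem f_ne_g (α : Q.Arr) : Q.f α ≠ Q.g α := by
  rw [← bar_g]
  exact Q.bar_ne _

theorem g_injective : Function.Injective Q.g := fun α β h => by
  have := congrArg Q.bar h
  rw [bar_g, bar_g] at this
  exact Q.f.injective this

theorem exists_src_eq (i : Q.Vert) : ∃ α, Q.src α = i := by
  have : Nonempty {α // Q.src α = i} := by
    by_contra h
    have := Q.card_src i
    rw [not_nonempty_iff] at h
    rw [Nat.card_of_isEmpty] at this
    omega
  exact ⟨this.some.1, this.some.2⟩

/-- An arrow with the given source. -/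
noncomputable def arrowAt (i : Q.Vert) : Q.Arr := (Q.exists_src_eq i).choose

@[simp] theorem src_arrowAt (i : Q.Vert) : Q.src (Q.arrowAt i) = i :=
  (Q.exists_src_eq i).choose_spec

theorem period_pos (α : Q.Arr) : 0 < Function.minimalPeriod Q.g α :=
  Function.minimalPeriod_pos_of_mem_periodicPts (Q.g_injective.mem_periodicPts α)

/-- The arrows `α, g(α), …, g^{k-1}(α)`. -/
noncomputable def gList (α : Q.Arr) (k : ℕ) : List Q.Arr := (List.range k).map fun l => Q.g^[l] α

@[simp] theorem gList_zero (α : Q.Arr) : Q.gList α 0 = [] := rfl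

@[simp] theorem length_gList (α : Q.Arr) (k : ℕ) : (Q.gList α k).length = k := by simp [gList]

theorem getElem?_gList (α : Q.Arr) {k l : ℕ} (h : l < k) :
    (Q.gList α k)[l]? = some (Q.g^[l] α) := by
  simp [gList, h]

theorem gList_add (α : Q.Arr) (k l : ℕ) :
    Q.gList α (k + l) = Q.gList α k ++ Q.gList (Q.g^[k] α) l := by
  rw [gList, List.range_add, List.map_append, List.map_map]
  congr 1
  refine List.map_congr_left fun x _ => ?_
  simp only [Function.comp_apply]
  rw [add_comm, Function.iterate_add_apply]

theorem gList_succ (α : Q.Arr) (k : ℕ) :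
    Q.gList α (k + 1) = Q.gList α k ++ [Q.g^[k] α] := by
  rw [gList_add]
  rfl

variable {Q}

theorem Weight.m_iterate (w : Q.Weight) (k : ℕ) (α : Q.Arr) : w.m (Q.g^[k] α) = w.m α := by
  induction k with
  | zero => rfl
  | succ k ih => rw [Function.iterate_succ_apply', w.orbit, ih]

/-- The length of the cycle `B_α`. -/
noncomputable def Weight.len (w : Q.Weight) (α : Q.Arr) : ℕ :=
  Function.minimalPeriod Q.g α * w.m α

theorem Weight.len_pos (w : Q.Weight) (α : Q.Arr) : 0 < w.len α :=
  Nat.mul_pos (Q.period_pos α) (w.pos α)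

theorem Weight.len_iterate (w : Q.Weight) (k : ℕ) (α : Q.Arr) : w.len (Q.g^[k] α) = w.len α := by
  rw [len, len, w.m_iterate,
    Function.minimalPeriod_apply_iterate (Q.g_injective.mem_periodicPts α)]

theorem Weight.iterate_len (w : Q.Weight) (α : Q.Arr) : Q.g^[w.len α] α = α :=
  (Function.isPeriodicPt_minimalPeriod Q.g α).mul_const _

theorem cyc_eq (w : Q.Weight) (K : Type u) [Field K] (α : Q.Arr) :
    Q.cyc w K α = ((Q.gList α (w.len α)).map (FinQuiver.arrow K)).prod := by
  rw [cyc, Weight.len]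
  generalize w.m α = m
  have h0 : FinQuiver.cycleProd K Q.g (Function.minimalPeriod Q.g α) α =
      ((Q.gList α (Function.minimalPeriod Q.g α)).map (FinQuiver.arrow K)).prod := by
    rw [FinQuiver.cycleProd, gList, List.map_map]
    rfl
  rw [h0]
  induction m with
  | zero => simp
  | succ m ih =>
    rw [pow_succ, ih, Nat.mul_succ, gList_add, List.map_append, List.prod_append]
    congr 4
    exact ((Function.isPeriodicPt_minimalPeriod Q.g α).mul_const _).eq.symm

end Arrows

section Walk

variable {Q : BiserialQuiver} {C : Type v} [Ring C]

/-- The product `α g(α) ⋯ g^{k-1}(α)` in a system, with the value `e_i` for `k = 0`. -/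
noncomputable def walk (E : Q.Vert → C) (X : Q.Arr → C) (α : Q.Arr) (k : ℕ) : C :=
  E (Q.src α) * ((Q.gList α k).map X).prod

variable {E : Q.Vert → C} {X : Q.Arr → C}

theorem walk_zero (α : Q.Arr) : walk E X α 0 = E (Q.src α) := by simp [walk]

theorem walk_succ (α : Q.Arr) (k : ℕ) :
    walk E X α (k + 1) = walk E X α k * X (Q.g^[k] α) := by
  simp [walk, gList_succ, mul_assoc]

variable (h : Q.IsPathSystem E X)
include h

theorem src_mul_walk (α : Q.Arr) (k : ℕ) : E (Q.src α) * walk E X α k = walk E X α k := by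
  rw [walk, ← mul_assoc, h.mul_self]

theorem walk_mul_src (α : Q.Arr) (k : ℕ) :
    walk E X α k * E (Q.src (Q.g^[k] α)) = walk E X α k := by
  cases k with
  | zero => simp [walk_zero, h.mul_self]
  | succ k => rw [walk_succ, mul_assoc, Function.iterate_succ_apply', src_g, h.mul_tgt]

theorem walk_mul_walk (α : Q.Arr) (k l : ℕ) :
    walk E X α k * walk E X (Q.g^[k] α) l = walk E X α (k + l) := by
  conv_lhs => rw [walk.eq_def E X (Q.g^[k] α), ← mul_assoc, walk_mul_src h]
  rw [walk, walk, gList_add, List.map_append, List.prod_append, mul_assoc]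

theorem walk_one (α : Q.Arr) : walk E X α 1 = X α := by
  simp [walk_succ, walk_zero, h.src_mul]

theorem walk_mul_walk_of_ne {α β : Q.Arr} {k l : ℕ} (hne : Q.src (Q.g^[k] α) ≠ Q.src β) :
    walk E X α k * walk E X β l = 0 := by
  rw [← walk_mul_src h, ← src_mul_walk h β, mul_assoc, ← mul_assoc (E _) (E _), h.mul_ne _ _ hne,
    zero_mul, mul_zero]

theorem src_mul_walk_of_ne {i : Q.Vert} {α : Q.Arr} {k : ℕ} (hne : i ≠ Q.src α) :
    E i * walk E X α k = 0 := by
  rw [← src_mul_walk h, ← mul_assoc, h.mul_ne _ _ hne, zero_mul]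

theorem walk_mul_src_of_ne {i : Q.Vert} {α : Q.Arr} {k : ℕ} (hne : Q.src (Q.g^[k] α) ≠ i) :
    walk E X α k * E i = 0 := by
  rw [← walk_mul_src h, mul_assoc, h.mul_ne _ _ hne, mul_zero]

/-- The first arrow of a nontrivial walk absorbs the idempotent of its source. -/
theorem walk_eq_prod (α : Q.Arr) {k : ℕ} (hk : 0 < k) :
    walk E X α k = ((Q.gList α k).map X).prod := by
  obtain ⟨k, rfl⟩ := Nat.exists_eq_add_of_lt hk
  rw [walk, zero_add, add_comm, gList_add, List.map_append, List.prod_append, ← mul_assoc]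
  congr 1
  simp [gList, h.src_mul]

end Walk

/-- A system which satisfies the relations of the algebra `B(Q, f, m)`. -/
structure IsSystem (Q : BiserialQuiver) (w : Q.Weight) {C : Type v} [Ring C] (E : Q.Vert → C)
    (X : Q.Arr → C) : Prop extends Q.IsPathSystem E X where
  mul_f : ∀ α, X α * X (Q.f α) = 0
  cycle : ∀ α, walk E X α (w.len α) = walk E X (Q.bar α) (w.len (Q.bar α))

section System

variable {Q : BiserialQuiver} {w : Q.Weight} {C : Type v} [Ring C]
variable {E : Q.Vert → C} {X : Q.Arr → C}

/-- If `γ` is the last arrow of the first walk, the second one starts with `bar (g γ) = f γ`, and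
the product contains `γ f(γ) = 0`. -/
theorem IsSystem.walk_mul_walk_bar (h : Q.IsSystem w E X) (α : Q.Arr) {k l : ℕ} (hk : 0 < k)
    (hl : 0 < l) : walk E X α k * walk E X (Q.bar (Q.g^[k] α)) l = 0 := by
  obtain ⟨k, rfl⟩ := Nat.exists_eq_add_of_lt hk
  obtain ⟨l, rfl⟩ := Nat.exists_eq_add_of_lt hl
  simp only [zero_add]
  rw [add_comm l 1, ← walk_mul_walk h.toIsPathSystem _ 1 l, walk_one h.toIsPathSystem,
    Function.iterate_succ_apply', bar_g, walk_succ, ← mul_assoc, mul_assoc _ (X _) (X _), h.mul_f,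
    mul_zero, zero_mul]

/-- The cycle relation replaces the initial `B_α` by `B_ᾱ`, which returns to `ᾱ` under `g`. The
remaining walk continues with `α = bar ᾱ`, so `walk_mul_walk_bar` applies. -/
theorem IsSystem.walk_eq_zero (h : Q.IsSystem w E X) (α : Q.Arr) {k : ℕ} (hk : w.len α < k) :
    walk E X α k = 0 := by
  obtain ⟨k, rfl⟩ := Nat.exists_eq_add_of_lt hk
  rw [add_assoc, ← walk_mul_walk h.toIsPathSystem, h.cycle, w.iterate_len]
  have := h.walk_mul_walk_bar (Q.bar α) (w.len_pos (Q.bar α)) (Nat.succ_pos k)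
  rwa [w.iterate_len, bar_bar] at this

/-- After a nontrivial walk, the next arrow of a path is either the one given by `g`, which prolongs
the walk, or the one given by `f`, which kills it. -/
theorem IsSystem.exists_walk (h : Q.IsSystem w E X) (p : Q.AllPaths) :
    FinQuiver.pathVal E X p = 0 ∨ ∃ α k, Q.src α = p.start ∧ Q.src (Q.g^[k] α) = p.finish ∧
      FinQuiver.pathVal E X p = walk E X α k := by
  obtain ⟨i, j, p⟩ := p
  induction p with
  | nil =>
    refine Or.inr ⟨Q.arrowAt i, 0, Q.src_arrowAt i, Q.src_arrowAt i, ?_⟩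
    simp [FinQuiver.pathVal, walk_zero]
  | cons p β ih =>
    obtain ⟨β, rfl, rfl⟩ := β
    have hc : FinQuiver.pathVal E X ⟨i, _, p.cons ⟨β, rfl, rfl⟩⟩ =
        FinQuiver.pathVal E X ⟨i, _, p⟩ * X β := by
      simp [FinQuiver.pathVal, mul_assoc]
    rw [hc]
    rcases ih with ih | ⟨α, k, h1, h2, h3⟩
    · exact Or.inl (by rw [ih, zero_mul])
    rw [h3]
    simp only at h1 h2
    rcases eq_or_eq_bar h2.symm with rfl | hβ
    · exact Or.inr ⟨α, k + 1, h1, by rw [Function.iterate_succ_apply', src_g], (walk_succ _ _).symm⟩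
    -- A trivial walk is just the idempotent of its vertex and may have been recorded with the wrong
    -- one of the two arrows; it is restarted with `β`.
    rcases Nat.eq_zero_or_pos k with rfl | hk
    · refine Or.inr ⟨β, 1, h2.symm.trans h1, by simp, ?_⟩
      rw [walk_zero, walk_one h.toIsPathSystem, ← h.src_mul β]
      rw [h1, ← h2.symm.trans h1, ← mul_assoc, h.mul_self]
    · left
      rw [hβ, ← walk_one h.toIsPathSystem, h.walk_mul_walk_bar α hk one_pos]

end System

/-! ### The standard basis of `B(Q, f, m)` -/

section Algebra

variable (Q : BiserialQuiver) (w : Q.Weight) (K : Type u) [Field K]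

/-- The idempotent of a vertex in `B(Q, f, m)`. -/
noncomputable def idem (i : Q.Vert) : Q.BiserialAlgebra w K :=
  RingQuot.mkAlgHom K _ (FinQuiver.vertex K i)

/-- The element of an arrow in `B(Q, f, m)`. -/
noncomputable def arr (α : Q.Arr) : Q.BiserialAlgebra w K :=
  RingQuot.mkAlgHom K _ (FinQuiver.arrow K α)

theorem pathVal_idem_arr (p : Q.AllPaths) : FinQuiver.pathVal (Q.idem w K) (Q.arr w K) p =
    RingQuot.mkAlgHom K (Q.Rel w K) (FinQuiver.ofPath K p) := by
  rw [← FinQuiver.pathVal_vertex_arrow]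
  simp only [FinQuiver.pathVal, map_mul, map_list_prod, List.map_map]
  rfl

theorem isSystem : Q.IsSystem w (Q.idem w K) (Q.arr w K) := by
  have h := (FinQuiver.isPathSystem Q.toFinQuiver K).map
    (RingQuot.mkAlgHom K (Q.Rel w K)).toRingHom
  have h' : Q.IsPathSystem (Q.idem w K) (Q.arr w K) := h
  refine { h' with mul_f := fun α => ?_, cycle := fun α => ?_ }
  · rw [arr, arr, ← map_mul, RingQuot.mkAlgHom_rel K (Rel.zero α), map_zero]
  · rw [walk_eq_prod h' _ (w.len_pos _), walk_eq_prod h' _ (w.len_pos _)]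
    have := RingQuot.mkAlgHom_rel K (Rel.cycle (Q := Q) (w := w) (K := K) α)
    rw [cyc_eq, cyc_eq, map_list_prod, map_list_prod, List.map_map, List.map_map] at this
    exact this

variable {Q w K} in
/-- The algebra homomorphism from `B(Q, f, m)` given by a system. -/
noncomputable def IsSystem.lift {C : Type v} [Ring C] [Algebra K C] {E : Q.Vert → C}
    {X : Q.Arr → C} (h : Q.IsSystem w E X) : Q.BiserialAlgebra w K →ₐ[K] C :=
  RingQuot.liftAlgHom K ⟨h.toIsPathSystem.lift, by
    intro x y hxy
    cases hxy with
    | zero α => rw [map_mul, h.lift_arrow, h.lift_arrow, h.mul_f, map_zero]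
    | cycle α =>
      have := h.cycle α
      rw [walk_eq_prod h.toIsPathSystem _ (w.len_pos _),
        walk_eq_prod h.toIsPathSystem _ (w.len_pos _)] at this
      rw [cyc_eq, cyc_eq, map_list_prod, map_list_prod, List.map_map, List.map_map]
      have hX : ⇑(h.toIsPathSystem.lift (K := K)) ∘ FinQuiver.arrow K = X :=
        funext fun α => h.lift_arrow α
      rw [hX, this]⟩

variable {Q w K} in
@[simp] theorem IsSystem.lift_idem {C : Type v} [Ring C] [Algebra K C] {E : Q.Vert → C}
    {X : Q.Arr → C} (h : Q.IsSystem w E X) (i : Q.Vert) : h.lift (Q.idem w K i) = E i := by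
  rw [IsSystem.lift, idem, RingQuot.liftAlgHom_mkAlgHom_apply, h.lift_vertex]

variable {Q w K} in
@[simp] theorem IsSystem.lift_arr {C : Type v} [Ring C] [Algebra K C] {E : Q.Vert → C}
    {X : Q.Arr → C} (h : Q.IsSystem w E X) (α : Q.Arr) : h.lift (Q.arr w K α) = X α := by
  rw [IsSystem.lift, arr, RingQuot.liftAlgHom_mkAlgHom_apply, h.lift_arrow]

theorem map_walk {C D : Type*} [Ring C] [Ring D] (F : C →+* D) (E : Q.Vert → C) (X : Q.Arr → C)
    (α : Q.Arr) (k : ℕ) : F (walk E X α k) = walk (F ∘ E) (F ∘ X) α k := by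
  simp only [walk, map_mul, map_list_prod, List.map_map, Function.comp_apply]

/-- The element `α g(α) ⋯ g^{k-1}(α)` of `B(Q, f, m)`, which is `e_i` for `k = 0`. -/
noncomputable def gWalk (α : Q.Arr) (k : ℕ) : Q.BiserialAlgebra w K :=
  walk (Q.idem w K) (Q.arr w K) α k

theorem span_gWalk :
    Submodule.span K (Set.range fun p : Q.Arr × ℕ => Q.gWalk w K p.1 p.2) = ⊤ := by
  rw [eq_top_iff]
  rintro x -
  obtain ⟨x, rfl⟩ := RingQuot.mkAlgHom_surjective K _ x
  induction x using FinQuiver.PathAlgebra.induction with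
  | zero => rw [map_zero]; exact zero_mem _
  | add x y hx hy => rw [map_add]; exact add_mem hx hy
  | smul a p =>
    rw [map_smul]
    refine Submodule.smul_mem _ _ ?_
    rw [← pathVal_idem_arr]
    rcases (Q.isSystem w K).exists_walk p with h | ⟨α, k, -, -, h⟩
    · rw [h]; exact zero_mem _
    · rw [h]; exact Submodule.subset_span ⟨(α, k), rfl⟩

/-- The index set of the standard basis of `B(Q, f, m)`: the vertices, the socle elements and the
proper initial subpaths of the cycles `B_α`. -/
abbrev BasisIndex : Type := Q.Vert ⊕ Q.Vert ⊕ {p : Q.Arr × ℕ // 0 < p.2 ∧ p.2 < w.len p.1}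

/-- The arrow with which a basis element starts, and its length. -/
noncomputable def indexWalk : Q.BasisIndex w → Q.Arr × ℕ
  | .inl i => (Q.arrowAt i, 0)
  | .inr (.inl i) => (Q.arrowAt i, w.len (Q.arrowAt i))
  | .inr (.inr p) => p.1

/-- The standard basis of `B(Q, f, m)`. -/
noncomputable def basisVec (b : Q.BasisIndex w) : Q.BiserialAlgebra w K :=
  Q.gWalk w K (Q.indexWalk w b).1 (Q.indexWalk w b).2

theorem gWalk_eq_zero_or (α : Q.Arr) (k : ℕ) :
    Q.gWalk w K α k = 0 ∨ ∃ b, Q.gWalk w K α k = Q.basisVec w K b := by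
  have h := Q.isSystem w K
  rcases lt_trichotomy k (w.len α) with hk | rfl | hk
  · rcases Nat.eq_zero_or_pos k with rfl | h0
    · refine Or.inr ⟨.inl (Q.src α), ?_⟩
      simp [basisVec, indexWalk, gWalk, walk_zero]
    · exact Or.inr ⟨.inr (.inr ⟨(α, k), h0, hk⟩), rfl⟩
  · refine Or.inr ⟨.inr (.inl (Q.src α)), ?_⟩
    rw [basisVec, indexWalk, gWalk, gWalk]
    -- The basis contains the full cycle of only one of the two arrows at the vertex; the cycle
    -- relation identifies the other cycle with it.
    rcases eq_or_eq_bar (Q.src_arrowAt (Q.src α)) with h1 | h1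
    · rw [h1]
    · rw [h1]; exact h.cycle α
  · exact Or.inl (h.walk_eq_zero α hk)

theorem span_basisVec : Submodule.span K (Set.range (Q.basisVec w K)) = ⊤ := by
  rw [eq_top_iff, ← Q.span_gWalk w K, Submodule.span_le]
  rintro _ ⟨p, rfl⟩
  rcases Q.gWalk_eq_zero_or w K p.1 p.2 with h | ⟨b, h⟩
  · simp only [h]; exact zero_mem _
  · simp only [h]; exact Submodule.subset_span ⟨b, rfl⟩

/-- The property of a path to represent a given basis element. -/
def Represents : Q.BasisIndex w → Q.AllPaths → Prop
  | .inl i, p => p.start = i ∧ FinQuiver.arrowList p.path = []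
  | .inr (.inl i), p => ∃ α, Q.src α = i ∧ FinQuiver.arrowList p.path = Q.gList α (w.len α)
  | .inr (.inr p), q => FinQuiver.arrowList q.path = Q.gList p.1.1 p.1.2

open Classical in
/-- The functional on the path algebra giving a coordinate with respect to the standard basis. -/
noncomputable def coord (b : Q.BasisIndex w) : Q.PathAlgebra K →ₗ[K] K :=
  FinQuiver.linearLift fun p => if Q.Represents w b p then 1 else 0

variable {Q w}

theorem gList_head {α β : Q.Arr} {k l : ℕ} (hk : 0 < k) (h : Q.gList α k = Q.gList β l) :
    α = β ∧ k = l := by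
  have hl : k = l := by simpa using congrArg List.length h
  subst hl
  have := congrArg (fun L => L[0]?) h
  simp only [getElem?_gList _ _ hk] at this
  exact ⟨by simpa using this, rfl⟩

/-- A basis element is represented by paths `α g(α) ⋯ g^{k-1}(α)` with `k ≤ m_α n_α`. -/
theorem Represents.exists_gList {b : Q.BasisIndex w} {p : Q.AllPaths} (h : Q.Represents w b p) :
    ∃ α k, k ≤ w.len α ∧ FinQuiver.arrowList p.path = Q.gList α k := by
  match b, h with
  | .inl i, h => exact ⟨Q.arrowAt i, 0, Nat.zero_le _, h.2⟩
  | .inr (.inl i), ⟨α, _, h⟩ => exact ⟨α, _, le_rfl, h⟩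
  | .inr (.inr p), h => exact ⟨p.1.1, p.1.2, p.2.2.le, h⟩

/-- Consecutive arrows of a representing path are `γ` and `g γ`, and `g γ ≠ f γ`. Hence all
coordinates vanish on multiples of a zero relation. -/
theorem Represents.not_mul_f {b : Q.BasisIndex w} {p : Q.AllPaths} (h : Q.Represents w b p)
    {l l' : List Q.Arr} {α : Q.Arr}
    (hp : FinQuiver.arrowList p.path = l ++ [α, Q.f α] ++ l') : False := by
  obtain ⟨β, k, -, h'⟩ := h.exists_gList
  rw [hp] at h'
  have hlen := congrArg List.length h'
  simp at hlen
  have h1 := congrArg (fun L => L[l.length]?) h'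
  have h2 := congrArg (fun L => L[l.length + 1]?) h'
  simp only [getElem?_gList Q β (k := k) (l := l.length) (by omega)] at h1
  simp only [getElem?_gList Q β (k := k) (l := l.length + 1) (by omega)] at h2
  simp at h1 h2
  rw [← Function.iterate_succ_apply, Function.iterate_succ_apply', ← h1] at h2
  exact Q.f_ne_g α h2

/-- A representing path is a stretch of one `g`-orbit, no longer than the full cycle of that orbit,
and the cycle length is constant on the orbit. A full cycle inside it leaves no room for further
arrows. -/
theorem Represents.cycle_le {b : Q.BasisIndex w} {p : Q.AllPaths} (h : Q.Represents w b p)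
    {l l' : List Q.Arr} {α : Q.Arr}
    (hp : FinQuiver.arrowList p.path = l ++ Q.gList α (w.len α) ++ l') : l = [] ∧ l' = [] := by
  obtain ⟨β, k, hk, h'⟩ := h.exists_gList
  rw [hp] at h'
  have hpos := w.len_pos α
  have hlen := congrArg List.length h'
  simp at hlen
  have h1 := congrArg (fun L => L[l.length]?) h'
  simp only [getElem?_gList Q β (k := k) (l := l.length) (by omega)] at h1
  rw [List.append_assoc, List.getElem?_append_right le_rfl, Nat.sub_self,
    List.getElem?_append_left (by simpa using hpos), getElem?_gList Q α hpos] at h1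
  have h3 : α = Q.g^[l.length] β := by simpa using h1
  have h4 : w.len α = w.len β := by rw [h3, w.len_iterate]
  exact ⟨List.length_eq_zero_iff.1 (by omega), List.length_eq_zero_iff.1 (by omega)⟩

/-- The right-hand side depends on `α` only through its source, so the two sides of a cycle relation
have the same coordinates. -/
theorem represents_cycle_iff (b : Q.BasisIndex w) {p : Q.AllPaths} {α : Q.Arr}
    (hp : FinQuiver.arrowList p.path = Q.gList α (w.len α)) :
    Q.Represents w b p ↔ b = .inr (.inl (Q.src α)) := by
  have hpos := w.len_pos α
  match b with
  | .inl i =>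
    simp only [Represents, hp, reduceCtorEq, iff_false, not_and]
    intro _ h
    have := congrArg List.length h
    simp at this
    omega
  | .inr (.inl i) =>
    simp only [Represents, hp, Sum.inr.injEq, Sum.inl.injEq]
    constructor
    · rintro ⟨β, rfl, h⟩
      rw [(gList_head hpos h).1]
    · rintro rfl
      exact ⟨α, rfl, rfl⟩
  | .inr (.inr ⟨⟨β, k⟩, hβ⟩) =>
    simp only [Represents, hp, Sum.inr.injEq, reduceCtorEq, iff_false]
    intro h
    obtain ⟨rfl, h2⟩ := gList_head hpos h
    simp only at hβ
    omega

theorem exists_path (α : Q.Arr) (k : ℕ) : ∃ p : Q.AllPaths, p.start = Q.src α ∧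
    p.finish = Q.src (Q.g^[k] α) ∧ FinQuiver.arrowList p.path = Q.gList α k := by
  induction k with
  | zero => exact ⟨⟨Q.src α, Q.src α, Quiver.Path.nil⟩, rfl, rfl, rfl⟩
  | succ k ih =>
    obtain ⟨⟨i, j, p⟩, h1, h2, h3⟩ := ih
    simp only at h1 h2 h3
    subst h1 h2
    refine ⟨⟨_, _, p.cons ⟨Q.g^[k] α, rfl, rfl⟩⟩, rfl, ?_, ?_⟩
    · simp only [Function.iterate_succ_apply', src_g]
    · simp [gList_succ, h3]

theorem represents_indexWalk (b b' : Q.BasisIndex w) {p : Q.AllPaths}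
    (h1 : p.start = Q.src (Q.indexWalk w b').1)
    (h2 : FinQuiver.arrowList p.path = Q.gList (Q.indexWalk w b').1 (Q.indexWalk w b').2) :
    Q.Represents w b p ↔ b = b' := by
  match b' with
  | .inl i =>
    simp only [indexWalk, gList_zero, src_arrowAt] at h1 h2
    match b with
    | .inl j => simp [Represents, h1, h2, eq_comm]
    | .inr (.inl j) =>
      simp only [Represents, h2, reduceCtorEq, iff_false, not_exists, not_and]
      intro α _ h
      have := congrArg List.length h
      have := w.len_pos α
      simp at *
      omega
    | .inr (.inr ⟨⟨β, k⟩, hβ⟩) =>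
      simp only [Represents, h2, reduceCtorEq, iff_false]
      intro h
      have := congrArg List.length h
      simp at *
      omega
  | .inr (.inl i) =>
    simp only [indexWalk] at h2
    rw [represents_cycle_iff b h2, src_arrowAt]
  | .inr (.inr ⟨⟨α, k⟩, hα⟩) =>
    simp only [indexWalk] at h1 h2 hα
    match b with
    | .inl j =>
      simp only [Represents, h2, reduceCtorEq, iff_false, not_and]
      intro _ h
      have := congrArg List.length h
      simp at this
      omega
    | .inr (.inl j) =>
      simp only [Represents, h2, Sum.inr.injEq, reduceCtorEq, iff_false, not_exists, not_and]
      intro β _ h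
      obtain ⟨rfl, h⟩ := gList_head hα.1 h
      omega
    | .inr (.inr ⟨⟨β, l⟩, hβ⟩) =>
      simp only [Represents, h2, Sum.inr.injEq, Subtype.mk.injEq, Prod.mk.injEq]
      constructor
      · intro h
        obtain ⟨rfl, rfl⟩ := gList_head hα.1 h
        exact ⟨rfl, rfl⟩
      · rintro ⟨rfl, rfl⟩
        rfl

/-- This is what makes the coordinates descend to the quotient. By linearity `a` and `c` are paths.
Multiples of zero relations vanish by `not_mul_f`. Multiples of a cycle relation by a nontrivial
path vanish on both sides by `cycle_le`; between trivial paths both sides agree by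
`represents_cycle_iff`. -/
theorem coord_mul_rel (b : Q.BasisIndex w) {x y : Q.PathAlgebra K} (hxy : Q.Rel w K x y)
    (a c : Q.PathAlgebra K) : Q.coord w K b (a * x * c) = Q.coord w K b (a * y * c) := by
  classical
  induction a using FinQuiver.PathAlgebra.induction with
  | zero => simp
  | add a a' h h' => simp only [add_mul, map_add, h, h']
  | smul k p =>
    simp only [smul_mul_assoc, map_smul]
    congr 1
    induction c using FinQuiver.PathAlgebra.induction with
    | zero => simp
    | add a a' h h' => simp only [mul_add, map_add, h, h']
    | smul l q =>
      simp only [mul_smul_comm, map_smul]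
      congr 1
      cases hxy with
      | zero α =>
        have := FinQuiver.ofPath_mul_arrow_prod_mul (K := K) p q [α, Q.f α]
        simp only [List.map_cons, List.map_nil, List.prod_cons, List.prod_nil, mul_one] at this
        rw [mul_zero, zero_mul, map_zero]
        rcases this with h | ⟨r, h1, h2, h3⟩
        · rw [h, map_zero]
        · rw [h3, coord, FinQuiver.linearLift_ofPath, if_neg]
          exact fun h => h.not_mul_f h2
      | cycle α =>
        by_cases hpq : FinQuiver.arrowList p.path = [] ∧ FinQuiver.arrowList q.path = []
        · have hs := FinQuiver.isPathSystem Q.toFinQuiver K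
          have key : ∀ β, Q.src β = Q.src α → Q.coord w K b
              (FinQuiver.ofPath K p * Q.cyc w K β * FinQuiver.ofPath K q) =
              if p.start = Q.src α ∧ q.start = Q.src α ∧ b = .inr (.inl (Q.src α)) then 1
              else 0 := by
            intro β hβ
            rw [FinQuiver.AllPaths.eq_nil hpq.1, FinQuiver.AllPaths.eq_nil hpq.2]
            change Q.coord w K b (FinQuiver.vertex K p.start * _ * FinQuiver.vertex K q.start) = _
            rw [cyc_eq, ← walk_eq_prod hs _ (w.len_pos _)]
            by_cases h1 : p.start = Q.src α
            · by_cases h2 : q.start = Q.src α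
              · have h3 := walk_mul_src hs β (w.len β)
                rw [w.iterate_len] at h3
                rw [h1, h2, ← hβ, src_mul_walk hs, h3]
                obtain ⟨r, r1, r2, r3⟩ := exists_path β (w.len β)
                have hr : walk (FinQuiver.vertex K) (FinQuiver.arrow K) β (w.len β) =
                    FinQuiver.ofPath K r := by
                  rw [walk, ← r1, ← r3]
                  exact FinQuiver.pathVal_vertex_arrow r
                rw [hr, coord, FinQuiver.linearLift_ofPath]
                simp [represents_cycle_iff b r3, hβ]
              · have h3 : Q.src (Q.g^[w.len β] β) ≠ q.start := by
                  rw [w.iterate_len, hβ]; exact Ne.symm h2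
                rw [mul_assoc, walk_mul_src_of_ne hs h3, mul_zero, map_zero, if_neg]
                tauto
            · rw [src_mul_walk_of_ne hs (hβ ▸ h1), zero_mul, map_zero, if_neg]
              tauto
          rw [key α rfl, key _ (Q.src_bar α)]
        · have key : ∀ β, Q.coord w K b
              (FinQuiver.ofPath K p * Q.cyc w K β * FinQuiver.ofPath K q) = 0 := by
            intro β
            rw [cyc_eq]
            rcases FinQuiver.ofPath_mul_arrow_prod_mul (K := K) p q (Q.gList β (w.len β)) with
              h | ⟨r, h1, h2, h3⟩
            · rw [h, map_zero]
            · rw [h3, coord, FinQuiver.linearLift_ofPath, if_neg]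
              exact fun h => hpq (h.cycle_le h2)
          rw [key, key]

/-- The functionals `coord` descend to the quotient by `RingQuot.functional_eq` and are dual to the
vectors `basisVec` by `represents_indexWalk`. -/
theorem linearIndependent_basisVec : LinearIndependent K (Q.basisVec w K) := by
  classical
  have hpath : ∀ b : Q.BasisIndex w, ∃ p : Q.AllPaths, p.start = Q.src (Q.indexWalk w b).1 ∧
      FinQuiver.arrowList p.path = Q.gList (Q.indexWalk w b).1 (Q.indexWalk w b).2 := fun b =>
    let ⟨p, h1, _, h3⟩ := exists_path (Q.indexWalk w b).1 (Q.indexWalk w b).2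
    ⟨p, h1, h3⟩
  choose p hp1 hp2 using hpath
  have hvec : ∀ b, Q.basisVec w K b = RingQuot.mkAlgHom K _ (FinQuiver.ofPath K (p b)) := by
    intro b
    rw [← pathVal_idem_arr, FinQuiver.pathVal, hp2, hp1]
    rfl
  rw [linearIndependent_iff]
  intro c hc
  ext b
  have h0 : RingQuot.mkAlgHom K (Q.Rel w K)
      (c.sum fun b k => k • FinQuiver.ofPath K (p b)) = RingQuot.mkAlgHom K (Q.Rel w K) 0 := by
    rw [map_zero, ← hc, Finsupp.linearCombination_apply, map_finsuppSum]
    simp only [map_smul, hvec]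
  have h1 := RingQuot.functional_eq (Q.Rel w K) (Q.coord w K b)
    (fun x y hxy a c => coord_mul_rel K b hxy a c) h0
  rw [map_zero, map_finsuppSum] at h1
  have h2 : ∀ b' : Q.BasisIndex w, ∀ k : K,
      Q.coord w K b (k • FinQuiver.ofPath K (p b')) = if b = b' then k else 0 := by
    intro b' k
    rw [map_smul, coord, FinQuiver.linearLift_ofPath]
    simp only [represents_indexWalk b b' (hp1 b') (hp2 b')]
    simp
  simp only [h2] at h1
  rw [Finsupp.sum_ite_eq] at h1
  simpa using h1

end Algebra

end BiserialQuiver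

/-! ### Idempotent algebras and first return maps -/

section Corner

variable {K : Type u} [Field K] {B : Type v} [Ring B] [Algebra K B] {e : B}

/-- The inclusion of the idempotent algebra `eBe` into `B`. -/
def cornerSubtype (K : Type u) [Field K] [Algebra K B] (he : IsIdempotentElem e) :
    he.Corner →ₗ[K] B where
  toFun x := x.1
  map_add' _ _ := rfl
  map_smul' _ _ := rfl

theorem cornerSubtype_injective (he : IsIdempotentElem e) :
    Function.Injective (cornerSubtype K he) := Subtype.val_injective

theorem cornerSubtype_mul (he : IsIdempotentElem e) (x y : he.Corner) :
    cornerSubtype K he (x * y) = cornerSubtype K he x * cornerSubtype K he y := rfl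

theorem cornerSubtype_one (he : IsIdempotentElem e) : cornerSubtype K he 1 = e := rfl

theorem cornerSubtype_sandwich (he : IsIdempotentElem e) (x : he.Corner) :
    e * cornerSubtype K he x * e = cornerSubtype K he x := by
  have h := (Subsemigroup.mem_corner_iff he).1 x.2
  change e * x.1 * e = x.1
  rw [h.1, h.2]

end Corner

namespace BiserialQuiver

variable {Q' Q : BiserialQuiver}

/-- An embedding of the arrows of a biserial quiver into those of another one, such that the
permutation `g` of the former is induced by the first return of the permutation `g` of the
latter. -/
structure FirstReturn (w' : Q'.Weight) (w : Q.Weight) where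
  onArr : Q'.Arr → Q.Arr
  onVert : Q'.Vert → Q.Vert
  /-- the first return time -/
  time : Q'.Arr → ℕ
  onArr_injective : Function.Injective onArr
  onVert_injective : Function.Injective onVert
  src_onArr : ∀ α, Q.src (onArr α) = onVert (Q'.src α)
  onArr_bar : ∀ α, onArr (Q'.bar α) = Q.bar (onArr α)
  time_pos : ∀ α, 0 < time α
  iterate_time : ∀ α, Q.g^[time α] (onArr α) = onArr (Q'.g α)
  ne_onArr : ∀ α l, 0 < l → l < time α → ∀ β, Q.g^[l] (onArr α) ≠ onArr β
  weight : ∀ α, w.m (onArr α) = w'.m α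

namespace FirstReturn

variable {w' : Q'.Weight} {w : Q.Weight} (R : FirstReturn w' w)

/-- The time of the `k`-th return. -/
noncomputable def totalTime (α : Q'.Arr) (k : ℕ) : ℕ :=
  ∑ l ∈ Finset.range k, R.time (Q'.g^[l] α)

@[simp] theorem totalTime_zero (α : Q'.Arr) : R.totalTime α 0 = 0 := by simp [totalTime]

theorem totalTime_succ (α : Q'.Arr) (k : ℕ) :
    R.totalTime α (k + 1) = R.totalTime α k + R.time (Q'.g^[k] α) := by
  rw [totalTime, Finset.sum_range_succ, totalTime]

theorem totalTime_add (α : Q'.Arr) (k l : ℕ) :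
    R.totalTime α (k + l) = R.totalTime α k + R.totalTime (Q'.g^[k] α) l := by
  induction l with
  | zero => simp
  | succ l ih =>
    rw [← add_assoc, totalTime_succ, ih, totalTime_succ, add_assoc, add_comm k l,
      Function.iterate_add_apply]

theorem totalTime_strictMono (α : Q'.Arr) : StrictMono (R.totalTime α) :=
  strictMono_nat_of_lt_succ fun k => by
    rw [totalTime_succ]
    exact Nat.lt_add_of_pos_right (R.time_pos _)

theorem iterate_totalTime (α : Q'.Arr) (k : ℕ) :
    Q.g^[R.totalTime α k] (R.onArr α) = R.onArr (Q'.g^[k] α) := by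
  induction k with
  | zero => simp
  | succ k ih =>
    rw [totalTime_succ, add_comm, Function.iterate_add_apply, ih, R.iterate_time,
      Function.iterate_succ_apply']

/-- Every visit to the image is one of the successive returns: by `ne_onArr` no visit occurs before
the first return time, which can be subtracted from `l`. -/
theorem exists_totalTime (l : ℕ) : ∀ (α β : Q'.Arr), Q.g^[l] (R.onArr α) = R.onArr β →
    ∃ k, l = R.totalTime α k := by
  induction l using Nat.strong_induction_on with
  | _ l ih =>
    intro α β h
    rcases Nat.eq_zero_or_pos l with rfl | hl
    · exact ⟨0, by simp⟩
    have h1 : R.time α ≤ l := by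
      by_contra hlt
      exact R.ne_onArr α l hl (not_le.1 hlt) β h
    obtain ⟨l', rfl⟩ := Nat.exists_eq_add_of_le h1
    have h2 := R.time_pos α
    rw [add_comm, Function.iterate_add_apply, R.iterate_time] at h
    obtain ⟨k, hk⟩ := ih l' (by omega) _ _ h
    refine ⟨1 + k, ?_⟩
    rw [totalTime_add, hk]
    simp [totalTime]

/-- One period upstairs closes up below, so its total time is a multiple of the period below.
Conversely the period below is a visit to the image, hence the total time of some `k > 0` returns,
and injectivity of `onArr` makes `k` a multiple of the period upstairs. -/
theorem totalTime_period (α : Q'.Arr) : R.totalTime α (Function.minimalPeriod Q'.g α) =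
    Function.minimalPeriod Q.g (R.onArr α) := by
  have h1 : Function.minimalPeriod Q.g (R.onArr α) ∣
      R.totalTime α (Function.minimalPeriod Q'.g α) := by
    refine Function.IsPeriodicPt.minimalPeriod_dvd ?_
    rw [Function.IsPeriodicPt, Function.IsFixedPt, iterate_totalTime,
      Function.iterate_minimalPeriod]
  have hpos : 0 < R.totalTime α (Function.minimalPeriod Q'.g α) := by
    have := R.totalTime_strictMono α (Q'.period_pos α)
    rwa [totalTime_zero] at this
  refine le_antisymm ?_ (Nat.le_of_dvd hpos h1)
  have h2 : Q.g^[Function.minimalPeriod Q.g (R.onArr α)] (R.onArr α) = R.onArr α :=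
    Function.iterate_minimalPeriod
  obtain ⟨k, hk⟩ := R.exists_totalTime _ _ _ h2
  rw [hk, iterate_totalTime] at h2
  have h3 : Function.minimalPeriod Q'.g α ∣ k :=
    Function.IsPeriodicPt.minimalPeriod_dvd (R.onArr_injective h2)
  have hk0 : 0 < k := by
    rcases Nat.eq_zero_or_pos k with rfl | h
    · rw [totalTime_zero] at hk
      have := Q.period_pos (R.onArr α)
      omega
    · exact h
  rw [hk]
  exact (R.totalTime_strictMono α).monotone (Nat.le_of_dvd hk0 h3)

/-- Since the weights agree, full cycles correspond to full cycles; this transports the cycle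
relations and the range of indices of the standard basis. -/
theorem totalTime_len (α : Q'.Arr) : R.totalTime α (w'.len α) = w.len (R.onArr α) := by
  rw [Weight.len, Weight.len, R.weight]
  generalize w'.m α = m
  induction m with
  | zero => simp
  | succ m ih =>
    rw [Nat.mul_succ, totalTime_add, ih,
      ((Function.isPeriodicPt_minimalPeriod Q'.g α).mul_const m).eq, totalTime_period,
      Nat.mul_succ]

/-- The image contains one arrow at each vertex `onVert i`, and with it the other one, because
`onArr` commutes with `bar`. -/
theorem exists_onArr_eq {α : Q.Arr} {i : Q'.Vert} (h : Q.src α = R.onVert i) :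
    ∃ β, R.onArr β = α := by
  have h1 : Q.src α = Q.src (R.onArr (Q'.arrowAt i)) := by rw [R.src_onArr, src_arrowAt, h]
  rcases eq_or_eq_bar h1 with h2 | h2
  · exact ⟨_, h2.symm⟩
  · exact ⟨Q'.bar (Q'.arrowAt i), by rw [R.onArr_bar, h2]⟩

section Algebra

variable (K : Type u) [Field K]

/-- The sum of the idempotents of the vertices in the image. -/
noncomputable def idemSum : Q.BiserialAlgebra w K := ∑ i, Q.idem w K (R.onVert i)

theorem idemSum_mul_gWalk (α : Q.Arr) (k : ℕ) :
    (∃ i, Q.src α = R.onVert i) ∧ R.idemSum K * Q.gWalk w K α k = Q.gWalk w K α k ∨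
    (∀ i, Q.src α ≠ R.onVert i) ∧ R.idemSum K * Q.gWalk w K α k = 0 := by
  have h := (Q.isSystem w K).toIsPathSystem
  rw [idemSum, Finset.sum_mul]
  by_cases hi : ∃ i, Q.src α = R.onVert i
  · refine Or.inl ⟨hi, ?_⟩
    obtain ⟨i, hi⟩ := hi
    rw [Finset.sum_eq_single i]
    · rw [← hi]; exact src_mul_walk h α k
    · intro j _ hj
      exact src_mul_walk_of_ne h fun h => hj (R.onVert_injective (h.trans hi))
    · exact fun h => absurd (Finset.mem_univ i) h
  · push Not at hi
    exact Or.inr ⟨hi, Finset.sum_eq_zero fun j _ => src_mul_walk_of_ne h (hi j).symm⟩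

theorem gWalk_mul_idemSum (α : Q.Arr) (k : ℕ) :
    (∃ i, Q.src (Q.g^[k] α) = R.onVert i) ∧ Q.gWalk w K α k * R.idemSum K = Q.gWalk w K α k ∨
    (∀ i, Q.src (Q.g^[k] α) ≠ R.onVert i) ∧ Q.gWalk w K α k * R.idemSum K = 0 := by
  have h := (Q.isSystem w K).toIsPathSystem
  rw [idemSum, Finset.mul_sum]
  by_cases hi : ∃ i, Q.src (Q.g^[k] α) = R.onVert i
  · refine Or.inl ⟨hi, ?_⟩
    obtain ⟨i, hi⟩ := hi
    rw [Finset.sum_eq_single i]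
    · rw [← hi]; exact walk_mul_src h α k
    · intro j _ hj
      exact walk_mul_src_of_ne h fun h => hj (R.onVert_injective (h.symm.trans hi))
    · exact fun h => absurd (Finset.mem_univ i) h
  · push Not at hi
    exact Or.inr ⟨hi, Finset.sum_eq_zero fun j _ => walk_mul_src_of_ne h (hi j)⟩

theorem idemSum_mul_idem (i : Q'.Vert) :
    R.idemSum K * Q.idem w K (R.onVert i) = Q.idem w K (R.onVert i) := by
  have h := R.idemSum_mul_gWalk K (Q.arrowAt (R.onVert i)) 0
  rw [gWalk, walk_zero, src_arrowAt] at h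
  rcases h with h | h
  · exact h.2
  · exact absurd rfl (h.1 i)

theorem idem_mul_idemSum (i : Q'.Vert) :
    Q.idem w K (R.onVert i) * R.idemSum K = Q.idem w K (R.onVert i) := by
  have h := R.gWalk_mul_idemSum K (Q.arrowAt (R.onVert i)) 0
  rw [gWalk, walk_zero, Function.iterate_zero, id, src_arrowAt] at h
  rcases h with h | h
  · exact h.2
  · exact absurd rfl (h.1 i)

theorem isIdempotentElem_idemSum : IsIdempotentElem (R.idemSum K) := by
  rw [IsIdempotentElem]
  conv_lhs => arg 1; rw [idemSum]
  rw [Finset.sum_mul, Finset.sum_congr rfl fun i _ => R.idem_mul_idemSum K i]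
  rfl

/-- The idempotent of a vertex, in the idempotent algebra. -/
noncomputable def cornerIdem (i : Q'.Vert) : (R.isIdempotentElem_idemSum K).Corner :=
  ⟨Q.idem w K (R.onVert i), (Subsemigroup.mem_corner_iff (R.isIdempotentElem_idemSum K)).2
    ⟨R.idemSum_mul_idem K i, R.idem_mul_idemSum K i⟩⟩

/-- The walk from an arrow to its first return, in the idempotent algebra. -/
noncomputable def cornerArr (α : Q'.Arr) : (R.isIdempotentElem_idemSum K).Corner :=
  ⟨Q.gWalk w K (R.onArr α) (R.time α), (Subsemigroup.mem_corner_iff (R.isIdempotentElem_idemSum K)).2 ⟨by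
    rcases R.idemSum_mul_gWalk K (R.onArr α) (R.time α) with h | h
    · exact h.2
    · exact absurd (R.src_onArr α) (h.1 _), by
    rcases R.gWalk_mul_idemSum K (R.onArr α) (R.time α) with h | h
    · exact h.2
    · rw [R.iterate_time] at h
      exact absurd (R.src_onArr _) (h.1 _)⟩⟩

theorem cornerSubtype_walk (α : Q'.Arr) (k : ℕ) :
    cornerSubtype K (R.isIdempotentElem_idemSum K) (walk (R.cornerIdem K) (R.cornerArr K) α k) =
      Q.gWalk w K (R.onArr α) (R.totalTime α k) := by
  induction k with
  | zero =>
    rw [walk_zero, totalTime_zero, gWalk, walk_zero, R.src_onArr]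
    rfl
  | succ k ih =>
    rw [walk_succ, cornerSubtype_mul, ih, totalTime_succ, gWalk, gWalk,
      ← walk_mul_walk (Q.isSystem w K).toIsPathSystem, iterate_totalTime]
    rfl

theorem isSystem_corner : Q'.IsSystem w' (R.cornerIdem K) (R.cornerArr K) := by
  have h := Q.isSystem w K
  have inj := cornerSubtype_injective (K := K) (R.isIdempotentElem_idemSum K)
  refine ⟨⟨fun i => ?_, fun i j hij => ?_, ?_, fun α => ?_, fun α => ?_⟩, fun α => ?_, fun α => ?_⟩
  · exact inj (h.mul_self _)
  · exact inj (h.mul_ne _ _ fun h => hij (R.onVert_injective h))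
  · refine inj ?_
    rw [map_sum, cornerSubtype_one]
    rfl
  · refine inj ?_
    rw [cornerSubtype_mul]
    change Q.idem w K _ * Q.gWalk w K _ _ = Q.gWalk w K _ _
    rw [← R.src_onArr]
    exact src_mul_walk h.toIsPathSystem _ _
  · refine inj ?_
    rw [cornerSubtype_mul]
    change Q.gWalk w K _ _ * Q.idem w K _ = Q.gWalk w K _ _
    rw [← src_g, ← R.src_onArr, ← R.iterate_time]
    exact walk_mul_src h.toIsPathSystem _ _
  · refine inj ?_
    rw [cornerSubtype_mul, map_zero]
    change Q.gWalk w K _ _ * Q.gWalk w K _ _ = 0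
    -- Since `f α = bar (g α)`, the second walk starts with the bar of the arrow at which the first
    -- walk arrives.
    rw [← bar_g, R.onArr_bar, ← R.iterate_time]
    exact h.walk_mul_walk_bar _ (R.time_pos _) (by rw [bar_g]; exact R.time_pos _)
  · refine inj ?_
    rw [cornerSubtype_walk, cornerSubtype_walk, totalTime_len, totalTime_len, R.onArr_bar]
    exact h.cycle _

theorem cornerSubtype_lift_gWalk (α : Q'.Arr) (k : ℕ) :
    cornerSubtype K _ ((R.isSystem_corner K).lift (Q'.gWalk w' K α k)) =
      Q.gWalk w K (R.onArr α) (R.totalTime α k) := by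
  rw [← cornerSubtype_walk, gWalk]
  congr 1
  refine (map_walk _ (R.isSystem_corner K).lift.toRingHom _ _ _ _).trans ?_
  congr 1
  · funext i
    exact (R.isSystem_corner K).lift_idem i
  · funext α
    exact (R.isSystem_corner K).lift_arr α

/-- The embedding of the index sets of the standard bases. -/
noncomputable def onIndex : Q'.BasisIndex w' → Q.BasisIndex w
  | .inl i => .inl (R.onVert i)
  | .inr (.inl i) => .inr (.inl (R.onVert i))
  | .inr (.inr p) => .inr (.inr ⟨(R.onArr p.1.1, R.totalTime p.1.1 p.1.2), by
      have h1 := R.totalTime_strictMono p.1.1 p.2.1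
      have h2 := R.totalTime_strictMono p.1.1 p.2.2
      rw [totalTime_zero] at h1
      rw [totalTime_len] at h2
      exact ⟨h1, h2⟩⟩)

theorem onIndex_injective : Function.Injective R.onIndex := by
  rintro (i | i | ⟨⟨α, k⟩, hα⟩) (j | j | ⟨⟨β, l⟩, hβ⟩) h <;> simp [onIndex] at h ⊢
  · exact R.onVert_injective h
  · exact R.onVert_injective h
  · obtain rfl := R.onArr_injective h.1
    exact ⟨rfl, (R.totalTime_strictMono α).injective h.2⟩

theorem cornerSubtype_lift_basisVec (b : Q'.BasisIndex w') :
    cornerSubtype K _ ((R.isSystem_corner K).lift (Q'.basisVec w' K b)) =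
      Q.basisVec w K (R.onIndex b) := by
  rw [basisVec, cornerSubtype_lift_gWalk, basisVec]
  have hs : ∀ i, Q.src (Q.arrowAt (R.onVert i)) = Q.src (R.onArr (Q'.arrowAt i)) := fun i => by
    rw [R.src_onArr, src_arrowAt, src_arrowAt]
  match b with
  | .inl i => simp only [indexWalk, onIndex, totalTime_zero, gWalk, walk_zero, hs]
  | .inr (.inl i) =>
    simp only [indexWalk, onIndex, totalTime_len]
    rcases eq_or_eq_bar (hs i) with h | h
    · rw [h]
    · rw [h]; exact (Q.isSystem w K).cycle _
  | .inr (.inr p) => rfl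

/-- The standard basis is mapped injectively into the standard basis of the larger algebra. -/
theorem lift_injective : Function.Injective ((R.isSystem_corner K).lift (K := K)) := by
  rw [injective_iff_map_eq_zero]
  intro x hx
  have hmem : x ∈ Submodule.span K (Set.range (Q'.basisVec w' K)) := by
    rw [span_basisVec]; trivial
  obtain ⟨c, rfl⟩ := (Finsupp.mem_span_range_iff_exists_finsupp).1 hmem
  have h1 := congrArg (cornerSubtype K _) hx
  rw [map_finsuppSum, map_finsuppSum, map_zero] at h1
  simp only [map_smul, cornerSubtype_lift_basisVec] at h1
  have h2 := linearIndependent_iff.1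
    ((linearIndependent_basisVec (Q := Q) (w := w) K).comp _ R.onIndex_injective) c
    (by rw [Finsupp.linearCombination_apply]; exact h1)
  rw [h2, Finsupp.sum_zero_index]

/-- A walk that survives multiplication by `idemSum` on both sides starts and ends at vertices of
the image. Its first arrow is then in the image and its length is a time of return, so it is the
image of a walk. -/
theorem lift_surjective : Function.Surjective ((R.isSystem_corner K).lift (K := K)) := by
  let F := (cornerSubtype K (R.isIdempotentElem_idemSum K)).comp
    (R.isSystem_corner K).lift.toLinearMap
  have key : ∀ y, R.idemSum K * y * R.idemSum K ∈ LinearMap.range F := by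
    intro y
    have hy : y ∈ Submodule.span K (Set.range fun p : Q.Arr × ℕ => Q.gWalk w K p.1 p.2) := by
      rw [span_gWalk]; trivial
    induction hy using Submodule.span_induction with
    | zero => rw [mul_zero, zero_mul]; exact zero_mem _
    | add x y _ _ hx hy => rw [mul_add, add_mul]; exact add_mem hx hy
    | smul a x _ hx =>
      rw [mul_smul_comm, smul_mul_assoc]
      exact Submodule.smul_mem _ _ hx
    | mem x hx =>
      obtain ⟨⟨α, k⟩, rfl⟩ := hx
      simp only
      rcases R.idemSum_mul_gWalk K α k with ⟨⟨i, hi⟩, h⟩ | ⟨-, h⟩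
      · rw [h]
        rcases R.gWalk_mul_idemSum K α k with ⟨⟨j, hj⟩, h'⟩ | ⟨-, h'⟩
        · rw [h']
          obtain ⟨β, rfl⟩ := R.exists_onArr_eq hi
          obtain ⟨β', h''⟩ := R.exists_onArr_eq hj
          obtain ⟨k, rfl⟩ := R.exists_totalTime _ _ _ h''.symm
          exact ⟨Q'.gWalk w' K β k, R.cornerSubtype_lift_gWalk K β k⟩
        · rw [h']; exact zero_mem _
      · rw [h, zero_mul]; exact zero_mem _
  intro x
  obtain ⟨y, hy⟩ := key (cornerSubtype K _ x)
  rw [cornerSubtype_sandwich] at hy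
  exact ⟨y, cornerSubtype_injective _ hy⟩

/-- The algebra of the smaller quiver is an idempotent algebra of the algebra of the larger one. -/
noncomputable def algEquiv :
    Q'.BiserialAlgebra w' K ≃ₐ[K] (R.isIdempotentElem_idemSum K).Corner :=
  AlgEquiv.ofBijective _ ⟨R.lift_injective K, R.lift_surjective K⟩

end Algebra

end FirstReturn

end BiserialQuiver

/-! ### Brauer graphs as biserial quivers -/

namespace BrauerGraph

variable (Γ : BrauerGraph)

/-- A Brauer graph as a biserial quiver. -/
def toBiserialQuiver : BiserialQuiver where
  toFinQuiver := Γ.quiver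
  -- With this choice `g`, which applies `bar` once more, becomes `next`.
  f := Γ.next.trans ((Equiv.refl Γ.Edge).prodCongr Equiv.boolNot)
  src_f _ := rfl
  card_src i := by
    have e : {α : Γ.Edge × Bool // α.1 = i} ≃ Bool :=
      { toFun := fun α => α.1.2
        invFun := fun b => ⟨(i, b), rfl⟩
        left_inv := by rintro ⟨⟨i, b⟩, rfl⟩; rfl
        right_inv := fun _ => rfl }
    exact (Nat.card_congr e).trans (by simp)
  card_tgt i := by
    have e : {α : Γ.Edge × Bool // (Γ.next α).1 = i} ≃ Bool :=
      { toFun := fun α => (Γ.next α.1).2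
        invFun := fun b => ⟨Γ.next.symm (i, b),
          congrArg Prod.fst (Γ.next.apply_symm_apply (i, b))⟩
        left_inv := by
          rintro ⟨α, rfl⟩
          exact Subtype.ext (Γ.next.symm_apply_apply α)
        right_inv := fun b => congrArg Prod.snd (Γ.next.apply_symm_apply (i, b)) }
    exact (Nat.card_congr e).trans (by simp)

theorem bar_eq (α : Γ.toBiserialQuiver.Arr) :
    Γ.toBiserialQuiver.bar α = Γ.otherArrow α := by
  refine (BiserialQuiver.eq_bar_of_ne (Q := Γ.toBiserialQuiver) (α := α) (β := Γ.otherArrow α)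
    rfl fun h => ?_).symm
  have h2 : (!α.2) = α.2 := congrArg Prod.snd h
  simp at h2

theorem g_eq : Γ.toBiserialQuiver.g = Γ.nextArrow := by
  funext α
  refine (Γ.bar_eq (Γ.toBiserialQuiver.f α)).trans ?_
  change ((Γ.next α).1, !!(Γ.next α).2) = Γ.next α
  simp

theorem vert_next (h : Γ.Edge × Bool) : Γ.vert (Γ.next h) = Γ.vert h :=
  ((Γ.sameCycle_next _ _).1 (Equiv.Perm.sameCycle_apply_right.2 (Equiv.Perm.SameCycle.refl _ _))).symm

/-- The multiplicities of a Brauer graph as a weight. -/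
def toWeight : Γ.toBiserialQuiver.Weight where
  m α := Γ.mult (Γ.vert α)
  pos α := Γ.mult_pos _
  orbit α := by rw [g_eq]; exact congrArg Γ.mult (Γ.vert_next α)

/-- The half-edges at a vertex form one cycle of `next`, that is, one orbit of the cyclic group it
generates. -/
theorem card_vert_eq (α : Γ.Edge × Bool) :
    Nat.card {β : Γ.Edge × Bool // Γ.vert β = Γ.vert α} =
      Function.minimalPeriod Γ.next α := by
  classical
  have h := MulAction.minimalPeriod_eq_card (a := Γ.next) (b := α)
  refine Eq.trans ?_ h.symm
  rw [← Nat.card_eq_fintype_card]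
  refine Nat.card_congr (Equiv.subtypeEquivRight fun β => ?_)
  rw [eq_comm, ← Γ.sameCycle_next, MulAction.mem_orbit_iff, Equiv.Perm.SameCycle]
  constructor
  · rintro ⟨i, hi⟩
    exact ⟨⟨Γ.next ^ i, i, rfl⟩, hi⟩
  · rintro ⟨⟨_, i, rfl⟩, hi⟩
    exact ⟨i, hi⟩

theorem cyc_pow_eq (K : Type u) [Field K] (α : Γ.quiver.Arr) :
    Γ.cyc K α ^ Γ.mult (Γ.attachedTo α) = Γ.toBiserialQuiver.cyc Γ.toWeight K α := by
  have h1 : Γ.toBiserialQuiver.cyc Γ.toWeight K α =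
      FinQuiver.cycleProd (Q := Γ.quiver) K Γ.toBiserialQuiver.g
        (Function.minimalPeriod Γ.toBiserialQuiver.g α) α ^ Γ.mult (Γ.attachedTo α) := rfl
  rw [h1, g_eq, BrauerGraph.cyc]
  exact congrArg (fun n => FinQuiver.cycleProd K Γ.nextArrow n α ^ Γ.mult (Γ.attachedTo α))
    (Γ.card_vert_eq α)

/-- Only two arrows start at the target of `α`, so forbidding all continuations except `g α` is the
same as forbidding `f α`. -/
theorem f_eq_of_ne (α β : Γ.toBiserialQuiver.Arr)
    (hpath : Γ.toBiserialQuiver.tgt α = Γ.toBiserialQuiver.src β)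
    (hne : β ≠ Γ.toBiserialQuiver.g α) : β = Γ.toBiserialQuiver.f α := by
  rw [← BiserialQuiver.bar_g]
  exact BiserialQuiver.eq_bar_of_ne (hpath.symm.trans (BiserialQuiver.src_g _ _).symm) hne

theorem f_ne_nextArrow (α : Γ.quiver.Arr) : Γ.toBiserialQuiver.f α ≠ Γ.nextArrow α := by
  rw [← g_eq]
  exact Γ.toBiserialQuiver.f_ne_g α

theorem cyc_bar_eq (K : Type u) [Field K] (α : Γ.quiver.Arr) :
    Γ.cyc K (Γ.otherArrow α) ^ Γ.mult (Γ.attachedTo (Γ.otherArrow α)) =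
      Γ.toBiserialQuiver.cyc Γ.toWeight K (Γ.toBiserialQuiver.bar α) :=
  (Γ.cyc_pow_eq K (Γ.otherArrow α)).trans
    (congrArg (Γ.toBiserialQuiver.cyc Γ.toWeight K) (Γ.bar_eq α).symm)

theorem toBiserialQuiver_rel_of_rel {K : Type u} [Field K] {x y : Γ.quiver.PathAlgebra K}
    (h : Γ.Rel K x y) : Γ.toBiserialQuiver.Rel Γ.toWeight K x y := by
  induction h with
  | zero α β hpath hne =>
    have h := Γ.f_eq_of_ne α β hpath (by rw [g_eq]; exact hne)
    rw [h]
    exact BiserialQuiver.Rel.zero (Q := Γ.toBiserialQuiver) α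
  | cycle α =>
    exact (congrArg₂ (Γ.toBiserialQuiver.Rel Γ.toWeight K) (Γ.cyc_pow_eq K α)
      (Γ.cyc_bar_eq K α)).mpr (BiserialQuiver.Rel.cycle (Q := Γ.toBiserialQuiver) α)

theorem rel_of_toBiserialQuiver_rel {K : Type u} [Field K]
    {x y : Γ.toBiserialQuiver.PathAlgebra K}
    (h : Γ.toBiserialQuiver.Rel Γ.toWeight K x y) : Γ.Rel K x y := by
  induction h with
  | zero α => exact BrauerGraph.Rel.zero (Γ := Γ) α _ rfl (Γ.f_ne_nextArrow α)
  | cycle α =>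
    exact (congrArg₂ (Γ.Rel K) (Γ.cyc_pow_eq K α) (Γ.cyc_bar_eq K α)).mp
      (BrauerGraph.Rel.cycle (Γ := Γ) (K := K) α)

/-- A Brauer graph algebra as the algebra of a biserial quiver. -/
theorem nonempty_algEquiv (K : Type u) [Field K] : Nonempty
    (Γ.BrauerAlgebra K ≃ₐ[K] Γ.toBiserialQuiver.BiserialAlgebra Γ.toWeight K) := by
  have h : Γ.Rel K = Γ.toBiserialQuiver.Rel Γ.toWeight K :=
    funext fun x => funext fun y => propext
      ⟨Γ.toBiserialQuiver_rel_of_rel, Γ.rel_of_toBiserialQuiver_rel⟩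
  have key : ∀ r : Γ.quiver.PathAlgebra K → Γ.quiver.PathAlgebra K → Prop, r = Γ.Rel K →
      Nonempty (Γ.BrauerAlgebra K ≃ₐ[K] RingQuot r) := by
    rintro _ rfl
    exact ⟨AlgEquiv.refl⟩
  exact key _ h.symm

end BrauerGraph

/-! ### Conjugate idempotents -/

section Corner

variable {K : Type u} [Field K] {B : Type v} [Ring B] [Algebra K B] {e f : B}

/-- Idempotent algebras of conjugate idempotents are isomorphic. -/
noncomputable def cornerConj (he : IsIdempotentElem e) (hf : IsIdempotentElem f) (u : Bˣ)
    (h : e * u = u * f) : he.Corner ≃ₐ[K] hf.Corner where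
  toFun x := ⟨↑u⁻¹ * x.1 * u, by
    have hx := (Subsemigroup.mem_corner_iff he).1 x.2
    refine (Subsemigroup.mem_corner_iff hf).2 ⟨?_, ?_⟩
    · have h' : f * ↑u⁻¹ = ↑u⁻¹ * e := by
        rw [Units.mul_inv_eq_iff_eq_mul, mul_assoc, h, Units.inv_mul_cancel_left]
      rw [← mul_assoc, ← mul_assoc, h', mul_assoc _ e, hx.1]
    · rw [mul_assoc, ← h, ← mul_assoc, mul_assoc _ _ e, hx.2]⟩
  invFun x := ⟨u * x.1 * ↑u⁻¹, by
    have hx := (Subsemigroup.mem_corner_iff hf).1 x.2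
    refine (Subsemigroup.mem_corner_iff he).2 ⟨?_, ?_⟩
    · rw [← mul_assoc, ← mul_assoc, h, mul_assoc _ f, hx.1]
    · have h' : ↑u⁻¹ * e = f * ↑u⁻¹ := by
        rw [Units.eq_mul_inv_iff_mul_eq, mul_assoc, h, Units.inv_mul_cancel_left]
      rw [mul_assoc, h', ← mul_assoc, mul_assoc _ _ f, hx.2]⟩
  left_inv x := Subtype.ext (by simp [mul_assoc])
  right_inv x := Subtype.ext (by simp [mul_assoc])
  map_mul' x y := Subtype.ext (by
    change ↑u⁻¹ * (x.1 * y.1) * ↑u = (↑u⁻¹ * x.1 * u) * (↑u⁻¹ * y.1 * u)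
    simp [mul_assoc])
  map_add' x y := Subtype.ext (by
    change ↑u⁻¹ * (x.1 + y.1) * ↑u = (↑u⁻¹ * x.1 * u) + (↑u⁻¹ * y.1 * u)
    simp [mul_add, add_mul])
  commutes' k := Subtype.ext (by
    change ↑u⁻¹ * (k • e) * ↑u = k • f
    rw [mul_smul_comm, smul_mul_assoc, mul_assoc, h, Units.inv_mul_cancel_left])

/-- The idempotent algebra of the unit is the whole algebra. -/
noncomputable def cornerOne (K : Type u) [Field K] [Algebra K B] (he : IsIdempotentElem e)
    (h : e = 1) : he.Corner ≃ₐ[K] B where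
  toFun x := x.1
  invFun x := ⟨x, (Subsemigroup.mem_corner_iff he).2 (by simp [h])⟩
  left_inv _ := rfl
  right_inv _ := rfl
  map_mul' _ _ := rfl
  map_add' _ _ := rfl
  commutes' k := by
    change k • e = _
    rw [h, Algebra.algebraMap_eq_smul_one]

/-- Idempotents which agree modulo a commutative quotient with nilpotent kernel are conjugate. -/
theorem exists_unit_conj {D : Type*} [CommRing D] (F : B →+* D)
    (hF : ∀ x, F x = 0 → IsNilpotent x) (he : IsIdempotentElem e) (hf : IsIdempotentElem f)
    (h : F e = F f) : ∃ u : Bˣ, e * u = u * f := by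
  have he' : F e * F e = F e := by rw [← map_mul, he.eq]
  -- The element `u = ef + (1 - e)(1 - f)` satisfies `eu = ef = uf`. In `D` both idempotents become
  -- one idempotent `ε`, and `u` becomes `ε + (1 - ε) = 1`; so `1 - u` is nilpotent.
  have hu : IsUnit (e * f + (1 - e) * (1 - f)) := by
    have h1 : F (1 - (e * f + (1 - e) * (1 - f))) = 0 := by
      simp only [map_sub, map_one, map_add, map_mul, ← h]
      linear_combination -2 * he'
    have := (hF _ h1).isUnit_one_sub
    rwa [sub_sub_cancel] at this
  obtain ⟨u, hu⟩ := hu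
  refine ⟨u, ?_⟩
  have he1 := he.eq
  have hf1 := hf.eq
  rw [hu]
  simp only [mul_add, add_mul, mul_sub, sub_mul, mul_one, one_mul, ← mul_assoc, he1]
  simp only [mul_assoc, hf1]
  abel

end Corner

/-! ### The augmentation and its nilpotent kernel -/

namespace BiserialQuiver

section Augmentation

variable (Q : BiserialQuiver) (w : Q.Weight) (K : Type u) [Field K]

open Classical in
theorem isSystem_augmentation :
    Q.IsSystem w (C := Q.Vert → K) (fun i => Pi.single i 1) (fun _ => 0) := by
  have hw : ∀ α k, 0 < k →
      walk (Q := Q) (C := Q.Vert → K) (fun i => Pi.single i 1) (fun _ => 0) α k = 0 := by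
    intro α k hk
    obtain ⟨k, rfl⟩ := Nat.exists_eq_add_of_lt hk
    rw [walk_succ, mul_zero]
  refine ⟨⟨fun i => ?_, fun i j h => ?_, ?_, fun α => mul_zero _, fun α => zero_mul _⟩,
    fun α => mul_zero _, fun α => ?_⟩
  · rw [← Pi.single_mul, mul_one]
  · funext k
    by_cases hk : k = i
    · subst hk; simp [h]
    · simp [hk]
  · exact Finset.univ_sum_single (fun _ => (1 : K))
  · rw [hw _ _ (w.len_pos _), hw _ _ (w.len_pos _)]

/-- The augmentation of `B(Q, f, m)`, which sends all arrows to zero. -/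
noncomputable def augmentation : Q.BiserialAlgebra w K →ₐ[K] (Q.Vert → K) :=
  (Q.isSystem_augmentation w K).lift

open Classical in
theorem augmentation_idem (i : Q.Vert) : Q.augmentation w K (Q.idem w K i) = Pi.single i 1 :=
  (Q.isSystem_augmentation w K).lift_idem i

theorem augmentation_gWalk (α : Q.Arr) {k : ℕ} (hk : 0 < k) :
    Q.augmentation w K (Q.gWalk w K α k) = 0 := by
  obtain ⟨k, rfl⟩ := Nat.exists_eq_add_of_lt hk
  rw [gWalk, walk_succ, map_mul, augmentation, IsSystem.lift_arr, mul_zero]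

/-- The span of the walks of length at least `n`. -/
noncomputable def walkSpan (n : ℕ) : Submodule K (Q.BiserialAlgebra w K) :=
  Submodule.span K {x | ∃ α k, n ≤ k ∧ x = Q.gWalk w K α k}

theorem mem_walkSpan_of_augmentation {x : Q.BiserialAlgebra w K}
    (hx : Q.augmentation w K x = 0) : x ∈ Q.walkSpan w K 1 := by
  classical
  -- Subtracting the combination of idempotents read off from the augmentation leaves a combination
  -- of nontrivial walks.
  have key : ∀ x, x - ∑ i, Q.augmentation w K x i • Q.idem w K i ∈ Q.walkSpan w K 1 := by
    intro x
    have hx : x ∈ Submodule.span K (Set.range fun p : Q.Arr × ℕ => Q.gWalk w K p.1 p.2) := by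
      rw [span_gWalk]; trivial
    induction hx using Submodule.span_induction with
    | zero =>
      rw [map_zero]
      simp only [Pi.zero_apply, zero_smul, Finset.sum_const_zero, sub_zero]
      exact zero_mem _
    | add x y _ _ hx hy =>
      simp only [map_add, Pi.add_apply, add_smul, Finset.sum_add_distrib]
      rw [add_sub_add_comm]
      exact add_mem hx hy
    | smul a x _ hx =>
      have := Submodule.smul_mem _ a hx
      simpa only [map_smul, Pi.smul_apply, smul_assoc, ← Finset.smul_sum, ← smul_sub] using this
    | mem x hx =>
      obtain ⟨⟨α, k⟩, rfl⟩ := hx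
      simp only
      rcases Nat.eq_zero_or_pos k with rfl | hk
      · rw [gWalk, walk_zero, augmentation_idem]
        rw [Finset.sum_eq_single (Q.src α)]
        · simp
        · intro i _ hi
          simp [hi]
        · simp
      · rw [augmentation_gWalk _ _ _ _ hk]
        simp only [Pi.zero_apply, zero_smul, Finset.sum_const_zero, sub_zero]
        exact Submodule.subset_span ⟨α, k, hk, rfl⟩
  have := key x
  rw [hx] at this
  simpa using this

/-- Two nontrivial walks either join to a walk whose length is the sum of the two, or have product
zero because they meet with `f` or at different vertices. -/
theorem mul_mem_walkSpan {m n : ℕ} (hn : 0 < m) (hm : 0 < n) {x y : Q.BiserialAlgebra w K}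
    (hx : x ∈ Q.walkSpan w K m) (hy : y ∈ Q.walkSpan w K n) : x * y ∈ Q.walkSpan w K (m + n) := by
  have h := Q.isSystem w K
  rw [walkSpan] at hx hy
  induction hx using Submodule.span_induction with
  | zero => rw [zero_mul]; exact zero_mem _
  | add x x' _ _ hx hx' => rw [add_mul]; exact add_mem hx hx'
  | smul a x _ hx => rw [smul_mul_assoc]; exact Submodule.smul_mem _ _ hx
  | mem x hx =>
    induction hy using Submodule.span_induction with
    | zero => rw [mul_zero]; exact zero_mem _
    | add x x' _ _ hx hx' => rw [mul_add]; exact add_mem hx hx'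
    | smul a x _ hx => rw [mul_smul_comm]; exact Submodule.smul_mem _ _ hx
    | mem y hy =>
      obtain ⟨α, k, hk, rfl⟩ := hx
      obtain ⟨β, l, hl, rfl⟩ := hy
      by_cases hs : Q.src (Q.g^[k] α) = Q.src β
      · rcases eq_or_eq_bar hs.symm with rfl | rfl
        · rw [gWalk, gWalk, walk_mul_walk h.toIsPathSystem]
          exact Submodule.subset_span ⟨α, k + l, by omega, rfl⟩
        · rw [gWalk, gWalk, h.walk_mul_walk_bar α (by omega) (by omega)]
          exact zero_mem _
      · rw [gWalk, gWalk, walk_mul_walk_of_ne h.toIsPathSystem hs]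
        exact zero_mem _

theorem isNilpotent_of_augmentation {x : Q.BiserialAlgebra w K}
    (hx : Q.augmentation w K x = 0) : IsNilpotent x := by
  have h1 := Q.mem_walkSpan_of_augmentation w K hx
  have hpow : ∀ n, x ^ (n + 1) ∈ Q.walkSpan w K (n + 1) := by
    intro n
    induction n with
    | zero => simpa using h1
    | succ n ih =>
      rw [pow_succ]
      exact Q.mul_mem_walkSpan w K (Nat.succ_pos n) one_pos ih h1
  -- This exponent exceeds every cycle length, so all walks of that length vanish.
  refine ⟨(∑ α, w.len α) + 1, ?_⟩
  have h2 := hpow (∑ α, w.len α)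
  have h3 : Q.walkSpan w K ((∑ α, w.len α) + 1) = ⊥ := by
    rw [walkSpan, Submodule.span_eq_bot]
    rintro _ ⟨α, k, hk, rfl⟩
    refine (Q.isSystem w K).walk_eq_zero α ?_
    have := Finset.single_le_sum (f := fun α => w.len α) (fun _ _ => Nat.zero_le _)
      (Finset.mem_univ α)
    omega
  rw [h3] at h2
  simpa using h2

end Augmentation

/-! ### Restriction of a biserial quiver to a set of vertices -/

section Restrict

variable (Q : BiserialQuiver) (I : Set Q.Vert)

theorem exists_return (α : {α // Q.src α ∈ I}) : ∃ k, 0 < k ∧ Q.src (Q.g^[k] α.1) ∈ I :=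
  ⟨_, Q.period_pos α.1, by rw [Function.iterate_minimalPeriod]; exact α.2⟩

open Classical in
/-- The first return time to the arrows which start in a set of vertices. -/
noncomputable def returnTime (α : {α // Q.src α ∈ I}) : ℕ := Nat.find (Q.exists_return I α)

theorem returnTime_pos (α : {α // Q.src α ∈ I}) : 0 < Q.returnTime I α := by
  classical
  exact (Nat.find_spec (Q.exists_return I α)).1

theorem notMem_of_lt_returnTime (α : {α // Q.src α ∈ I}) {k : ℕ} (h0 : 0 < k)
    (hk : k < Q.returnTime I α) : Q.src (Q.g^[k] α.1) ∉ I := by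
  classical
  exact fun h => Nat.find_min (Q.exists_return I α) hk ⟨h0, h⟩

/-- The first return map on the arrows which start in a set of vertices. -/
noncomputable def returnMap (α : {α // Q.src α ∈ I}) : {α // Q.src α ∈ I} :=
  ⟨Q.g^[Q.returnTime I α] α.1, by
    classical
    exact (Nat.find_spec (Q.exists_return I α)).2⟩

/-- If `α` and `β` had the same return with return times differing by `d > 0`, cancelling powers of
`g` would give `α = g^d β`, an earlier return of `β`. -/
theorem returnMap_injective : Function.Injective (Q.returnMap I) := by
  have key : ∀ α β, Q.returnMap I α = Q.returnMap I β → Q.returnTime I α ≤ Q.returnTime I β →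
      α = β := by
    intro α β h hle
    have h' : Q.g^[Q.returnTime I α] α.1 = Q.g^[Q.returnTime I β] β.1 := congrArg Subtype.val h
    obtain ⟨d, hd⟩ := Nat.exists_eq_add_of_le hle
    rw [hd, Function.iterate_add_apply] at h'
    have h2 := Q.g_injective.iterate _ h'
    have h3 := Q.returnTime_pos I α
    rcases Nat.eq_zero_or_pos d with rfl | h0
    · exact Subtype.ext h2
    · refine absurd ?_ (Q.notMem_of_lt_returnTime I β h0 (by omega))
      rw [← h2]
      exact α.2
  intro α β h
  rcases le_total (Q.returnTime I α) (Q.returnTime I β) with hle | hle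
  · exact key α β h hle
  · exact (key β α h.symm hle).symm

/-- The other arrow, within the arrows which start in a set of vertices. -/
noncomputable def barOn (α : {α // Q.src α ∈ I}) : {α // Q.src α ∈ I} :=
  ⟨Q.bar α.1, by rw [src_bar]; exact α.2⟩

theorem barOn_barOn (α : {α // Q.src α ∈ I}) : Q.barOn I (Q.barOn I α) = α :=
  Subtype.ext (Q.bar_bar α.1)

theorem card_src_restrict (i : I) :
    Nat.card {α : {α // Q.src α ∈ I} // (⟨Q.src α.1, α.2⟩ : I) = i} = 2 := by
  rw [← Q.card_src i.1]
  exact Nat.card_congr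
    { toFun := fun α => ⟨α.1.1, congrArg Subtype.val α.2⟩
      invFun := fun α => ⟨⟨α.1, by rw [α.2]; exact i.2⟩, Subtype.ext α.2⟩
      left_inv := fun _ => rfl
      right_inv := fun _ => rfl }

/-- The permutation `f` of the restriction of a biserial quiver to a set of vertices. -/
noncomputable def restrictPerm : Equiv.Perm {α // Q.src α ∈ I} :=
  Equiv.ofBijective (fun α => Q.barOn I (Q.returnMap I α)) (Finite.injective_iff_bijective.1
    (((Function.LeftInverse.injective (Q.barOn_barOn I))).comp (Q.returnMap_injective I)))

/-- The restriction of a biserial quiver to a set of vertices. -/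
noncomputable def restrict : BiserialQuiver where
  Vert := I
  Arr := {α // Q.src α ∈ I}
  fintypeVert := Fintype.ofFinite _
  fintypeArr := Fintype.ofFinite _
  src α := ⟨Q.src α.1, α.2⟩
  tgt α := ⟨Q.src (Q.restrictPerm I α).1, (Q.restrictPerm I α).2⟩
  f := Q.restrictPerm I
  src_f _ := rfl
  card_src := Q.card_src_restrict I
  card_tgt i := by
    rw [← Q.card_src_restrict I i]
    exact Nat.card_congr ((Q.restrictPerm I).subtypeEquiv fun _ => Iff.rfl)

theorem restrict_bar (α : {α // Q.src α ∈ I}) : (Q.restrict I).bar α = Q.barOn I α :=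
  (eq_bar_of_ne (Q := Q.restrict I) (α := α) (β := Q.barOn I α) (Subtype.ext (Q.src_bar α.1))
    fun h => Q.bar_ne α.1 (congrArg Subtype.val h)).symm

theorem restrict_g (α : {α // Q.src α ∈ I}) : (Q.restrict I).g α = Q.returnMap I α :=
  (Q.restrict_bar I (Q.restrictPerm I α)).trans (Q.barOn_barOn I _)

variable {Q}

/-- The restriction of a weight. -/
noncomputable def Weight.restrict (w : Q.Weight) : (Q.restrict I).Weight where
  m α := w.m α.1
  pos α := w.pos α.1
  orbit α := (congrArg (fun β : {α // Q.src α ∈ I} => w.m β.1) (Q.restrict_g I α)).trans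
    (w.m_iterate _ _)

/-- The first return structure of the restriction to a set of vertices. -/
noncomputable def restrictFirstReturn (w : Q.Weight) : FirstReturn (w.restrict I) w where
  onArr := Subtype.val
  onVert := Subtype.val
  time := Q.returnTime I
  onArr_injective := Subtype.val_injective
  onVert_injective := Subtype.val_injective
  src_onArr _ := rfl
  onArr_bar α := congrArg Subtype.val (Q.restrict_bar I α)
  time_pos := Q.returnTime_pos I
  iterate_time α := (congrArg Subtype.val (Q.restrict_g I α)).symm
  ne_onArr α l h0 hl β h := Q.notMem_of_lt_returnTime I α h0 hl (by
    rw [h]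
    exact β.2)
  weight _ := rfl

/-- The augmentation of `e` has entries 0 and 1. With `I` the set of vertices where the entry is 1,
`e` and the sum of the idempotents of `I` have the same augmentation, hence are conjugate. -/
theorem exists_restrict {w : Q.Weight} {K : Type u} [Field K] {e : Q.BiserialAlgebra w K}
    (he : IsIdempotentElem e) : ∃ I : Set Q.Vert, Nonempty
      (he.Corner ≃ₐ[K] (Q.restrict I).BiserialAlgebra (w.restrict I) K) := by
  classical
  let I : Set Q.Vert := {i | Q.augmentation w K e i = 1}
  let R := restrictFirstReturn I w
  have h1 : Q.augmentation w K e = Q.augmentation w K (R.idemSum K) := by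
    funext i
    rw [FirstReturn.idemSum, map_sum, Finset.sum_apply]
    simp only [augmentation_idem]
    have hidem : Q.augmentation w K e i * Q.augmentation w K e i = Q.augmentation w K e i := by
      rw [← Pi.mul_apply, ← map_mul, he.eq]
    by_cases hi : i ∈ I
    · refine Eq.trans hi (Eq.symm ((Finset.sum_eq_single (ι := (Q.restrict I).Vert)
        (⟨i, hi⟩ : I) ?_ ?_).trans
        (Pi.single_eq_same (M := fun _ => K) i 1)))
      · intro j _ hj
        exact Pi.single_eq_of_ne (fun h => hj (Subtype.ext h.symm)) _
      · exact fun h => absurd (Finset.mem_univ _) h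
    · refine Eq.trans ?_ (Finset.sum_eq_zero fun j _ => Pi.single_eq_of_ne ?_ _).symm
      · by_contra hne
        exact hi (mul_left_cancel₀ hne (hidem.trans (mul_one _).symm))
      · rintro rfl
        exact hi j.2
  obtain ⟨u, hu⟩ := exists_unit_conj (Q.augmentation w K).toRingHom
    (fun x hx => Q.isNilpotent_of_augmentation w K hx) he (R.isIdempotentElem_idemSum K) h1
  exact ⟨I, ⟨(cornerConj he (R.isIdempotentElem_idemSum K) u hu).trans (R.algEquiv K).symm⟩⟩

end Restrict

/-! ### Indecomposability and connectedness -/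

section Connected

variable {Q : BiserialQuiver} {w : Q.Weight} {K : Type u} [Field K]

theorem idem_ne_zero (i : Q.Vert) : Q.idem w K i ≠ 0 := by
  have h := (linearIndependent_basisVec (Q := Q) (w := w) K).ne_zero (.inl i)
  simpa [basisVec, indexWalk, gWalk, walk_zero] using h

/-- The quiver of an indecomposable algebra is connected. -/
theorem eq_univ_of_isIndecomposable (h : IsIndecomposableAlgebra (Q.BiserialAlgebra w K))
    {S : Set Q.Vert} (hS : ∀ α, Q.src α ∈ S ↔ Q.tgt α ∈ S) {i : Q.Vert} (hi : i ∈ S)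
    (j : Q.Vert) : j ∈ S := by
  classical
  have hs := Q.isSystem w K
  -- The sum of the idempotents of `S`. A walk starts in `S` if and only if it ends there, so `c` is
  -- a central idempotent and must be 0 or 1; the idempotents of vertices, being nonzero, then
  -- decide between the two.
  let c : Q.BiserialAlgebra w K := ∑ i, if i ∈ S then Q.idem w K i else 0
  have hc1 : ∀ i, c * Q.idem w K i = if i ∈ S then Q.idem w K i else 0 := by
    intro i
    rw [Finset.sum_mul, Finset.sum_eq_single i]
    · split_ifs
      · exact hs.mul_self i
      · exact zero_mul _
    · intro k _ hk
      split_ifs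
      · exact hs.mul_ne _ _ hk
      · exact zero_mul _
    · exact fun h => absurd (Finset.mem_univ _) h
  have hc2 : ∀ i, Q.idem w K i * c = if i ∈ S then Q.idem w K i else 0 := by
    intro i
    rw [Finset.mul_sum, Finset.sum_eq_single i]
    · split_ifs
      · exact hs.mul_self i
      · exact mul_zero _
    · intro k _ hk
      split_ifs
      · exact hs.mul_ne _ _ hk.symm
      · exact mul_zero _
    · exact fun h => absurd (Finset.mem_univ _) h
  have hidem : IsIdempotentElem c := by
    rw [IsIdempotentElem]
    conv_lhs => arg 2; rw [show c = ∑ i, if i ∈ S then Q.idem w K i else 0 from rfl]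
    rw [Finset.mul_sum]
    refine Finset.sum_congr rfl fun i _ => ?_
    split_ifs with hi
    · rw [hc1, if_pos hi]
    · exact mul_zero _
  have hiter : ∀ α k, Q.src (Q.g^[k] α) ∈ S ↔ Q.src α ∈ S := by
    intro α k
    induction k with
    | zero => rfl
    | succ k ih => rw [Function.iterate_succ_apply', src_g, ← hS, ih]
  have hcentral : ∀ x, c * x = x * c := by
    intro x
    have hx : x ∈ Submodule.span K (Set.range fun p : Q.Arr × ℕ => Q.gWalk w K p.1 p.2) := by
      rw [span_gWalk]; trivial
    induction hx using Submodule.span_induction with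
    | zero => rw [mul_zero, zero_mul]
    | add x y _ _ hx hy => rw [mul_add, add_mul, hx, hy]
    | smul a x _ hx => rw [mul_smul_comm, smul_mul_assoc, hx]
    | mem x hx =>
      obtain ⟨⟨α, k⟩, rfl⟩ := hx
      simp only [gWalk]
      have e1 : c * walk (Q.idem w K) (Q.arr w K) α k =
          if Q.src α ∈ S then walk (Q.idem w K) (Q.arr w K) α k else 0 := by
        conv_lhs => rw [← src_mul_walk hs.toIsPathSystem, ← mul_assoc, hc1]
        rw [ite_mul, zero_mul, src_mul_walk hs.toIsPathSystem]
      have e2 : walk (Q.idem w K) (Q.arr w K) α k * c =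
          if Q.src α ∈ S then walk (Q.idem w K) (Q.arr w K) α k else 0 := by
        conv_lhs => rw [← walk_mul_src hs.toIsPathSystem, mul_assoc, hc2]
        simp only [hiter]
        rw [mul_ite, mul_zero, walk_mul_src hs.toIsPathSystem]
      rw [e1, e2]
  rcases h.2 c hidem hcentral with h0 | h1
  · have := hc1 i
    rw [h0, zero_mul, if_pos hi] at this
    exact absurd this.symm (idem_ne_zero i)
  · by_contra hj
    have := hc1 j
    rw [h1, one_mul, if_neg hj] at this
    exact idem_ne_zero j this

theorem nonempty_vert (h : Nontrivial (Q.BiserialAlgebra w K)) : Nonempty Q.Vert := by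
  by_contra he
  rw [not_nonempty_iff] at he
  have := (Q.isSystem w K).sum_eq
  rw [Finset.univ_eq_empty, Finset.sum_empty] at this
  exact zero_ne_one this

end Connected

/-! ### Biserial quivers as Brauer graphs -/

section ToBrauerGraph

variable (Q : BiserialQuiver)

/-- A numbering of the two arrows which start at each vertex. -/
noncomputable def label (h : Q.Vert × Bool) : Q.Arr :=
  if h.2 then Q.arrowAt h.1 else Q.bar (Q.arrowAt h.1)

@[simp] theorem src_label (h : Q.Vert × Bool) : Q.src (Q.label h) = h.1 := by
  rw [label]
  split_ifs <;> simp

theorem bar_label (i : Q.Vert) (b : Bool) : Q.bar (Q.label (i, b)) = Q.label (i, !b) := by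
  cases b <;> simp [label]

theorem label_bijective : Function.Bijective Q.label := by
  constructor
  · rintro ⟨i, b⟩ ⟨j, c⟩ h
    have h1 := congrArg Q.src h
    rw [src_label, src_label] at h1
    simp only at h1
    subst h1
    cases b <;> cases c
    · rfl
    · exact absurd h (Q.bar_ne _)
    · exact absurd h.symm (Q.bar_ne _)
    · rfl
  · intro α
    rcases eq_or_eq_bar (Q.src_arrowAt (Q.src α)) with h | h
    · exact ⟨(Q.src α, true), h⟩
    · refine ⟨(Q.src α, false), ?_⟩
      change Q.bar _ = _
      rw [h, bar_bar]

/-- The permutation of the half-edges which corresponds to `g`. -/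
noncomputable def nextPerm : Equiv.Perm (Q.Vert × Bool) :=
  (Equiv.ofBijective Q.label Q.label_bijective).trans
    ((Equiv.ofBijective Q.g (Finite.injective_iff_bijective.1 Q.g_injective)).trans
      (Equiv.ofBijective Q.label Q.label_bijective).symm)

@[simp] theorem label_nextPerm (h : Q.Vert × Bool) : Q.label (Q.nextPerm h) = Q.g (Q.label h) := by
  exact (Equiv.ofBijective Q.label Q.label_bijective).apply_symm_apply _

variable {Q} {w : Q.Weight} {K : Type u} [Field K]

theorem Weight.m_label_eq (w : Q.Weight) {h h' : Q.Vert × Bool}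
    (hs : Q.nextPerm.SameCycle h h') : w.m (Q.label h) = w.m (Q.label h') := by
  have key : ∀ h, w.m (Q.label (Q.nextPerm h)) = w.m (Q.label h) := fun h => by
    rw [label_nextPerm, w.orbit]
  have pow : ∀ (k : ℕ) h, w.m (Q.label ((Q.nextPerm ^ k) h)) = w.m (Q.label h) := by
    intro k
    induction k with
    | zero => exact fun _ => rfl
    | succ k ih => exact fun h => by rw [pow_succ', Equiv.Perm.mul_apply, key, ih]
  obtain ⟨k, -, rfl⟩ := hs.exists_pow_eq'
  rw [pow]

variable (w) in
/-- The Brauer graph of an indecomposable algebra `B(Q, f, m)`. -/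
noncomputable def toBrauerGraph (h : IsIndecomposableAlgebra (Q.BiserialAlgebra w K)) :
    BrauerGraph where
  Vertex := Quotient (Equiv.Perm.SameCycle.setoid Q.nextPerm)
  Edge := Q.Vert
  fintypeVertex := Fintype.ofFinite _
  vert h := Quotient.mk _ h
  nonempty_edge := nonempty_vert h.1
  connected := by
    intro v v'
    induction v using Quotient.inductionOn with
    | h x =>
    induction v' using Quotient.inductionOn with
    | h y =>
    let r : Quotient (Equiv.Perm.SameCycle.setoid Q.nextPerm) →
        Quotient (Equiv.Perm.SameCycle.setoid Q.nextPerm) → Prop := fun a b =>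
      ∃ i : Q.Vert, ∃ ε : Bool, Quotient.mk _ (i, ε) = a ∧ Quotient.mk _ (i, !ε) = b
    -- The edges reachable from the given vertex of the graph. Testing the half `true` suffices,
    -- since the two halves of an edge are one step apart. An arrow joins two half-edges at the same
    -- vertex, so `S` is a union of connected components of the quiver.
    let S : Set Q.Vert := {i | Relation.ReflTransGen r (Quotient.mk _ x) (Quotient.mk _ (i, true))}
    have hmem : ∀ z : Q.Vert × Bool,
        z.1 ∈ S ↔ Relation.ReflTransGen r (Quotient.mk _ x) (Quotient.mk _ z) := by
      rintro ⟨i, _ | _⟩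
      · exact ⟨fun h => h.tail ⟨i, true, rfl, rfl⟩, fun h => h.tail ⟨i, false, rfl, rfl⟩⟩
      · rfl
    have hS : ∀ α, Q.src α ∈ S ↔ Q.tgt α ∈ S := by
      intro α
      obtain ⟨z, rfl⟩ := Q.label_bijective.2 α
      rw [← src_g, ← label_nextPerm, src_label, src_label, hmem, hmem]
      have : (Quotient.mk (Equiv.Perm.SameCycle.setoid Q.nextPerm) (Q.nextPerm z)) =
          Quotient.mk _ z := Quotient.sound (by
        exact Equiv.Perm.sameCycle_apply_left.2 (Equiv.Perm.SameCycle.refl _ _))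
      rw [this]
    exact (hmem y).1 (eq_univ_of_isIndecomposable h hS ((hmem x).2 .refl) y.1)
  next := Q.nextPerm
  sameCycle_next h h' := (Quotient.eq (r := Equiv.Perm.SameCycle.setoid Q.nextPerm)).symm
  mult := Quotient.lift (fun h => w.m (Q.label h)) fun _ _ h => w.m_label_eq h
  mult_pos v := by
    induction v using Quotient.inductionOn with
    | h x => exact w.pos _

/-- The first return structure of the numbering of the arrows. -/
noncomputable def toBrauerGraphFirstReturn
    (h : IsIndecomposableAlgebra (Q.BiserialAlgebra w K)) :
    FirstReturn (toBrauerGraph w h).toWeight w where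
  onArr := Q.label
  onVert i := i
  -- The numbering is a bijection onto all arrows, so every step of `g` is already a return.
  time _ := 1
  onArr_injective := Q.label_bijective.1
  onVert_injective := Function.injective_id
  src_onArr := Q.src_label
  onArr_bar α := by
    exact (congrArg Q.label (BrauerGraph.bar_eq _ α)).trans (Q.bar_label _ _).symm
  time_pos _ := one_pos
  iterate_time α := by
    rw [BrauerGraph.g_eq]
    exact (Q.label_nextPerm α).symm
  ne_onArr α l h0 h1 := by omega
  weight _ := rfl

/-- The first return structure has all vertices in its image, so the idempotent is 1 and the corner
is the whole algebra. -/
theorem isBrauerGraphAlgebra (h : IsIndecomposableAlgebra (Q.BiserialAlgebra w K)) :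
    IsBrauerGraphAlgebra K (Q.BiserialAlgebra w K) := by
  let R := toBrauerGraphFirstReturn h
  have h1 : R.idemSum K = 1 := (Q.isSystem w K).sum_eq
  obtain ⟨F⟩ := (toBrauerGraph w h).nonempty_algEquiv K
  exact ⟨_, ⟨(F.trans ((R.algEquiv K).trans
    (cornerOne K (R.isIdempotentElem_idemSum K) h1))).symm⟩⟩

end ToBrauerGraph

theorem _root_.IsIndecomposableAlgebra.of_ringEquiv {A B : Type*} [Ring A] [Ring B] (F : A ≃+* B)
    (h : IsIndecomposableAlgebra A) : IsIndecomposableAlgebra B := by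
  obtain ⟨h1, h2⟩ := h
  refine ⟨F.symm.toEquiv.nontrivial, fun e he hc => ?_⟩
  have h3 := h2 (F.symm e) (by rw [IsIdempotentElem, ← map_mul, he.eq]) fun a => by
    have := congrArg F.symm (hc (F a))
    simpa using this
  rcases h3 with h3 | h3
  · exact Or.inl (by simpa using h3)
  · exact Or.inr (by simpa using h3)

/-- An indecomposable idempotent algebra of an algebra `B(Q, f, m)` is a Brauer graph algebra. -/
theorem isBrauerGraphAlgebra_of_corner {Q : BiserialQuiver} {w : Q.Weight} {K : Type u} [Field K]
    {A : Type v} [Ring A] [Algebra K A] (hA : IsIndecomposableAlgebra A)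
    {e : Q.BiserialAlgebra w K} (he : IsIdempotentElem e) (F : A ≃ₐ[K] he.Corner) :
    IsBrauerGraphAlgebra K A := by
  obtain ⟨I, ⟨G⟩⟩ := exists_restrict he
  obtain ⟨Γ, ⟨H⟩⟩ := isBrauerGraphAlgebra (hA.of_ringEquiv (F.trans G).toRingEquiv)
  exact ⟨Γ, ⟨(F.trans G).trans H⟩⟩

end BiserialQuiver

/-! ### Disks as quotients and as chart domains -/

section Topology

/-- Two closed continuous surjections with the same fibres have homeomorphic targets. -/
theorem nonempty_homeomorph_of_fibres {W X Y : Type*} [TopologicalSpace W] [TopologicalSpace X]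
    [TopologicalSpace Y] [CompactSpace W] [T2Space X] [T2Space Y] {p : W → X} {q : W → Y}
    (hp : Continuous p) (hq : Continuous q) {U : Set X} {V : Set Y} (hUV : p ⁻¹' U = q ⁻¹' V)
    (hU : U ⊆ Set.range p) (hV : V ⊆ Set.range q)
    (hfib : ∀ w w', p w ∈ U → p w' ∈ U → (p w = p w' ↔ q w = q w')) : Nonempty (U ≃ₜ V) := by
  let p' : p ⁻¹' U → U := U.restrictPreimage p
  let q' : p ⁻¹' U → V := V.restrictPreimage q ∘ Homeomorph.setCongr hUV
  have sp : Function.Surjective p' := by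
    rintro ⟨x, hx⟩
    obtain ⟨w, rfl⟩ := hU hx
    exact ⟨⟨w, hx⟩, rfl⟩
  have sq : Function.Surjective (V.restrictPreimage q) := by
    rintro ⟨x, hx⟩
    obtain ⟨w, rfl⟩ := hV hx
    exact ⟨⟨w, hx⟩, rfl⟩
  -- A continuous map from a compact to a Hausdorff space is closed, and so is its restriction over
  -- any subset of the target. Hence `U` and `V` are quotients of one space by the same equivalence
  -- relation.
  have hp' : Topology.IsQuotientMap p' :=
    (hp.isClosedMap.restrictPreimage U).isQuotientMap hp.restrictPreimage sp
  have hq' : Topology.IsQuotientMap q' :=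
    ((hq.isClosedMap.restrictPreimage V).isQuotientMap hq.restrictPreimage sq).comp
      (Homeomorph.setCongr hUV).isQuotientMap
  have hpq : ∀ w w', p' w = p' w' ↔ q' w = q' w' := by
    intro w w'
    rw [Subtype.ext_iff, Subtype.ext_iff]
    exact hfib w.1 w'.1 w.2 w'.2
  have e1 : ∀ w, q' (Function.surjInv sp (p' w)) = q' w := fun w =>
    (hpq _ _).1 (Function.surjInv_eq sp _)
  have e2 : ∀ w, p' (Function.surjInv hq'.surjective (q' w)) = p' w := fun w =>
    (hpq _ _).2 (Function.surjInv_eq hq'.surjective _)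
  exact ⟨{
    toFun := fun u => q' (Function.surjInv sp u)
    invFun := fun v => p' (Function.surjInv hq'.surjective v)
    left_inv := fun u => by
      obtain ⟨w, rfl⟩ := sp u
      simp only [e1, e2]
    right_inv := fun v => by
      obtain ⟨w, rfl⟩ := hq'.surjective v
      simp only [e1, e2]
    continuous_toFun := by
      rw [hp'.continuous_iff]
      exact hq'.continuous.congr fun w => (e1 w).symm
    continuous_invFun := by
      rw [hq'.continuous_iff]
      exact hp'.continuous.congr fun w => (e2 w).symm }⟩

/-- The translated complex plane as the Euclidean plane. -/
noncomputable def planeHomeomorph : ℂ ≃ₜ EuclideanSpace ℝ (Fin 2) :=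
  Complex.orthonormalBasisOneI.repr.toHomeomorph.trans
    -- The shift by 2 moves the unit disk away from the boundary line of the half-plane.
    (Homeomorph.addRight (EuclideanSpace.single 0 2))

theorem planeHomeomorph_zero (z : ℂ) : planeHomeomorph z 0 = z.re + 2 := by
  simp [planeHomeomorph, Complex.orthonormalBasisOneI_repr_apply]

theorem re_add_two_pos (z : Metric.ball (0 : ℂ) 1) : 0 < z.1.re + 2 := by
  have h1 := Complex.abs_re_le_norm z.1
  have h2 : ‖z.1‖ < 1 := mem_ball_zero_iff.1 z.2
  have h3 := neg_abs_le z.1.re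
  linarith

/-- The open unit disk as an open subset of the half-plane. -/
noncomputable def diskToHalfPlane (z : Metric.ball (0 : ℂ) 1) : EuclideanHalfSpace 2 :=
  ⟨planeHomeomorph z.1, by
    rw [planeHomeomorph_zero]
    exact (re_add_two_pos z).le⟩

theorem isOpenEmbedding_diskToHalfPlane : Topology.IsOpenEmbedding diskToHalfPlane := by
  have h1 : Topology.IsOpenEmbedding fun z : Metric.ball (0 : ℂ) 1 => planeHomeomorph z.1 :=
    planeHomeomorph.isOpenEmbedding.comp Metric.isOpen_ball.isOpenEmbedding_subtypeVal
  have hc : Continuous diskToHalfPlane := h1.continuous.subtype_mk _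
  refine ⟨Topology.IsEmbedding.of_comp hc continuous_subtype_val h1.isEmbedding, ?_⟩
  have h2 := h1.isOpen_range.preimage
    (continuous_subtype_val : Continuous (Subtype.val : EuclideanHalfSpace 2 → _))
  refine (congrArg IsOpen (Set.ext fun x => ?_)).mpr h2
  constructor
  · rintro ⟨z, rfl⟩
    exact ⟨z, rfl⟩
  · rintro ⟨z, hz⟩
    exact ⟨z, Subtype.ext hz⟩

/-- An open set homeomorphic to the open disk is the domain of a chart in the half-plane with
values in the interior. -/
theorem exists_chart_of_homeomorph_disk {X : Type*} [TopologicalSpace X] {U : Set X}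
    (hU : IsOpen U) (e : U ≃ₜ Metric.ball (0 : ℂ) 1) :
    ∃ f : OpenPartialHomeomorph X (EuclideanHalfSpace 2), f.source = U ∧
      ∀ x ∈ U, 0 < (f x).1 0 := by
  have hne : Nonempty U := ⟨e.symm ⟨0, by simp⟩⟩
  let g : U → EuclideanHalfSpace 2 := diskToHalfPlane ∘ e
  have hg : Topology.IsOpenEmbedding g := isOpenEmbedding_diskToHalfPlane.comp e.isOpenEmbedding
  let i := (hU.isOpenEmbedding_subtypeVal).toOpenPartialHomeomorph
  let f := i.symm.trans (hg.toOpenPartialHomeomorph)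
  have hs : f.source = U := by
    simp [f, i]
  refine ⟨f, hs, fun x hx => ?_⟩
  have h1 : ∃ u, f x = g u := ⟨i.symm x, rfl⟩
  obtain ⟨u, hu⟩ := h1
  rw [hu]
  change 0 < planeHomeomorph (e u).1 0
  rw [planeHomeomorph_zero]
  exact re_add_two_pos _

end Topology

section Dihedral

/-! ### Orbits of two fixed-point-free involutions -/

/-- Two fixed-point-free involutions of a set. -/
structure InvolutionPair (X : Type*) where
  s : Equiv.Perm X
  t : Equiv.Perm X
  s_s : ∀ x, s (s x) = x
  t_t : ∀ x, t (t x) = x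
  s_ne : ∀ x, s x ≠ x
  t_ne : ∀ x, t x ≠ x

namespace InvolutionPair

variable {X : Type*} (D : InvolutionPair X) (x : X)

/-- The rotation of the cycles formed by the two involutions. -/
def rot : Equiv.Perm X := D.t * D.s

theorem rot_apply (y : X) : D.rot y = D.t (D.s y) := rfl

theorem s_zpow (k : ℤ) (y : X) : D.s ((D.rot ^ k) y) = (D.rot ^ (-k)) (D.s y) := by
  have hs : D.s * D.s = 1 := Equiv.ext D.s_s
  have ht : D.t * D.t = 1 := Equiv.ext D.t_t
  have h1 : SemiconjBy D.s D.rot D.rot⁻¹ := by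
    rw [SemiconjBy, rot, mul_inv_rev, inv_eq_of_mul_eq_one_left hs, inv_eq_of_mul_eq_one_left ht,
      mul_assoc]
  have h2 := h1.zpow_right k
  rw [inv_zpow'] at h2
  exact congrArg (fun f : Equiv.Perm X => f y) h2.eq

/-- If `s y = rot^k y`, the element halfway between would be fixed by an involution: by `s` if `k`
is even, by `t` if `k` is odd. This is why an orbit closes up to a cycle instead of an interval. -/
theorem s_ne_zpow (k : ℤ) (y : X) : D.s y ≠ (D.rot ^ k) y := by
  intro h
  rcases Int.even_or_odd' k with ⟨q, rfl | rfl⟩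
  · refine D.s_ne ((D.rot ^ q) y) ?_
    rw [s_zpow, h, ← Equiv.Perm.mul_apply, ← zpow_add]
    congr 2
    ring
  · refine D.t_ne ((D.rot ^ (q + 1)) y) ?_
    have h1 : ∀ z, D.t z = D.rot (D.s z) := fun z => by rw [rot_apply, D.s_s]
    rw [h1, s_zpow, h, ← Equiv.Perm.mul_apply, ← Equiv.Perm.mul_apply, ← zpow_one_add, ← zpow_add]
    congr 2
    ring

/-- The elements of the orbit of `x`, numbered cyclically. -/
def flag (r : ℤ) (b : Bool) : X := if b then D.s ((D.rot ^ r) x) else (D.rot ^ r) x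

@[simp] theorem flag_zero_false : D.flag x 0 false = x := rfl

theorem s_flag (r : ℤ) (b : Bool) : D.s (D.flag x r b) = D.flag x r (!b) := by
  cases b <;> simp [flag, D.s_s]

theorem t_flag_true (r : ℤ) : D.t (D.flag x r true) = D.flag x (r + 1) false := by
  have h : D.t (D.s ((D.rot ^ r) x)) = (D.rot ^ (r + 1)) x := by
    rw [← rot_apply, ← Equiv.Perm.mul_apply, ← zpow_one_add, add_comm]
  exact h

theorem t_flag_false (r : ℤ) : D.t (D.flag x r false) = D.flag x (r - 1) true := by
  have := D.t_flag_true x (r - 1)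
  rw [sub_add_cancel] at this
  rw [← this, D.t_t]

/-- The number of rotations in an orbit. -/
noncomputable def order : ℕ := Function.minimalPeriod D.rot x

theorem order_pos [Finite X] : 0 < D.order x :=
  Function.minimalPeriod_pos_of_mem_periodicPts (D.rot.injective.mem_periodicPts x)

theorem zpow_eq_iff (r r' : ℤ) : (D.rot ^ r) x = (D.rot ^ r') x ↔ (D.order x : ℤ) ∣ r - r' := by
  rw [order]
  have := MulAction.zpow_smul_eq_iff_minimalPeriod_dvd (a := D.rot) (b := x) (n := r - r')
  refine Iff.trans ?_ this
  rw [sub_eq_neg_add, zpow_add, mul_smul, zpow_neg, inv_smul_eq_iff]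
  rfl

theorem flag_eq_iff (r r' : ℤ) (b b' : Bool) :
    D.flag x r b = D.flag x r' b' ↔ b = b' ∧ (D.order x : ℤ) ∣ r - r' := by
  have key : ∀ r r' : ℤ, D.s ((D.rot ^ r) x) ≠ (D.rot ^ r') x := by
    intro r r' h
    refine D.s_ne_zpow (r' - r) ((D.rot ^ r) x) ?_
    rw [h, ← Equiv.Perm.mul_apply, ← zpow_add, sub_add_cancel]
  cases b <;> cases b'
  · simp [flag, zpow_eq_iff]
  · simpa [flag] using (key r' r).symm
  · simpa [flag] using key r r'
  · simp [flag, zpow_eq_iff]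

/-- The angle of a point of the sector with a given number, in units of half a rotation. -/
def angle (r : ℤ) (b : Bool) (c : ℝ) : ℝ := if b then 2 * r + c else 2 * r - c

variable {x} in
/-- The sectors of the orbit fit together to a circle. -/
theorem angle_eq_iff {r r' : ℤ} {b b' : Bool} {c c' : ℝ} (h0 : 0 ≤ c) (h1 : c ≤ 1)
    (h0' : 0 ≤ c') (h1' : c' ≤ 1) :
    (∃ k : ℤ, angle r b c = angle r' b' c' + 2 * D.order x * k) ↔
      c = c' ∧ (D.flag x r b = D.flag x r' b' ∨ c = 0 ∧ D.s (D.flag x r b) = D.flag x r' b' ∨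
        c = 1 ∧ D.t (D.flag x r b) = D.flag x r' b') := by
  constructor
  · rintro ⟨k, hk⟩
    have key : ∀ m : ℤ, (D.order x : ℤ) ∣ m - m + D.order x * k := fun m => by
      rw [sub_self, zero_add]
      exact dvd_mul_right _ _
    have cast : ∀ d : ℤ, (r : ℝ) - r' - D.order x * k = d → r - r' - D.order x * k = d :=
      fun d h => by exact_mod_cast h
    have bound : ∀ {a b : ℝ} (z : ℤ), (z : ℝ) = a → a < b → ∀ y : ℤ, (y : ℝ) = b → z < y :=
      fun {a b} z hz hab y hy => by
        rw [← hz, ← hy] at hab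
        exact_mod_cast hab
    have dvd : ∀ d : ℤ, r - r' - D.order x * k = d → (D.order x : ℤ) ∣ r - d - r' := fun d h =>
      ⟨k, by linarith⟩
    have same : c' - c = 0 → c = c' := fun h => by linarith
    -- With `n` the order, `2 (r - r' - n k)` equals `c - c'` up to sign for sectors of equal type,
    -- and `c + c'` up to sign otherwise. The integer in parentheses is 0 in the first case. In the
    -- second it is 0, forcing `c = c' = 0`, or of absolute value 1, forcing `c = c' = 1`: the two
    -- common rays with a neighbouring sector.
    cases b <;> cases b' <;> simp only [angle, if_true, if_false, Bool.false_eq_true] at hk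
    · have hz : (2 * (r - r' - D.order x * k) : ℝ) = c - c' := by linarith
      have h2 : (r - r' - D.order x * k : ℤ) = 0 := by
        have h3 : (-1 : ℝ) < ((r - r' - D.order x * k : ℤ) : ℝ) := by push_cast; linarith
        have h4 : ((r - r' - D.order x * k : ℤ) : ℝ) < 1 := by push_cast; linarith
        have h5 : (-1 : ℤ) < r - r' - D.order x * k := by exact_mod_cast h3
        have h6 : r - r' - D.order x * k < (1 : ℤ) := by exact_mod_cast h4
        omega
      have h7 : ((r - r' - D.order x * k : ℤ) : ℝ) = 0 := by rw [h2]; simp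
      push_cast at h7
      refine ⟨by linarith, Or.inl ((D.flag_eq_iff _ _ _ _ _).2 ⟨rfl, ?_⟩)⟩
      simpa using dvd 0 h2
    · have hz : (2 * (r - r' - D.order x * k) : ℝ) = c + c' := by linarith
      have h3 : (-1 : ℝ) < ((r - r' - D.order x * k : ℤ) : ℝ) := by push_cast; linarith
      have h4 : ((r - r' - D.order x * k : ℤ) : ℝ) < 2 := by push_cast; linarith
      have h5 : (-1 : ℤ) < r - r' - D.order x * k := by exact_mod_cast h3
      have h6 : r - r' - D.order x * k < (2 : ℤ) := by exact_mod_cast h4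
      have h2 : r - r' - D.order x * k = 0 ∨ r - r' - D.order x * k = 1 := by omega
      rcases h2 with h2 | h2
      · have h7 : ((r - r' - D.order x * k : ℤ) : ℝ) = 0 := by rw [h2]; simp
        push_cast at h7
        refine ⟨by linarith, Or.inr (Or.inl ⟨by linarith, ?_⟩)⟩
        rw [s_flag, flag_eq_iff]
        exact ⟨rfl, by simpa using dvd 0 h2⟩
      · have h7 : ((r - r' - D.order x * k : ℤ) : ℝ) = 1 := by rw [h2]; simp
        push_cast at h7
        refine ⟨by linarith, Or.inr (Or.inr ⟨by linarith, ?_⟩)⟩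
        rw [t_flag_false, flag_eq_iff]
        exact ⟨rfl, dvd 1 h2⟩
    · have hz : (2 * (r - r' - D.order x * k) : ℝ) = -(c + c') := by linarith
      have h3 : (-2 : ℝ) < ((r - r' - D.order x * k : ℤ) : ℝ) := by push_cast; linarith
      have h4 : ((r - r' - D.order x * k : ℤ) : ℝ) < 1 := by push_cast; linarith
      have h5 : (-2 : ℤ) < r - r' - D.order x * k := by exact_mod_cast h3
      have h6 : r - r' - D.order x * k < (1 : ℤ) := by exact_mod_cast h4
      have h2 : r - r' - D.order x * k = 0 ∨ r - r' - D.order x * k = -1 := by omega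
      rcases h2 with h2 | h2
      · have h7 : ((r - r' - D.order x * k : ℤ) : ℝ) = 0 := by rw [h2]; simp
        push_cast at h7
        refine ⟨by linarith, Or.inr (Or.inl ⟨by linarith, ?_⟩)⟩
        rw [s_flag, flag_eq_iff]
        exact ⟨rfl, by simpa using dvd 0 h2⟩
      · have h7 : ((r - r' - D.order x * k : ℤ) : ℝ) = -1 := by rw [h2]; simp
        push_cast at h7
        refine ⟨by linarith, Or.inr (Or.inr ⟨by linarith, ?_⟩)⟩
        rw [t_flag_true, flag_eq_iff]
        exact ⟨rfl, by simpa using dvd (-1) h2⟩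
    · have hz : (2 * (r - r' - D.order x * k) : ℝ) = c' - c := by linarith
      have h2 : (r - r' - D.order x * k : ℤ) = 0 := by
        have h3 : (-1 : ℝ) < ((r - r' - D.order x * k : ℤ) : ℝ) := by push_cast; linarith
        have h4 : ((r - r' - D.order x * k : ℤ) : ℝ) < 1 := by push_cast; linarith
        have h5 : (-1 : ℤ) < r - r' - D.order x * k := by exact_mod_cast h3
        have h6 : r - r' - D.order x * k < (1 : ℤ) := by exact_mod_cast h4
        omega
      have h7 : ((r - r' - D.order x * k : ℤ) : ℝ) = 0 := by rw [h2]; simp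
      push_cast at h7
      refine ⟨by linarith, Or.inl ((D.flag_eq_iff _ _ _ _ _).2 ⟨rfl, ?_⟩)⟩
      simpa using dvd 0 h2
  · rintro ⟨rfl, h | ⟨rfl, h⟩ | ⟨rfl, h⟩⟩
    · obtain ⟨rfl, k, hk⟩ := (D.flag_eq_iff _ _ _ _ _).1 h
      have hk' : (r : ℝ) - r' = D.order x * k := by exact_mod_cast hk
      refine ⟨k, ?_⟩
      cases b <;> simp only [angle, if_true, if_false, Bool.false_eq_true] <;> linarith
    · rw [s_flag, flag_eq_iff] at h
      obtain ⟨rfl, k, hk⟩ := h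
      have hk' : (r : ℝ) - r' = D.order x * k := by exact_mod_cast hk
      refine ⟨k, ?_⟩
      cases b <;> simp [angle] <;> linarith
    · cases b
      · rw [t_flag_false, flag_eq_iff] at h
        obtain ⟨rfl, k, hk⟩ := h
        have hk' : (r : ℝ) - 1 - r' = D.order x * k := by exact_mod_cast hk
        refine ⟨k, ?_⟩
        simp only [angle, if_true, if_false, Bool.false_eq_true]
        linarith
      · rw [t_flag_true, flag_eq_iff] at h
        obtain ⟨rfl, k, hk⟩ := h
        have hk' : (r : ℝ) + 1 - r' = D.order x * k := by exact_mod_cast hk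
        refine ⟨k, ?_⟩
        simp only [angle, if_true, if_false, Bool.false_eq_true]
        linarith

/-- Every angle belongs to one of the sectors. -/
theorem exists_angle_eq (y : ℝ) : ∃ (r : ℤ) (b : Bool) (c : ℝ), 0 ≤ c ∧ c ≤ 1 ∧ angle r b c = y := by
  have h1 := abs_sub_round (y / 2)
  rw [abs_le] at h1
  rcases le_total (2 * (round (y / 2) : ℝ)) y with h | h
  · exact ⟨round (y / 2), true, y - 2 * round (y / 2), by linarith, by linarith, by simp [angle]⟩
  · exact ⟨round (y / 2), false, 2 * round (y / 2) - y, by linarith, by linarith, by simp [angle]⟩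

end InvolutionPair

end Dihedral

/-! ### Barycentric and polar coordinates on the triangle -/

theorem fin_three_cases (i j : Fin 3) : i = j ∨ i = j + 1 ∨ i = j + 2 := by
  decide +revert

/-- The closed triangle. -/
abbrev StdTriangle : Type := stdSimplex ℝ (Fin (2 + 1))

namespace StdTriangle

theorem sum_eq_cyclic (f : Fin 3 → ℝ) (j : Fin 3) : ∑ i, f i = f j + f (j + 1) + f (j + 2) := by
  have h := Equiv.sum_comp (Equiv.addLeft j) f
  rw [← h, Fin.sum_univ_three]
  simp

theorem sum_eq (x : StdTriangle) (j : Fin 3) : x j + x (j + 1) + x (j + 2) = 1 := by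
  have h := stdSimplex.sum_eq_one x
  rwa [sum_eq_cyclic] at h

theorem ext_of {x y : StdTriangle} (j : Fin 3) (h1 : x (j + 1) = y (j + 1))
    (h2 : x (j + 2) = y (j + 2)) : x = y := by
  refine stdSimplex.ext (funext fun i => ?_)
  have hx := x.sum_eq j
  have hy := y.sum_eq j
  rcases fin_three_cases i j with rfl | rfl | rfl
  · change x i = y i
    linarith
  · exact h1
  · exact h2

theorem continuous_apply (i : Fin 3) : Continuous fun x : StdTriangle => x i :=
  (_root_.continuous_apply i).comp continuous_subtype_val

/-- The point with given coordinates. -/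
noncomputable def ofCoords (j : Fin 3) (a b : ℝ) (ha : 0 ≤ a) (hb : 0 ≤ b) (hab : a + b ≤ 1) :
    StdTriangle :=
  ⟨fun i => if i = j + 1 then a else if i = j + 2 then b else 1 - a - b, by
    constructor
    · intro i
      dsimp only
      split_ifs <;> linarith
    · have h1 : j + 2 ≠ j + 1 := by decide +revert
      have h2 : j ≠ j + 1 ∧ j ≠ j + 2 := by decide +revert
      rw [sum_eq_cyclic _ j, if_pos rfl, if_neg h1, if_pos rfl, if_neg h2.1, if_neg h2.2]
      ring⟩

theorem ofCoords_one (j : Fin 3) (a b : ℝ) (ha : 0 ≤ a) (hb : 0 ≤ b) (hab : a + b ≤ 1) :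
    ofCoords j a b ha hb hab (j + 1) = a :=
  if_pos rfl

theorem ofCoords_two (j : Fin 3) (a b : ℝ) (ha : 0 ≤ a) (hb : 0 ≤ b) (hab : a + b ≤ 1) :
    ofCoords j a b ha hb hab (j + 2) = b := by
  have h : j + 2 ≠ j + 1 := by decide +revert
  exact (if_neg h).trans (if_pos rfl)

/-- The sides on which a point lies. -/
def zeros (x : StdTriangle) : Set (Fin 3) := {i | x i = 0}

/-- The distance from the `j`-th corner. -/
def radius (j : Fin 3) (x : StdTriangle) : ℝ := x (j + 1) + x (j + 2)

theorem radius_nonneg (j : Fin 3) (x : StdTriangle) : 0 ≤ x.radius j :=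
  add_nonneg (stdSimplex.zero_le x _) (stdSimplex.zero_le x _)

theorem radius_lt_one_iff {j : Fin 3} {x : StdTriangle} : x.radius j < 1 ↔ 0 < x j := by
  have := x.sum_eq j
  rw [radius]
  constructor <;> intro h <;> linarith

theorem continuous_radius (j : Fin 3) : Continuous (radius j) :=
  (continuous_apply _).add (continuous_apply _)

/-- The direction of a point, seen from the `j`-th corner. -/
noncomputable def slope (j : Fin 3) (x : StdTriangle) : ℝ := x (j + 1) / x.radius j

theorem slope_nonneg (j : Fin 3) (x : StdTriangle) : 0 ≤ x.slope j :=
  div_nonneg (stdSimplex.zero_le x _) (x.radius_nonneg j)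

theorem slope_le_one (j : Fin 3) (x : StdTriangle) : x.slope j ≤ 1 :=
  div_le_one_of_le₀ (le_add_of_nonneg_right (stdSimplex.zero_le x _)) (x.radius_nonneg j)

theorem slope_eq_zero_iff {j : Fin 3} {x : StdTriangle} (h : x.radius j ≠ 0) :
    x.slope j = 0 ↔ x (j + 1) = 0 := by
  rw [slope, div_eq_zero_iff, or_iff_left h]

theorem slope_eq_one_iff {j : Fin 3} {x : StdTriangle} (h : x.radius j ≠ 0) :
    x.slope j = 1 ↔ x (j + 2) = 0 := by
  rw [slope, div_eq_one_iff_eq h, radius]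
  constructor <;> intro h <;> linarith

/-- Radius and slope are polar coordinates centred at the `j`-th corner; at the corner itself the
slope carries no information. -/
theorem eq_of_radius_slope {j : Fin 3} {x y : StdTriangle} (h1 : x.radius j = y.radius j)
    (h2 : x.radius j ≠ 0 → x.slope j = y.slope j) : x = y := by
  by_cases h : x.radius j = 0
  · have hx1 := stdSimplex.zero_le x (j + 1)
    have hx2 := stdSimplex.zero_le x (j + 2)
    have hy1 := stdSimplex.zero_le y (j + 1)
    have hy2 := stdSimplex.zero_le y (j + 2)
    rw [h] at h1
    rw [radius] at h h1
    exact ext_of j (by linarith) (by linarith)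
  · have h3 := h2 h
    rw [slope, slope, ← h1, div_left_inj' h] at h3
    refine ext_of j h3 ?_
    rw [radius, radius, h3] at h1
    linarith

end StdTriangle

/-! ### Gluing triangles along sides of equal number -/

/-- Finitely many triangles with sides numbered by `0, 1, 2`, and for every number a
fixed-point-free involution of the triangles which tells along which sides they are glued. -/
structure FlagSystem where
  Flag : Type
  [finite : Finite Flag]
  [nonempty : Nonempty Flag]
  s : Fin 3 → Equiv.Perm Flag
  s_s : ∀ i φ, s i (s i φ) = φ
  s_ne : ∀ i φ, s i φ ≠ φ
  connected : ∀ φ φ', Relation.ReflTransGen (fun a b => ∃ i, b = s i a) φ φ'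

namespace FlagSystem

attribute [instance] FlagSystem.finite FlagSystem.nonempty

variable (F : FlagSystem)

instance : TopologicalSpace F.Flag := ⊥

instance : DiscreteTopology F.Flag := ⟨rfl⟩

/-- Flags are equivalent if they are connected by involutions with numbers in `J`. -/
def adj (J : Set (Fin 3)) : Setoid F.Flag where
  r := Relation.ReflTransGen fun a b => ∃ i ∈ J, b = F.s i a
  iseqv := ⟨fun _ => .refl, fun h => by
    induction h with
    | refl => exact .refl
    | tail _ h ih =>
      obtain ⟨i, hi, rfl⟩ := h
      exact .head ⟨i, hi, (F.s_s i _).symm⟩ ih, fun h h' => h.trans h'⟩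

variable {F}

theorem adj_mono {J J' : Set (Fin 3)} (h : J ⊆ J') {φ φ' : F.Flag} (hφ : (F.adj J) φ φ') :
    (F.adj J') φ φ' :=
  Relation.ReflTransGen.mono (fun _ _ ⟨i, hi, hb⟩ => ⟨i, h hi, hb⟩) _ _ hφ

theorem adj_s {J : Set (Fin 3)} {i : Fin 3} (h : i ∈ J) (φ : F.Flag) : (F.adj J) φ (F.s i φ) :=
  Relation.ReflTransGen.single ⟨i, h, rfl⟩

/-- The orbits of a single involution. -/
theorem adj_singleton {i : Fin 3} {φ φ' : F.Flag} :
    (F.adj {i}) φ φ' ↔ φ' = φ ∨ φ' = F.s i φ := by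
  constructor
  · intro h
    induction h with
    | refl => exact Or.inl rfl
    | tail _ h ih =>
      obtain ⟨k, rfl, rfl⟩ := h
      rcases ih with rfl | rfl
      · exact Or.inr rfl
      · exact Or.inl (F.s_s _ _)
  · rintro (rfl | rfl)
    · exact .refl
    · exact adj_s (Set.mem_singleton i) φ

variable (F)

/-- The gluing of the triangles. -/
def gluing : Setoid (F.Flag × StdTriangle) where
  r p q := p.2 = q.2 ∧ (F.adj p.2.zeros) p.1 q.1
  iseqv := ⟨fun _ => ⟨rfl, (F.adj _).refl _⟩, fun ⟨h1, h2⟩ => ⟨h1.symm, h1 ▸ (F.adj _).symm h2⟩,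
    fun ⟨h1, h2⟩ ⟨h3, h4⟩ => ⟨h1.trans h3, (F.adj _).trans h2 (h1 ▸ h4)⟩⟩

/-- The surface obtained by gluing the triangles. -/
def Surface : Type := Quotient F.gluing

instance : TopologicalSpace F.Surface := inferInstanceAs (TopologicalSpace (Quotient F.gluing))

/-- A point of a triangle, as a point of the surface. -/
def point (φ : F.Flag) (x : StdTriangle) : F.Surface := Quotient.mk F.gluing (φ, x)

variable {F}

theorem point_eq_iff {φ φ' : F.Flag} {x x' : StdTriangle} :
    F.point φ x = F.point φ' x' ↔ x = x' ∧ (F.adj x.zeros) φ φ' :=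
  Quotient.eq (r := F.gluing)

theorem exists_point (P : F.Surface) : ∃ φ x, P = F.point φ x := by
  induction P using Quotient.inductionOn with
  | h p => exact ⟨p.1, p.2, rfl⟩

theorem continuous_point' : Continuous fun p : F.Flag × StdTriangle => F.point p.1 p.2 :=
  continuous_quotient_mk'

theorem continuous_point (φ : F.Flag) : Continuous (F.point φ) :=
  continuous_point'.comp (Continuous.prodMk_right φ)

variable (F) in
/-- The position of a point of the surface in its triangle. -/
def position : F.Surface → StdTriangle := Quotient.lift (fun p => p.2) fun _ _ h => h.1

@[simp] theorem position_point (φ : F.Flag) (x : StdTriangle) : F.position (F.point φ x) = x := rfl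

theorem continuous_position : Continuous F.position := continuous_snd.quotient_lift _

instance : CompactSpace F.Surface := inferInstanceAs (CompactSpace (Quotient F.gluing))

open Classical in
variable (F) in
/-- The functions which separate the points of the surface with equal positions. -/
noncomputable def separate (J : Set (Fin 3)) (o : Quotient (F.adj J)) : F.Surface → ℝ :=
  Quotient.lift (fun p => if Quotient.mk _ p.1 = o then ∏ i, if i ∈ J then 1 else p.2 i else 0) (by
    rintro ⟨φ, x⟩ ⟨φ', x'⟩ ⟨h1, h2⟩
    simp only at h1 h2 ⊢
    subst h1
    by_cases h : x.zeros ⊆ J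
    · have : (Quotient.mk (F.adj J) φ) = Quotient.mk _ φ' := Quotient.sound (adj_mono h h2)
      rw [this]
    -- A point on a side outside `J` may be glued to flags of another class, but there the product
    -- of the coordinates outside `J` vanishes.
    · obtain ⟨i, hi, hJ⟩ := Set.not_subset.1 h
      have : (∏ i, if i ∈ J then 1 else x i) = 0 :=
        Finset.prod_eq_zero (Finset.mem_univ i) (by rw [if_neg hJ]; exact hi)
      rw [this, ite_self, ite_self])

theorem continuous_separate (J : Set (Fin 3)) (o : Quotient (F.adj J)) :
    Continuous (F.separate J o) := by
  refine Continuous.quotient_lift ?_ _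
  rw [continuous_prod_of_discrete_left]
  intro φ
  by_cases h : Quotient.mk _ φ = o
  · simp only [h, if_true]
    refine continuous_finsetProd _ fun i _ => ?_
    by_cases hi : i ∈ J
    · simp only [hi, if_true]
      exact continuous_const
    · simp only [hi, if_false]
      exact StdTriangle.continuous_apply i
  · simp only [h, if_false]
    exact continuous_const

/-- Position and the functions `separate` give a continuous injection into a Hausdorff space. For
two points with the same position `x`, take `J = x.zeros`: the product is then nonzero, and the
function detects the class of the flag. -/
instance : T2Space F.Surface := by
  classical
  refine T2Space.of_injective_continuous (f := fun P : F.Surface =>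
    (F.position P, fun (J : Set (Fin 3)) (o : Quotient (F.adj J)) => F.separate J o P)) ?_ ?_
  · intro P P' h
    obtain ⟨φ, x, rfl⟩ := exists_point P
    obtain ⟨φ', x', rfl⟩ := exists_point P'
    rw [Prod.mk.injEq] at h
    obtain ⟨h1, h2⟩ := h
    simp only [position_point] at h1
    subst h1
    refine point_eq_iff.2 ⟨rfl, ?_⟩
    have h3 := congrFun (congrFun h2 x.zeros) (Quotient.mk _ φ')
    have h4 : (∏ i, if i ∈ x.zeros then 1 else x i) ≠ 0 := by
      rw [Finset.prod_ne_zero_iff]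
      intro i _
      split_ifs with hi
      · exact one_ne_zero
      · exact hi
    have e : ∀ ψ, F.separate x.zeros (Quotient.mk _ φ') (F.point ψ x) =
      if Quotient.mk (F.adj x.zeros) ψ = Quotient.mk _ φ' then
        ∏ i, if i ∈ x.zeros then 1 else x i else 0 := fun _ => rfl
    simp only [e, if_true] at h3
    split_ifs at h3 with h5
    · exact Quotient.exact h5
    · exact absurd h3.symm h4
  · exact continuous_position.prodMk
      (continuous_pi fun J => continuous_pi fun o => continuous_separate J o)

instance : ConnectedSpace F.Surface := by
  have h : IsConnected (⋃ φ : F.Flag, Set.range (F.point φ)) := by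
    refine IsConnected.iUnion_of_reflTransGen (fun φ => isConnected_range (continuous_point φ))
      fun φ φ' => ?_
    refine Relation.ReflTransGen.mono ?_ _ _ (F.connected φ φ')
    rintro φ _ ⟨i, rfl⟩
    -- A corner different from the `i`-th lies on side `i`, so it is common to the triangles `φ` and
    -- `s i φ`.
    obtain ⟨j, hj⟩ : ∃ j : Fin 3, j ≠ i := exists_ne i
    refine ⟨F.point φ (stdSimplex.vertex j), ⟨_, rfl⟩, stdSimplex.vertex j, ?_⟩
    refine (point_eq_iff.2 ⟨rfl, adj_s ?_ φ⟩).symm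
    change (stdSimplex.vertex j : StdTriangle) i = 0
    simp [stdSimplex.vertex_coe, hj]
  have h2 : (⋃ φ : F.Flag, Set.range (F.point φ)) = Set.univ := by
    rw [Set.eq_univ_iff_forall]
    intro P
    obtain ⟨φ, x, rfl⟩ := exists_point P
    exact Set.mem_iUnion.2 ⟨φ, x, rfl⟩
  rw [h2] at h
  exact connectedSpace_iff_univ.2 h

/-! ### Open stars of corners as charts -/

section Chart

variable (F) in
/-- The two involutions which fix the `j`-th corner. -/
def pair (j : Fin 3) : InvolutionPair F.Flag where
  s := F.s (j + 1)
  t := F.s (j + 2)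
  s_s := F.s_s _
  t_t := F.s_s _
  s_ne := F.s_ne _
  t_ne := F.s_ne _

theorem adj_flag {J : Set (Fin 3)} {j : Fin 3} (h1 : j + 1 ∈ J) (h2 : j + 2 ∈ J) (φ : F.Flag)
    (r : ℤ) (b : Bool) : (F.adj J) φ ((F.pair j).flag φ r b) := by
  have step : ∀ ψ, (F.adj J) ψ ((F.pair j).rot ψ) := fun ψ =>
    (F.adj J).trans (adj_s h1 ψ) (adj_s h2 _)
  have key : ∀ r : ℤ, (F.adj J) φ (((F.pair j).rot ^ r) φ) := by
    intro r
    induction r using Int.induction_on with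
    | zero => exact (F.adj J).refl φ
    | succ n ih =>
      rw [add_comm, zpow_one_add]
      exact (F.adj J).trans ih (step _)
    | pred n ih =>
      have h := step (((F.pair j).rot ^ (-(n : ℤ) - 1)) φ)
      rw [← Equiv.Perm.mul_apply, ← zpow_one_add, add_sub_cancel] at h
      exact (F.adj J).trans ih ((F.adj J).symm h)
  cases b
  · exact key r
  · exact (F.adj J).trans (key r) (adj_s h1 _)

/-- Off the `j`-th corner and off the side opposite to it, at most one coordinate vanishes. So at
most one involution acts, and its orbits have two elements. -/
theorem adj_zeros_iff {j : Fin 3} {x : StdTriangle} (h : 0 < x j) (hr : x.radius j ≠ 0)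
    {φ φ' : F.Flag} : (F.adj x.zeros) φ φ' ↔ φ = φ' ∨ x.slope j = 0 ∧ (F.pair j).s φ = φ' ∨
      x.slope j = 1 ∧ (F.pair j).t φ = φ' := by
  rw [StdTriangle.slope_eq_zero_iff hr, StdTriangle.slope_eq_one_iff hr]
  constructor
  · intro hadj
    induction hadj with
    | refl => exact Or.inl rfl
    | tail _ h' ih =>
      obtain ⟨i, hi, rfl⟩ := h'
      have hi0 : x i = 0 := hi
      rcases fin_three_cases i j with rfl | rfl | rfl
      · exact absurd hi0 h.ne'
      · rcases ih with rfl | ⟨-, rfl⟩ | ⟨h2, rfl⟩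
        · exact Or.inr (Or.inl ⟨hi0, rfl⟩)
        · exact Or.inl (F.s_s _ _).symm
        · exact absurd (by rw [StdTriangle.radius, hi0, h2, add_zero]) hr
      · rcases ih with rfl | ⟨h2, rfl⟩ | ⟨-, rfl⟩
        · exact Or.inr (Or.inr ⟨hi0, rfl⟩)
        · exact absurd (by rw [StdTriangle.radius, hi0, h2, add_zero]) hr
        · exact Or.inl (F.s_s _ _).symm
  · rintro (rfl | ⟨h1, rfl⟩ | ⟨h1, rfl⟩)
    · exact (F.adj _).refl _
    · exact adj_s (show j + 1 ∈ x.zeros from h1) φ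
    · exact adj_s (show j + 2 ∈ x.zeros from h1) φ

variable (F) in
/-- The map from the triangles around a corner to the disk. -/
noncomputable def sector (j : Fin 3) (φ : F.Flag) (r : ℤ) (b : Bool) (x : StdTriangle) : ℂ :=
  -- The `2n` triangles around the corner, `n` being the order of the rotation, take an angle `π /
  -- n` each; the opposite sides lie on the unit circle.
  (x.radius j : ℂ) * Complex.exp
    ((Real.pi * InvolutionPair.angle r b (x.slope j) / (F.pair j).order φ : ℝ) * Complex.I)

theorem norm_sector (j : Fin 3) (φ : F.Flag) (r : ℤ) (b : Bool) (x : StdTriangle) :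
    ‖F.sector j φ r b x‖ = x.radius j := by
  rw [sector, norm_mul, Complex.norm_exp_ofReal_mul_I, mul_one, Complex.norm_real,
    Real.norm_of_nonneg (x.radius_nonneg j)]

theorem continuous_sector (j : Fin 3) (φ : F.Flag) (r : ℤ) (b : Bool) :
    Continuous (F.sector j φ r b) := by
  rw [continuous_iff_continuousAt]
  intro x
  -- The slope jumps at the corner, but the norm of the sector map is the radius, which tends to
  -- zero there.
  by_cases h : x.radius j = 0
  · have h0 : F.sector j φ r b x = 0 := by
      rw [← norm_eq_zero, norm_sector, h]
    rw [ContinuousAt, h0]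
    refine squeeze_zero_norm (fun y => (norm_sector j φ r b y).le) ?_
    rw [← h]
    exact (StdTriangle.continuous_radius j).continuousAt
  · have hs : ContinuousAt (StdTriangle.slope j) x :=
      (StdTriangle.continuous_apply _).continuousAt.div
        (StdTriangle.continuous_radius j).continuousAt h
    have ha : ContinuousAt (fun y : StdTriangle => InvolutionPair.angle r b (y.slope j)) x := by
      cases b
      · exact continuousAt_const.sub hs
      · exact continuousAt_const.add hs
    refine ContinuousAt.mul ?_ (ContinuousAt.cexp (ContinuousAt.mul ?_ continuousAt_const))
    · exact Complex.continuous_ofReal.continuousAt.comp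
        (StdTriangle.continuous_radius j).continuousAt
    · exact Complex.continuous_ofReal.continuousAt.comp
        ((continuousAt_const.mul ha).div_const _)

theorem sector_eq_iff {j : Fin 3} {φ : F.Flag} {r r' : ℤ} {b b' : Bool} {x x' : StdTriangle} :
    F.sector j φ r b x = F.sector j φ r' b' x' ↔ x.radius j = x'.radius j ∧
      (x.radius j ≠ 0 → ∃ k : ℤ, InvolutionPair.angle r b (x.slope j) =
        InvolutionPair.angle r' b' (x'.slope j) + 2 * (F.pair j).order φ * k) := by
  have hn : ((F.pair j).order φ : ℝ) ≠ 0 := by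
    exact_mod_cast ((F.pair j).order_pos φ).ne'
  have hπ := Real.pi_ne_zero
  have key : x.radius j = x'.radius j → x.radius j ≠ 0 →
      (F.sector j φ r b x = F.sector j φ r' b' x' ↔
      ∃ k : ℤ, InvolutionPair.angle r b (x.slope j) =
        InvolutionPair.angle r' b' (x'.slope j) + 2 * (F.pair j).order φ * k) := by
    intro h1 h2
    rw [sector, sector, ← h1, mul_right_inj' (by exact_mod_cast h2),
      Complex.exp_eq_exp_iff_exists_int]
    refine exists_congr fun k => ?_
    have e : ∀ A A' : ℝ, ((A : ℂ) * Complex.I = A' * Complex.I + k * (2 * Real.pi * Complex.I)) ↔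
        A = A' + k * (2 * Real.pi) := by
      intro A A'
      have : (A' : ℂ) * Complex.I + k * (2 * Real.pi * Complex.I) =
          ((A' + k * (2 * Real.pi) : ℝ) : ℂ) * Complex.I := by
        push_cast
        ring
      rw [this, mul_left_inj' Complex.I_ne_zero, Complex.ofReal_inj]
    rw [e]
    constructor
    · intro h
      field_simp at h
      linarith
    · intro h
      rw [h]
      field_simp
  constructor
  · intro h
    have h1 : x.radius j = x'.radius j := by
      rw [← norm_sector j φ r b x, h, norm_sector]
    exact ⟨h1, fun h2 => (key h1 h2).1 h⟩
  · rintro ⟨h1, h2⟩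
    by_cases h3 : x.radius j = 0
    · rw [sector, sector, ← h1, h3]
      simp
    · exact (key h1 h3).2 (h2 h3)

/-- The map to the disk identifies exactly the points which are glued. -/
theorem point_eq_iff_sector_eq {j : Fin 3} {φ : F.Flag} {r r' : ℤ} {b b' : Bool}
    {x x' : StdTriangle} (hx : 0 < x j) :
    F.point ((F.pair j).flag φ r b) x = F.point ((F.pair j).flag φ r' b') x' ↔
      F.sector j φ r b x = F.sector j φ r' b' x' := by
  rw [point_eq_iff, sector_eq_iff]
  have ang := fun h0 h1 h2 h3 => (F.pair j).angle_eq_iff (x := φ) (r := r) (r' := r') (b := b)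
    (b' := b') (c := x.slope j) (c' := x'.slope j) h0 h1 h2 h3
  replace ang := ang (x.slope_nonneg j) (x.slope_le_one j) (x'.slope_nonneg j) (x'.slope_le_one j)
  constructor
  · rintro ⟨rfl, h⟩
    refine ⟨rfl, fun h0 => ang.2 ⟨rfl, (adj_zeros_iff hx h0).1 h⟩⟩
  · rintro ⟨h1, h2⟩
    have hxx : x = x' := StdTriangle.eq_of_radius_slope h1 fun h0 => (ang.1 (h2 h0)).1
    refine ⟨hxx, ?_⟩
    -- At the corner both involutions act, so all triangles of the orbit are glued there.
    by_cases h0 : x.radius j = 0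
    · have h3 := stdSimplex.zero_le x (j + 1)
      have h4 := stdSimplex.zero_le x (j + 2)
      rw [StdTriangle.radius] at h0
      have h5 : j + 1 ∈ x.zeros := by change x (j + 1) = 0; linarith
      have h6 : j + 2 ∈ x.zeros := by change x (j + 2) = 0; linarith
      exact (F.adj _).trans ((F.adj _).symm (adj_flag h5 h6 φ r b)) (adj_flag h5 h6 φ r' b')
    · exact (adj_zeros_iff hx h0).2 (ang.1 (h2 h0)).2

variable (F) in
/-- The open star of a vertex: the union of the triangles around it, without the opposite sides. -/
def star (j : Fin 3) (φ : F.Flag) : Set F.Surface :=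
  {P | ∃ r b x, 0 < x j ∧ P = F.point ((F.pair j).flag φ r b) x}

/-- The complement is the image of a closed set under a closed map: the triangles outside the orbit
and the sides opposite to the corner. Where `x j > 0` only the two involutions of `pair j` can act,
so gluing never leaves the orbit. -/
theorem isOpen_star (j : Fin 3) (φ : F.Flag) : IsOpen (F.star j φ) := by
  have hclosed : IsClosed ((fun p : F.Flag × StdTriangle => F.point p.1 p.2) ''
      {p | p.2 j = 0 ∨ ∀ r b, p.1 ≠ (F.pair j).flag φ r b}) := by
    refine continuous_point'.isClosedMap _ ?_
    refine IsClosed.union ?_ ?_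
    · exact isClosed_eq ((StdTriangle.continuous_apply j).comp continuous_snd) continuous_const
    · exact (isClosed_discrete {ψ : F.Flag | ∀ r b, ψ ≠ (F.pair j).flag φ r b}).preimage
        continuous_fst
  convert hclosed.isOpen_compl using 1
  ext P
  rw [Set.mem_compl_iff]
  constructor
  · rintro ⟨r, b, x, hx, rfl⟩ ⟨⟨ψ, y⟩, hy, hP⟩
    obtain ⟨rfl, hadj⟩ := point_eq_iff.1 hP
    rcases hy with hy | hy
    · exact hx.ne' hy
    · have hadj' := (F.adj _).symm hadj
      have key : ∀ ψ', (F.adj y.zeros) ((F.pair j).flag φ r b) ψ' →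
          ∃ r' b', ψ' = (F.pair j).flag φ r' b' := by
        intro ψ' h
        induction h with
        | refl => exact ⟨r, b, rfl⟩
        | tail _ h ih =>
          obtain ⟨i, hi, rfl⟩ := h
          obtain ⟨r', b', rfl⟩ := ih
          rcases fin_three_cases i j with rfl | rfl | rfl
          · exact absurd hi hx.ne'
          · exact ⟨_, _, (F.pair j).s_flag φ r' b'⟩
          · cases b'
            · exact ⟨_, _, (F.pair j).t_flag_false φ r'⟩
            · exact ⟨_, _, (F.pair j).t_flag_true φ r'⟩
      obtain ⟨r', b', h⟩ := key ψ hadj'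
      exact hy r' b' h
  · intro h
    obtain ⟨ψ, x, rfl⟩ := exists_point P
    by_contra hstar
    refine h ⟨(ψ, x), ?_, rfl⟩
    by_contra hn
    rw [Set.mem_ofPred_eq, not_or] at hn
    obtain ⟨h1, h2⟩ := hn
    push Not at h2
    obtain ⟨r, b, h2⟩ := h2
    simp only at h1 h2
    exact hstar ⟨r, b, x, lt_of_le_of_ne (stdSimplex.zero_le x j) (Ne.symm h1), by rw [← h2]⟩

/-- Star and disk are both covered by finitely many copies of the triangle, with the same fibres by
`point_eq_iff_sector_eq`, so `nonempty_homeomorph_of_fibres` applies. -/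
theorem nonempty_star_homeomorph (j : Fin 3) (φ : F.Flag) :
    Nonempty (F.star j φ ≃ₜ Metric.ball (0 : ℂ) 1) := by
  set n : ℤ := ((F.pair j).order φ : ℤ) with hn
  have hpos : 0 < n := Int.natCast_pos.2 ((F.pair j).order_pos φ)
  -- A finite, hence compact, choice of sector numbers. They meet every residue modulo `n`, and they
  -- suffice for all arguments in `(-π, π]`, where the angle is at most `n` in absolute value.
  let W := Set.Icc (-n) n × Bool × StdTriangle
  let p : W → F.Surface := fun w => F.point ((F.pair j).flag φ w.1 w.2.1) w.2.2
  let q : W → ℂ := fun w => F.sector j φ w.1 w.2.1 w.2.2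
  have hp : Continuous p := by
    rw [continuous_prod_of_discrete_left]
    intro r
    rw [continuous_prod_of_discrete_left]
    exact fun b => continuous_point ((F.pair j).flag φ r b)
  have hq : Continuous q := by
    rw [continuous_prod_of_discrete_left]
    intro r
    rw [continuous_prod_of_discrete_left]
    exact fun b => continuous_sector j φ r b
  have hU : ∀ w, p w ∈ F.star j φ ↔ 0 < w.2.2 j := by
    intro w
    constructor
    · rintro ⟨r, b, x, hx, h⟩
      rw [(point_eq_iff.1 h).1]
      exact hx
    · intro h
      exact ⟨_, _, _, h, rfl⟩
  have hV : ∀ w, q w ∈ Metric.ball (0 : ℂ) 1 ↔ 0 < w.2.2 j := by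
    intro w
    rw [mem_ball_zero_iff, norm_sector, StdTriangle.radius_lt_one_iff]
  refine nonempty_homeomorph_of_fibres hp hq ?_ ?_ ?_ ?_
  · ext w
    rw [Set.mem_preimage, Set.mem_preimage, hU, hV]
  · rintro _ ⟨r, b, x, hx, rfl⟩
    have h1 := Int.emod_nonneg r hpos.ne'
    have h2 := Int.emod_lt_of_pos r hpos
    refine ⟨(⟨r % n, by constructor <;> omega⟩, b, x), ?_⟩
    have : (F.pair j).flag φ (r % n) b = (F.pair j).flag φ r b := by
      rw [InvolutionPair.flag_eq_iff, ← hn]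
      refine ⟨rfl, ?_⟩
      rw [← dvd_neg, neg_sub]
      exact Int.dvd_self_sub_emod
    simp only [p, this]
  · intro z hz
    rw [mem_ball_zero_iff] at hz
    have hnR : (0 : ℝ) < (F.pair j).order φ := Nat.cast_pos.2 ((F.pair j).order_pos φ)
    have hnn : (n : ℝ) = ((F.pair j).order φ : ℝ) := by exact_mod_cast hn
    obtain ⟨r, b, c, h0, h1, hrc⟩ :=
      InvolutionPair.exists_angle_eq (z.arg * (F.pair j).order φ / Real.pi)
    have hc0 := norm_nonneg z
    -- The point with radius `‖z‖` and slope `c`.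
    let x := StdTriangle.ofCoords j (c * ‖z‖) ((1 - c) * ‖z‖) (by positivity)
      (mul_nonneg (by linarith) hc0) (by linarith)
    have hrad : x.radius j = ‖z‖ := by
      rw [StdTriangle.radius, StdTriangle.ofCoords_one, StdTriangle.ofCoords_two]
      ring
    have hr : r ∈ Set.Icc (-n) n := by
      have habs : |z.arg * (F.pair j).order φ / Real.pi| ≤ (F.pair j).order φ := by
        rw [abs_div, abs_mul, abs_of_pos hnR, abs_of_pos Real.pi_pos,
          div_le_iff₀ Real.pi_pos, mul_comm]
        exact mul_le_mul_of_nonneg_left (Complex.abs_arg_le_pi z) hnR.le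
      rw [← hrc, abs_le] at habs
      have hn1 : (1 : ℝ) ≤ (F.pair j).order φ := by exact_mod_cast (F.pair j).order_pos φ
      have hbd : -(n : ℝ) - 1 < r ∧ (r : ℝ) < n + 1 := by
        rw [hnn]
        cases b <;> simp only [InvolutionPair.angle, if_true, if_false, Bool.false_eq_true] at habs <;>
          constructor <;> linarith [habs.1, habs.2]
      have e1 : -n - 1 < r := by exact_mod_cast hbd.1
      have e2 : r < n + 1 := by exact_mod_cast hbd.2
      constructor <;> omega
    refine ⟨(⟨r, hr⟩, b, x), ?_⟩
    change F.sector j φ r b x = z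
    rw [sector, hrad]
    by_cases hz0 : z = 0
    · simp [hz0]
    · have hslope : x.slope j = c := by
        rw [StdTriangle.slope, hrad, StdTriangle.ofCoords_one, mul_div_assoc,
          div_self (norm_ne_zero_iff.2 hz0), mul_one]
      rw [hslope, hrc]
      have : Real.pi * (z.arg * (F.pair j).order φ / Real.pi) / (F.pair j).order φ = z.arg := by
        have := Real.pi_ne_zero
        field_simp
      rw [this]
      exact Complex.norm_mul_exp_arg_mul_I z
  · intro w w' h h'
    exact point_eq_iff_sector_eq ((hU w).1 h)

theorem exists_chart (P : F.Surface) : ∃ f : OpenPartialHomeomorph F.Surface (EuclideanHalfSpace 2),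
    P ∈ f.source ∧ ∀ Q ∈ f.source, 0 < (f Q).1 0 := by
  obtain ⟨φ, x, rfl⟩ := exists_point P
  obtain ⟨j, hj⟩ : ∃ j, 0 < x j := by
    by_contra h
    push Not at h
    have := x.sum_eq 0
    linarith [h 0, h (0 + 1), h (0 + 2)]
  obtain ⟨e⟩ := nonempty_star_homeomorph j φ
  obtain ⟨f, hf, hpos⟩ := exists_chart_of_homeomorph_disk (isOpen_star j φ) e
  refine ⟨f, ?_, ?_⟩
  · rw [hf]
    exact ⟨0, false, x, hj, by simp⟩
  · rw [hf]
    exact hpos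

noncomputable instance : ChartedSpace (EuclideanHalfSpace 2) F.Surface where
  atlas := Set.range fun P => (exists_chart P).choose
  chartAt P := (exists_chart P).choose
  mem_chart_source P := (exists_chart P).choose_spec.1
  chart_mem_atlas P := ⟨P, rfl⟩

/-- The charts were chosen with values in the interior of the half-plane, while a boundary point has
first coordinate zero in its preferred chart. -/
theorem surfaceBoundary_eq_empty : surfaceBoundary F.Surface = ∅ := by
  rw [Set.eq_empty_iff_forall_notMem]
  intro P hP
  have h1 : extChartAt (𝓡∂ 2) P P ∈ frontier (Set.range (𝓡∂ 2)) := hP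
  rw [frontier_range_modelWithCornersEuclideanHalfSpace] at h1
  have h2 : 0 < ((exists_chart P).choose P).1 0 :=
    (exists_chart P).choose_spec.2 P (exists_chart P).choose_spec.1
  have h3 : (0 : ℝ) = ((exists_chart P).choose P).1 0 := h1
  exact h2.ne h3

end Chart

end FlagSystem

/-! ### Faces of the triangle -/

theorem stdSimplex.map_apply {X Y : Type*} [Fintype X] [Fintype Y] {f : X → Y}
    (hf : Function.Injective f) (x : stdSimplex ℝ X) (k : X) : stdSimplex.map f x (f k) = x k := by
  classical
  rw [stdSimplex.map_coe, FunOnFinite.linearMap_apply_apply, Finset.sum_eq_single k]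
  · intro l hl hne
    exact absurd (hf (Finset.mem_filter.1 hl).2) hne
  · intro h
    exact absurd (by simp) h

theorem stdSimplex.map_apply_eq_zero {X Y : Type*} [Fintype X] [Fintype Y] {f : X → Y}
    (x : stdSimplex ℝ X) {i : Y} (hi : i ∉ Set.range f) : stdSimplex.map f x i = 0 := by
  classical
  rw [stdSimplex.map_coe, FunOnFinite.linearMap_apply_apply]
  refine Finset.sum_eq_zero fun k hk => ?_
  exact absurd ⟨k, (Finset.mem_filter.1 hk).2⟩ hi

theorem stdSimplex.map_injective {X Y : Type*} [Fintype X] [Fintype Y] {f : X → Y}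
    (hf : Function.Injective f) :
    Function.Injective (stdSimplex.map f : stdSimplex ℝ X → stdSimplex ℝ Y) := by
  intro x y h
  refine stdSimplex.ext (funext fun k => ?_)
  rw [← stdSimplex.map_apply hf x, h, stdSimplex.map_apply hf y]

namespace StdTriangle

/-- The sides containing a point in the interior of a face. -/
theorem zeros_map {n : ℕ} (f : Fin (n + 1) ↪o Fin 3) {y : stdSimplex ℝ (Fin (n + 1))}
    (hy : y ∈ openSimplex n) : zeros (stdSimplex.map f y) = (Set.range f)ᶜ := by
  ext i
  constructor
  · rintro hi ⟨k, rfl⟩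
    have h : stdSimplex.map f y (f k) = 0 := hi
    rw [stdSimplex.map_apply f.injective] at h
    exact (hy k).ne' h
  · exact fun hi => stdSimplex.map_apply_eq_zero y hi

theorem compl_range_subset_zeros {n : ℕ} (f : Fin (n + 1) ↪o Fin 3)
    (y : stdSimplex ℝ (Fin (n + 1))) : (Set.range f)ᶜ ⊆ zeros (stdSimplex.map f y) :=
  fun _ hi => stdSimplex.map_apply_eq_zero y hi

theorem exists_map_eq {n : ℕ} (f : Fin (n + 1) ↪o Fin 3) {x : StdTriangle}
    (hf : x.zeros = (Set.range f)ᶜ) : ∃ y ∈ openSimplex n, stdSimplex.map f y = x := by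
  have h0 : ∀ i, i ∉ Set.range f → x i = 0 := fun i hi => by
    have : i ∈ x.zeros := by rw [hf]; exact hi
    exact this
  have hsum : ∑ k, x (f k) = 1 := by
    rw [← stdSimplex.sum_eq_one x]
    exact Fintype.sum_of_injective f f.injective _ _ h0 fun _ => rfl
  refine ⟨⟨fun k => x (f k), fun k => stdSimplex.zero_le x _, hsum⟩, fun k => ?_, ?_⟩
  · have hk : f k ∉ x.zeros := by
      rw [hf]
      exact fun h => h ⟨k, rfl⟩
    exact lt_of_le_of_ne (stdSimplex.zero_le x _) (Ne.symm hk)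
  · refine stdSimplex.ext (funext fun i => ?_)
    by_cases hi : i ∈ Set.range f
    · obtain ⟨k, rfl⟩ := hi
      exact stdSimplex.map_apply f.injective _ k
    · exact (stdSimplex.map_apply_eq_zero _ hi).trans (h0 i hi).symm

/-- Every point lies in the interior of a face. -/
theorem exists_face (x : StdTriangle) :
    ∃ (n : ℕ) (f : Fin (n + 1) ↪o Fin 3), ∃ y ∈ openSimplex n, stdSimplex.map f y = x := by
  classical
  -- The support of `x` consists of the corners of the smallest face containing `x`; the dimension
  -- of this face is one less than their number.
  let s : Finset (Fin 3) := Finset.univ.filter fun i => x i ≠ 0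
  have hs : s.Nonempty := by
    by_contra h
    rw [Finset.not_nonempty_iff_eq_empty, Finset.filter_eq_empty_iff] at h
    have h1 := stdSimplex.sum_eq_one x
    rw [Finset.sum_eq_zero fun i hi => not_not.1 (h hi)] at h1
    exact zero_ne_one h1
  have hc : s.card = s.card - 1 + 1 := (Nat.sub_add_cancel hs.card_pos).symm
  refine ⟨s.card - 1, s.orderEmbOfFin hc, exists_map_eq _ ?_⟩
  rw [Finset.range_orderEmbOfFin]
  ext i
  change x i = 0 ↔ i ∉ (s : Set (Fin 3))
  simp [s]

end StdTriangle

/-- An order embedding into the numbers of the corners which misses one of them. -/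
theorem exists_eq_succAbove (f : Fin 2 ↪o Fin 3) : ∃ i, f = Fin.succAboveOrderEmb i := by
  obtain ⟨i, hi⟩ : ∃ i, i ∉ Set.range f := by
    by_contra! h
    have := Fintype.card_le_of_surjective f h
    simp at this
  refine ⟨i, OrderEmbedding.range_inj.1 (Set.eq_of_subset_of_ncard_le ?_ ?_)⟩
  · rintro _ ⟨k, rfl⟩
    rw [Fin.range_succAboveOrderEmb]
    rintro rfl
    exact hi ⟨k, rfl⟩
  · rw [Set.ncard_range_of_injective f.injective,
      Set.ncard_range_of_injective (Fin.succAboveOrderEmb i).injective]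

theorem compl_range_succAbove (i : Fin 3) :
    (Set.range (Fin.succAboveOrderEmb i : Fin 2 ↪o Fin 3))ᶜ = {i} := by
  rw [Fin.range_succAboveOrderEmb, compl_compl]

/-! ### The triangulation of the glued surface and its quiver -/

namespace FlagSystem

variable (F : FlagSystem)

/-- The cells of the surface: the faces of the triangles up to gluing. -/
abbrev Cell (n : ℕ) : Type := Σ f : Fin (n + 1) ↪o Fin 3, Quotient (F.adj (Set.range f)ᶜ)

variable {F}

/-- The characteristic map of a cell. -/
noncomputable def cellMap {n : ℕ} (c : F.Cell n) (y : stdSimplex ℝ (Fin (n + 1))) : F.Surface :=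
  F.point c.2.out (stdSimplex.map c.1 y)

/-- The face with corners in the range of `f` lies on exactly the sides with the remaining numbers.
Flags in the same class are glued along these sides, so the choice of a representative is
immaterial. -/
theorem cellMap_mk {n : ℕ} (f : Fin (n + 1) ↪o Fin 3) (φ : F.Flag)
    (y : stdSimplex ℝ (Fin (n + 1))) :
    cellMap (⟨f, Quotient.mk _ φ⟩ : F.Cell n) y = F.point φ (stdSimplex.map f y) :=
  point_eq_iff.2 ⟨rfl, adj_mono (StdTriangle.compl_range_subset_zeros f y)
    (Quotient.exact (Quotient.out_eq _))⟩

theorem continuous_cellMap {n : ℕ} (c : F.Cell n) : Continuous (cellMap c) :=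
  (continuous_point _).comp (stdSimplex.continuous_map _)

/-- Followed by `position`, the characteristic map is the inclusion of a face into the triangle,
which is an embedding. -/
theorem isEmbedding_cellMap {n : ℕ} (c : F.Cell n) :
    Topology.IsEmbedding ((openSimplex n).domRestrict (cellMap c)) := by
  have h1 : Topology.IsEmbedding
      (stdSimplex.map c.1 : stdSimplex ℝ (Fin (n + 1)) → StdTriangle) :=
    ((stdSimplex.continuous_map c.1).isClosedEmbedding
      (stdSimplex.map_injective c.1.injective)).isEmbedding
  exact Topology.IsEmbedding.of_comp ((continuous_cellMap c).comp continuous_subtype_val)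
    continuous_position (h1.comp Topology.IsEmbedding.subtypeVal)

/-- The vanishing coordinates of the position determine the face, and the gluing relation at this
position is exactly the equivalence of flags that defines the cells on this face. -/
theorem cell_ext {n m : ℕ} {c : F.Cell n} {d : F.Cell m} {x : stdSimplex ℝ (Fin (n + 1))}
    {y : stdSimplex ℝ (Fin (m + 1))} (hx : x ∈ openSimplex n) (hy : y ∈ openSimplex m)
    (h : cellMap c x = cellMap d y) : (⟨n, c⟩ : Σ n, F.Cell n) = ⟨m, d⟩ := by
  obtain ⟨f, o⟩ := c
  obtain ⟨f', o'⟩ := d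
  induction o using Quotient.inductionOn with
  | h φ =>
  induction o' using Quotient.inductionOn with
  | h φ' =>
  rw [cellMap_mk, cellMap_mk, point_eq_iff] at h
  obtain ⟨h1, h2⟩ := h
  have hr : Set.range f = Set.range f' := by
    rw [← compl_inj_iff, ← StdTriangle.zeros_map f hx, ← StdTriangle.zeros_map f' hy, h1]
  have hn : n = m := by
    have := congrArg Set.ncard hr
    rw [Set.ncard_range_of_injective f.injective, Set.ncard_range_of_injective f'.injective] at this
    simpa using this
  subst hn
  obtain rfl : f = f' := OrderEmbedding.range_inj.1 hr
  rw [StdTriangle.zeros_map f hx] at h2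
  rw [Quotient.sound h2]

theorem exists_cell (P : F.Surface) : ∃ (n : ℕ) (c : F.Cell n), ∃ y ∈ openSimplex n,
    cellMap c y = P := by
  obtain ⟨φ, x, rfl⟩ := exists_point P
  obtain ⟨n, f, y, hy, rfl⟩ := x.exists_face
  exact ⟨n, ⟨f, Quotient.mk _ φ⟩, y, hy, cellMap_mk f φ y⟩

theorem exists_cell_vertex {n : ℕ} (c : F.Cell n) (k : Fin (n + 1)) :
    ∃ p : F.Cell 0, cellMap c (stdSimplex.vertex k) ∈ Set.range (cellMap p) := by
  refine ⟨⟨OrderEmbedding.ofStrictMono (fun _ => c.1 k) (by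
    intro a b h
    omega),
    Quotient.mk _ c.2.out⟩, stdSimplex.vertex 0, ?_⟩
  rw [cellMap_mk, cellMap, stdSimplex.map_vertex, stdSimplex.map_vertex]
  rfl

/-- The cell of a triangle. -/
def triangle (φ : F.Flag) : F.Cell 2 := ⟨RelEmbedding.refl _, Quotient.mk _ φ⟩

theorem triangle_injective : Function.Injective (triangle (F := F)) := by
  intro φ φ' h
  have h1 : (F.adj (Set.range (RelEmbedding.refl (α := Fin 3) (· ≤ ·)))ᶜ) φ φ' :=
    Quotient.exact (eq_of_heq (Sigma.mk.inj_iff.1 h).2)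
  clear h
  induction h1 with
  | refl => rfl
  | tail _ h _ =>
    obtain ⟨i, hi, -⟩ := h
    exact absurd ⟨i, rfl⟩ hi

theorem exists_triangle_eq (t : F.Cell 2) : ∃ φ, t = triangle φ := by
  obtain ⟨f, o⟩ := t
  obtain rfl : f = RelEmbedding.refl _ := OrderEmbedding.range_inj.1
    ((Finite.surjective_of_injective f.injective).range_eq.trans Set.range_id.symm)
  induction o using Quotient.inductionOn with
  | h φ => exact ⟨φ, rfl⟩

theorem cellMap_triangle (φ : F.Flag) (x : StdTriangle) : cellMap (triangle φ) x = F.point φ x := by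
  rw [triangle, cellMap_mk]
  exact congrArg (F.point φ) (stdSimplex.map_id_apply x)

/-- The edge which is the `i`-th side of a triangle. -/
def edge (i : Fin 3) (φ : F.Flag) : F.Cell 1 := ⟨Fin.succAboveOrderEmb i, Quotient.mk _ φ⟩

theorem edge_eq_iff {i j : Fin 3} {φ φ' : F.Flag} :
    edge i φ = edge j φ' ↔ i = j ∧ (φ' = φ ∨ φ' = F.s i φ) := by
  constructor
  · intro h
    have h1 := (Sigma.mk.inj_iff.1 h).1
    have hij : i = j := by
      have := compl_range_succAbove i
      rw [h1, compl_range_succAbove] at this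
      exact (Set.singleton_injective this).symm
    subst hij
    have h2 := Quotient.exact (eq_of_heq (Sigma.mk.inj_iff.1 h).2)
    rw [compl_range_succAbove] at h2
    exact ⟨rfl, adj_singleton.1 h2⟩
  · rintro ⟨rfl, h⟩
    have h2 := adj_singleton.2 h
    rw [← compl_range_succAbove] at h2
    exact congrArg (Sigma.mk _) (Quotient.sound h2)

theorem exists_edge_eq (a : F.Cell 1) : ∃ i φ, a = edge i φ := by
  obtain ⟨f, o⟩ := a
  obtain ⟨i, rfl⟩ := exists_eq_succAbove f
  induction o using Quotient.inductionOn with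
  | h φ => exact ⟨i, φ, rfl⟩

/-- The sides of a triangle. -/
noncomputable def side (t : F.Cell 2) (i : Fin 3) : F.Cell 1 := edge i t.2.out

theorem side_triangle (φ : F.Flag) (i : Fin 3) : side (triangle φ) i = edge i φ := by
  have h : triangle (triangle φ).2.out = triangle φ :=
    congrArg (Sigma.mk _) (Quotient.out_eq _)
  rw [side, triangle_injective h]

theorem side_eq_iff {φ φ' : F.Flag} {i j : Fin 3} :
    side (triangle φ) j = edge i φ' ↔ j = i ∧ (φ = φ' ∨ φ = F.s i φ') := by
  rw [side_triangle, eq_comm, edge_eq_iff, eq_comm (a := i)]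

/-- Side `i` of `φ` is shared with `s i φ` only, and `s i` has no fixed points. -/
theorem card_side (a : F.Cell 1) :
    Nat.card {p : F.Cell 2 × Fin 3 // side p.1 p.2 = a} = 2 := by
  obtain ⟨i, φ, rfl⟩ := exists_edge_eq a
  rw [Nat.card_eq_two_iff]
  refine ⟨⟨(triangle φ, i), side_triangle φ i⟩,
    ⟨(triangle (F.s i φ), i), side_eq_iff.2 ⟨rfl, Or.inr rfl⟩⟩, ?_, ?_⟩
  · intro h
    exact F.s_ne i φ (triangle_injective (Prod.mk.inj (Subtype.ext_iff.1 h)).1).symm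
  · rw [Set.eq_univ_iff_forall]
    rintro ⟨⟨t, j⟩, h⟩
    obtain ⟨ψ, rfl⟩ := exists_triangle_eq t
    obtain ⟨h1, h2⟩ := side_eq_iff.1 h
    dsimp only at h1 h2
    subst h1
    rcases h2 with rfl | h2
    · exact Or.inl rfl
    · subst h2
      exact Or.inr rfl

theorem bijOn_side (t : F.Cell 2) (i : Fin 3) :
    Set.BijOn (cellMap t) (openSide i) (cellMap (side t i) '' openSimplex 1) := by
  obtain ⟨φ, rfl⟩ := exists_triangle_eq t
  rw [side_triangle]
  refine ⟨?_, ?_, ?_⟩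
  · rintro x ⟨h0, hpos⟩
    obtain ⟨y, hy, rfl⟩ := StdTriangle.exists_map_eq (Fin.succAboveOrderEmb i) (x := x) (by
      rw [compl_range_succAbove]
      ext j
      constructor
      · intro hj
        by_contra hji
        exact (hpos j hji).ne' hj
      · rintro rfl
        exact h0)
    refine ⟨y, hy, ?_⟩
    rw [edge, cellMap_mk, cellMap_triangle]
  · intro x _ y _ h
    rw [cellMap_triangle, cellMap_triangle] at h
    exact (point_eq_iff.1 h).1
  · rintro _ ⟨y, hy, rfl⟩
    refine ⟨stdSimplex.map (Fin.succAboveOrderEmb i) y, ?_, ?_⟩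
    · have h := StdTriangle.zeros_map (Fin.succAboveOrderEmb i) hy
      rw [compl_range_succAbove, Set.ext_iff] at h
      exact ⟨(h i).2 rfl, fun j hj => lt_of_le_of_ne (stdSimplex.zero_le _ j)
        fun h0 => hj ((h j).1 h0.symm)⟩
    · rw [edge, cellMap_mk, cellMap_triangle]

variable (F) in
/-- The triangulation of the surface. -/
noncomputable def triangulation : DirectedTriangulation F.Surface where
  Cell := F.Cell
  finite_cell _ := inferInstance
  isEmpty_cell n hn := ⟨fun c => by
    have := Fintype.card_le_of_injective c.1 c.1.injective
    simp only [Fintype.card_fin] at this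
    omega⟩
  φ _ := cellMap
  continuous_φ _ := continuous_cellMap
  isEmbedding_φ _ := isEmbedding_cellMap
  disjoint_cell := by
    intro c d hne
    rw [Set.disjoint_left]
    rintro _ ⟨x, hx, rfl⟩ ⟨y, hy, h⟩
    exact hne (cell_ext hy hx h).symm
  cover := by
    rw [Set.eq_univ_iff_forall]
    intro P
    obtain ⟨n, c, y, hy, rfl⟩ := exists_cell P
    exact Set.mem_iUnion.2 ⟨⟨n, c⟩, y, hy, rfl⟩
  edge_vertex := exists_cell_vertex
  triangle_vertex := exists_cell_vertex
  side := side
  bijOn_side := bijOn_side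
  -- Sides with different numbers are never glued, so no triangle is self-folded.
  self_folded t i j k hij _ _ h := absurd (edge_eq_iff.1 h).1 hij
  edge_cases a := Or.inl ⟨card_side a, fun h => by
    rw [surfaceBoundary_eq_empty] at h
    exact h ⟨stdSimplex.vertex 0, rfl⟩⟩
  two_le_card_edge := by
    obtain ⟨φ⟩ := F.nonempty
    -- The three sides of any one triangle are three different edges.
    have h : Function.Injective fun i : Fin 3 => edge i φ := fun i j h => (edge_eq_iff.1 h).1
    have := Nat.card_le_card_of_injective _ h
    rw [Nat.card_eq_fintype_card, Fintype.card_fin] at this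
    omega
  -- Every triangle is directed so that `f` leads from side `i` to side `i + 1`; no compatibility
  -- between neighbouring triangles is needed.
  orient _ := true

variable (F) in
/-- The arrow starting at the `i`-th side of a triangle. -/
noncomputable def arrow (i : Fin 3) (φ : F.Flag) : F.triangulation.quiver.Arr :=
  Sum.inl (triangle φ, i)

theorem arrow_inj {i j : Fin 3} {φ ψ : F.Flag} (h : F.arrow i φ = F.arrow j ψ) : i = j ∧ φ = ψ := by
  have h1 := Prod.mk.inj (Sum.inl_injective h)
  exact ⟨h1.2, triangle_injective h1.1⟩

theorem exists_arrow_eq (α : F.triangulation.quiver.Arr) : ∃ i φ, α = F.arrow i φ := by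
  rcases α with ⟨t, i⟩ | ⟨a, ha⟩
  · obtain ⟨φ, rfl⟩ := exists_triangle_eq t
    exact ⟨i, φ, rfl⟩
  · rw [surfaceBoundary_eq_empty] at ha
    exact absurd (ha ⟨stdSimplex.vertex 0, rfl⟩) (Set.notMem_empty _)

theorem src_arrow (i : Fin 3) (φ : F.Flag) :
    F.triangulation.quiver.src (F.arrow i φ) = edge i φ := side_triangle φ i

theorem bar_arrow (i : Fin 3) (φ : F.Flag) :
    F.triangulation.quiver.bar (F.arrow i φ) = F.arrow i (F.s i φ) := by
  refine (BiserialQuiver.eq_bar_of_ne ?_ ?_).symm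
  · rw [src_arrow, src_arrow]
    exact edge_eq_iff.2 ⟨rfl, Or.inr (F.s_s i φ).symm⟩
  · intro h
    exact F.s_ne i φ (arrow_inj h).2

/-- In geometric terms `g` passes to the next side and crosses it into the neighbouring triangle. -/
theorem g_arrow (i : Fin 3) (φ : F.Flag) :
    F.triangulation.quiver.g (F.arrow i φ) = F.arrow (i + 1) (F.s (i + 1) φ) := by
  have h : F.triangulation.quiver.f (F.arrow i φ) = F.arrow (i + 1) φ :=
    congrArg (fun j => (Sum.inl (triangle φ, j) : F.triangulation.Arrow)) (finRotate_apply i)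
  rw [BiserialQuiver.g, h, bar_arrow]

end FlagSystem

namespace FlagSystem

variable {F : FlagSystem}

/-- A weight function, given by its values on the arrows starting at sides with number `0`. -/
noncomputable def weight (m : F.Flag → ℕ) (pos : ∀ φ, 0 < m φ)
    (hm : ∀ φ, m (F.s 1 (F.s 2 (F.s 0 φ))) = m φ) : F.triangulation.quiver.Weight where
  -- Since `g` takes side 0 of `s 1 φ` to side 1 of `φ`, and side 1 of `s 2 φ` to side 2 of `φ`, the
  -- other two values are forced. The condition `hm` expresses invariance under the remaining step
  -- from side 2 to side 0. The default 1 concerns loops at boundary edges, which do not exist here.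
  m := Sum.elim (fun p => ![m p.1.2.out, m (F.s 1 p.1.2.out), m (F.s 1 (F.s 2 p.1.2.out))] p.2)
    fun _ => 1
  pos α := by
    rcases α with ⟨t, i⟩ | a
    · fin_cases i
      · exact pos _
      · exact pos _
      · exact pos _
    · exact Nat.one_pos
  orbit α := by
    have e : ∀ φ : F.Flag, (triangle φ).2.out = φ := fun φ =>
      triangle_injective (congrArg (Sigma.mk _) (Quotient.out_eq _))
    obtain ⟨i, φ, rfl⟩ := exists_arrow_eq α
    rw [g_arrow]
    change ![m (triangle _).2.out, m (F.s 1 (triangle _).2.out),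
      m (F.s 1 (F.s 2 (triangle _).2.out))] (i + 1) = ![m (triangle φ).2.out,
        m (F.s 1 (triangle φ).2.out), m (F.s 1 (F.s 2 (triangle φ).2.out))] i
    rw [e, e]
    fin_cases i
    · exact congrArg m (F.s_s 1 φ)
    · exact congrArg (fun ψ => m (F.s 1 ψ)) (F.s_s 2 φ)
    · have h := hm (F.s 0 φ)
      rw [F.s_s] at h
      exact h.symm

theorem weight_arrow (m : F.Flag → ℕ) (pos : ∀ φ, 0 < m φ)
    (hm : ∀ φ, m (F.s 1 (F.s 2 (F.s 0 φ))) = m φ) (φ : F.Flag) :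
    (weight m pos hm).m (F.arrow 0 φ) = m φ :=
  congrArg m (triangle_injective (congrArg (Sigma.mk _) (Quotient.out_eq _)))

theorem g_iterate_three (φ : F.Flag) : F.triangulation.quiver.g^[3] (F.arrow 0 φ) =
    F.arrow 0 (F.s 0 (F.s 2 (F.s 1 φ))) := by
  change F.triangulation.quiver.g (F.triangulation.quiver.g (F.triangulation.quiver.g _)) = _
  rw [g_arrow, g_arrow, g_arrow]
  rfl

theorem g_iterate_ne {l : ℕ} (h0 : 0 < l) (h3 : l < 3) (φ ψ : F.Flag) :
    F.triangulation.quiver.g^[l] (F.arrow 0 φ) ≠ F.arrow 0 ψ := by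
  obtain rfl | rfl : l = 1 ∨ l = 2 := by omega
  · change F.triangulation.quiver.g _ ≠ _
    rw [g_arrow]
    exact fun h => absurd (arrow_inj h).1 (by decide)
  · change F.triangulation.quiver.g (F.triangulation.quiver.g _) ≠ _
    rw [g_arrow, g_arrow]
    exact fun h => absurd (arrow_inj h).1 (by decide)

end FlagSystem

/-! ### The surface of a Brauer graph -/

namespace BrauerGraph

variable (Γ : BrauerGraph)

/-- The other half of an edge. -/
def swap : Equiv.Perm (Γ.Edge × Bool) where
  toFun h := (h.1, !h.2)
  invFun h := (h.1, !h.2)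
  left_inv _ := Prod.ext rfl (Bool.not_not _)
  right_inv _ := Prod.ext rfl (Bool.not_not _)

theorem swap_swap (h : Γ.Edge × Bool) : Γ.swap (Γ.swap h) = h := Γ.swap.left_inv h

/-- The involutions of the two triangles at every half-edge. The sides with number `2` are glued
in such a way that three steps of the permutation `g` lead to the next half-edge. -/
def involution : Fin 3 → (Γ.Edge × Bool) × Bool → (Γ.Edge × Bool) × Bool
  | 0, φ => (Γ.swap φ.1, φ.2)
  | 1, φ => (φ.1, !φ.2)
  | 2, (h, false) => (Γ.swap (Γ.next h), true)
  | 2, (h, true) => (Γ.next.symm (Γ.swap h), false)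

theorem involution_involution (i : Fin 3) (φ : (Γ.Edge × Bool) × Bool) :
    Γ.involution i (Γ.involution i φ) = φ := by
  obtain ⟨h, b⟩ := φ
  fin_cases i <;> cases b <;> simp [involution, swap_swap]

theorem involution_ne (i : Fin 3) (φ : (Γ.Edge × Bool) × Bool) : Γ.involution i φ ≠ φ := by
  obtain ⟨h, b⟩ := φ
  fin_cases i <;> cases b <;> simp [involution, swap, Prod.ext_iff]

/-- This dictates the choice of the second involution: together with `FlagSystem.g_iterate_three` it
turns three steps of `g` into one step of `next`. -/
theorem involution_next (h : Γ.Edge × Bool) :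
    Γ.involution 0 (Γ.involution 2 (Γ.involution 1 (h, true))) = (Γ.next h, true) := by
  simp [involution, swap_swap]

/-- The relation of having a common side. -/
def Adjacent (φ φ' : (Γ.Edge × Bool) × Bool) : Prop := ∃ i, φ' = Γ.involution i φ

theorem reflTransGen_symm {φ φ' : (Γ.Edge × Bool) × Bool}
    (h : Relation.ReflTransGen Γ.Adjacent φ φ') : Relation.ReflTransGen Γ.Adjacent φ' φ := by
  induction h with
  | refl => exact .refl
  | tail _ h ih =>
    obtain ⟨i, rfl⟩ := h
    exact .head ⟨i, (Γ.involution_involution i _).symm⟩ ih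

theorem reflTransGen_of_vert_eq {h h' : Γ.Edge × Bool} (hv : Γ.vert h = Γ.vert h') :
    Relation.ReflTransGen Γ.Adjacent (h, true) (h', true) := by
  have step : ∀ h, Relation.ReflTransGen Γ.Adjacent (h, true) (Γ.next h, true) := fun h => by
    rw [← involution_next]
    exact ((Relation.ReflTransGen.single ⟨1, rfl⟩).tail ⟨2, rfl⟩).tail ⟨0, rfl⟩
  obtain ⟨r, rfl⟩ := (Γ.sameCycle_next h h').2 hv
  clear hv
  induction r using Int.induction_on with
  | zero => exact .refl
  | succ n ih =>
    rw [add_comm, zpow_one_add]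
    exact ih.trans (step _)
  | pred n ih =>
    have h1 := step ((Γ.next ^ (-(n : ℤ) - 1)) h)
    rw [← Equiv.Perm.mul_apply, ← zpow_one_add, add_sub_cancel] at h1
    exact ih.trans (Γ.reflTransGen_symm h1)

/-- The three-step moves turn around a vertex of the graph, involution 0 passes to the other half of
an edge, and involution 1 joins the two triangles of a half-edge. Connectedness of the graph does
the rest. -/
theorem reflTransGen_adjacent (φ φ' : (Γ.Edge × Bool) × Bool) :
    Relation.ReflTransGen Γ.Adjacent φ φ' := by
  have key : ∀ h h' : Γ.Edge × Bool, Relation.ReflTransGen Γ.Adjacent (h, true) (h', true) := by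
    intro h h'
    have hc := Γ.connected (Γ.vert h) (Γ.vert h')
    generalize hv : Γ.vert h' = v at hc
    induction hc generalizing h' with
    | refl => exact Γ.reflTransGen_of_vert_eq hv.symm
    | tail _ hab ih =>
      obtain ⟨i, ε, ha, hb⟩ := hab
      exact ((ih (i, ε) ha).tail ⟨0, rfl⟩).trans (Γ.reflTransGen_of_vert_eq (hb.trans hv.symm))
  have flip : ∀ φ : (Γ.Edge × Bool) × Bool, Relation.ReflTransGen Γ.Adjacent φ (φ.1, true) := by
    rintro ⟨h, b⟩
    cases b
    · exact .single ⟨1, rfl⟩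
    · exact .refl
  exact ((flip φ).trans (key _ _)).trans (Γ.reflTransGen_symm (flip φ'))

/-- A surface glued from two triangles for every half-edge of the Brauer graph. -/
def flagSystem : FlagSystem where
  Flag := (Γ.Edge × Bool) × Bool
  nonempty := by
    have := Γ.nonempty_edge
    infer_instance
  s i := Function.Involutive.toPerm _ (Γ.involution_involution i)
  s_s := Γ.involution_involution
  s_ne := Γ.involution_ne
  connected := Γ.reflTransGen_adjacent

/-- The multiplicities of the vertices, and `1` for the additional triangles. -/
def flagMult (φ : Γ.flagSystem.Flag) : ℕ := bif φ.2 then Γ.mult (Γ.vert φ.1) else 1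

theorem flagMult_pos (φ : Γ.flagSystem.Flag) : 0 < Γ.flagMult φ := by
  obtain ⟨h, b⟩ := φ
  cases b
  · exact Nat.one_pos
  · exact Γ.mult_pos _

/-- The word is the inverse of the three-step return. It takes `(h, true)` to the triangle `true` of
the preceding half-edge at the same vertex, and it keeps the triangles `false` among themselves. -/
theorem flagMult_eq (φ : Γ.flagSystem.Flag) : Γ.flagMult
    (Γ.flagSystem.s 1 (Γ.flagSystem.s 2 (Γ.flagSystem.s 0 φ))) = Γ.flagMult φ := by
  obtain ⟨h, b⟩ := φ
  cases b
  · rfl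
  · have h1 : Γ.vert (Γ.next.symm h) = Γ.vert h := by
      rw [← Γ.vert_next, Equiv.apply_symm_apply]
    have h2 : Γ.vert (Γ.next.symm (Γ.swap (Γ.swap h))) = Γ.vert h := by rw [swap_swap, h1]
    exact congrArg Γ.mult h2

/-- The Brauer quiver in the quiver of the triangulated surface. -/
noncomputable def flagSystemFirstReturn : BiserialQuiver.FirstReturn Γ.toWeight
    (FlagSystem.weight Γ.flagMult Γ.flagMult_pos Γ.flagMult_eq) where
  onArr h := Γ.flagSystem.arrow 0 (h, true)
  -- The triangles `true` of the two halves of `i` are glued along their sides with number 0; this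
  -- common side stands for the edge `i`.
  onVert i := FlagSystem.edge (F := Γ.flagSystem) 0 ((i, true), true)
  time _ := 3
  onArr_injective h h' e := (Prod.mk.inj (FlagSystem.arrow_inj e).2).1
  onVert_injective i i' e := by
    rcases (FlagSystem.edge_eq_iff.1 e).2 with h | h
    · exact (congrArg (fun φ : (Γ.Edge × Bool) × Bool => φ.1.1) h).symm
    · exact absurd (congrArg (fun φ : (Γ.Edge × Bool) × Bool => φ.1.2) h) Bool.true_eq_false_eq_False
  src_onArr h := by
    refine (FlagSystem.src_arrow _ _).trans (FlagSystem.edge_eq_iff.2 ⟨rfl, ?_⟩)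
    obtain ⟨i, b⟩ := h
    cases b
    · exact Or.inr rfl
    · exact Or.inl rfl
  onArr_bar h := (congrArg (fun h' => Γ.flagSystem.arrow 0 (h', true)) (Γ.bar_eq h)).trans
    (FlagSystem.bar_arrow (F := Γ.flagSystem) 0 (h, true)).symm
  time_pos _ := Nat.succ_pos 2
  iterate_time h := by
    refine (FlagSystem.g_iterate_three _).trans ?_
    rw [g_eq]
    exact congrArg (Γ.flagSystem.arrow 0) (Γ.involution_next h)
  ne_onArr h l h0 h3 h' := FlagSystem.g_iterate_ne h0 h3 _ _
  weight h := FlagSystem.weight_arrow _ _ _ _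

end BrauerGraph

/-! ### The equivalence -/

theorem theorem1 (K : Type u) [Field K] [IsAlgClosed K]
    (A : Type v) [Ring A] [Algebra K A] [FiniteDimensional K A]
    (hbasic : IsBasicAlgebra K A) (hindec : IsIndecomposableAlgebra A)
    (hdim : 2 ≤ Module.finrank K A) :
    IsBrauerGraphAlgebra K A ↔
      ∃ (S : Type) (_ : TopologicalSpace S) (_ : T2Space S) (_ : CompactSpace S)
        (_ : ConnectedSpace S) (_ : ChartedSpace (EuclideanHalfSpace 2) S)
        (T : DirectedTriangulation S) (w : T.quiver.Weight)
        (e : T.quiver.BiserialAlgebra w K) (he : IsIdempotentElem e),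
        Nonempty (A ≃ₐ[K] he.Corner) := by
  constructor
  · rintro ⟨Γ, ⟨F⟩⟩
    obtain ⟨G⟩ := Γ.nonempty_algEquiv K
    exact ⟨Γ.flagSystem.Surface, inferInstance, inferInstance, inferInstance, inferInstance,
      inferInstance, Γ.flagSystem.triangulation, _, _,
      Γ.flagSystemFirstReturn.isIdempotentElem_idemSum K,
      ⟨(F.trans G).trans (Γ.flagSystemFirstReturn.algEquiv K)⟩⟩
  · rintro ⟨S, _, _, _, _, _, T, w, e, he, ⟨F⟩⟩
    exact BiserialQuiver.isBrauerGraphAlgebra_of_corner hindec he F
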